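/- There are a program $P$ for the read-only word-RAM and constants $c, C$ such that the following holds for every graph $G$ (finite, simple, undirected) with vertex set $\{0,\dots,n-1\}$, every $k \ge 0$, every $a$, and every word size $w$ with $c\log n \le w \le a\log n$ and $k<2^w$. Started on the instance $(G,k)$ of Feedback Vertex Set, $P$ halts after at most $C\,n^4 k\log k$ steps, uses at most $C a\,k^2\log n$ bits of working memory, and either returns a set $X$ of at most $3k^2$ vertices that is a feedback vertex set of $G$ (that is, $G-X$ is a forest), or answers that $(G,k)$ is a no-instance, in which case $G$ indeed has no feedback vertex set of at most $k$ vertices. In short: there is an $O(n^4k\log k)$-time, $O(k^2\log n)$-bit algorithm that either returns a feedback vertex set of at most $3k^2$ vertices or correctly reports a no-instance. Here the read-only word-RAM has a read-only input memory and a read-write working memory, both with constant-time random access, and executes arithmetic operations ($+,-,\cdot,/,\bmod$), bit shifts, comparisons and memory accesses on words of $w$ bits in one step each. The input consists of $n$, $k$ and the adjacency arrays of $G$, with the neighbours of each vertex in increasing order. The space in bits is $w$ times the number of registers and of cells of the working memory up to the last one accessed; the returned set $X$ is stored in the working memory. In the bounds, $\log x$ stands for $\lfloor\log_2(x+2)\rfloor$,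 the factor $n^4$ for $(n+1)^4$, and the factors $k$ and $k^2$ of the time and space bounds for $k+1$ and $(k+1)^2$, so that the bounds do not vanish for $n,k\le 1$. -/

import Mathlib

/-! Feedback vertex sets, and the read-only word-RAM with unit-cost instructions. -/

namespace ROWordRAM

/-- A set `F` of vertices is a feedback vertex set of `G` if `G - F` is a forest. -/
def IsFeedbackVertexSet {V : Type*} (G : SimpleGraph V) (F : Set V) : Prop :=
  (G.induce Fᶜ).IsAcyclic

/-- `(G, k)` is a yes-instance: there is a feedback vertex set with at most `k` vertices. -/
def IsYesInstance {V : Type*} (G : SimpleGraph V) (k : ℕ) : Prop :=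
  ∃ F : Finset V, F.card ≤ k ∧ IsFeedbackVertexSet G (F : Set V)

/-- Arithmetic and bit-shift operations on words. -/
inductive Op
  | add | sub | mul | div | mod | shl | shr

/-- The value of an operation on words of `w` bits. Addition, subtraction, multiplication and
left shift are taken modulo `2 ^ w`. -/
def Op.eval (w : ℕ) : Op → ℕ → ℕ → ℕ
  | .add, x, y => (x + y) % 2 ^ w
  | .sub, x, y => (x + (2 ^ w - y)) % 2 ^ w
  | .mul, x, y => (x * y) % 2 ^ w
  | .div, x, y => x / y
  | .mod, x, y => x % y
  | .shl, x, y => (x * 2 ^ y) % 2 ^ w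
  | .shr, x, y => x / 2 ^ y

/-- Comparisons of words. -/
inductive Cmp
  | lt | le | eq | ne

/-- The meaning of a comparison. -/
def Cmp.holds : Cmp → ℕ → ℕ → Prop
  | .lt, x, y => x < y
  | .le, x, y => x ≤ y
  | .eq, x, y => x = y
  | .ne, x, y => x ≠ y

/-- Programs. All arguments except the literal of `const` are indices of registers. There is an
instruction that reads the input memory, but none that writes to it. -/
inductive Prog
  /-- do nothing -/
  | skip
  /-- put a literal into register `r` -/
  | const (r c : ℕ)
  /-- put the result of an operation on registers `x`, `y` into register `r` -/
  | op (o : Op) (r x y : ℕ)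
  /-- put into `r` the word of the input memory at the address in register `x` -/
  | read (r x : ℕ)
  /-- put into `r` the word of the working memory at the address in register `x` -/
  | load (r x : ℕ)
  /-- write register `y` to the working memory at the address in register `x` -/
  | store (x y : ℕ)
  /-- sequential composition -/
  | seq (p q : Prog)
  /-- branch on a comparison of registers `x`, `y` -/
  | ite (b : Cmp) (x y : ℕ) (p q : Prog)
  /-- repeat `p` as long as the comparison of registers `x`, `y` holds -/
  | loop (b : Cmp) (x y : ℕ) (p : Prog)

/-- Number of registers of a program: one more than the largest index of a register in it. -/
def Prog.numRegs : Prog → ℕ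
  | .skip => 0
  | .const r _ => r + 1
  | .op _ r x y => max r (max x y) + 1
  | .read r x => max r x + 1
  | .load r x => max r x + 1
  | .store x y => max x y + 1
  | .seq p q => max p.numRegs q.numRegs
  | .ite _ x y p q => max (max x y + 1) (max p.numRegs q.numRegs)
  | .loop _ x y p => max (max x y + 1) p.numRegs

/-- Registers, working memory, and the high-water mark `top` of the working memory: every cell
that has been accessed so far has an address smaller than `top`. -/
structure State where
  reg : ℕ → ℕ
  mem : ℕ → ℕ
  top : ℕ

/-- The state with all registers and all cells zero, and no cell accessed. -/
def State.init : State := ⟨fun _ => 0, fun _ => 0, 0⟩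

/-- Write `v` to register `r`. -/
def State.setReg (s : State) (r v : ℕ) : State :=
  { s with reg := Function.update s.reg r v }

/-- Record an access to the cell with address `a`. -/
def State.touch (s : State) (a : ℕ) : State :=
  { s with top := max s.top (a + 1) }

/-- Write `v` to the cell with address `a`. -/
def State.setMem (s : State) (a v : ℕ) : State :=
  { s with mem := Function.update s.mem a v }

/-- `Exec w inp p s s' t`: with word size `w` and contents `inp` of the read-only input memory, the
program `p` started in `s` halts in `s'` after exactly `t` steps. Every instruction and every
evaluation of a comparison is one step. -/
inductive Exec (w : ℕ) (inp : List ℕ) : Prog → State → State → ℕ → Prop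
  | skip (s : State) : Exec w inp .skip s s 1
  | const (s : State) (r c : ℕ) :
      Exec w inp (.const r c) s (s.setReg r (c % 2 ^ w)) 1
  | op (s : State) (o : Op) (r x y : ℕ) :
      Exec w inp (.op o r x y) s (s.setReg r (o.eval w (s.reg x) (s.reg y))) 1
  | read (s : State) (r x : ℕ) :
      Exec w inp (.read r x) s (s.setReg r (inp.getD (s.reg x) 0 % 2 ^ w)) 1
  | load (s : State) (r x : ℕ) :
      Exec w inp (.load r x) s ((s.touch (s.reg x)).setReg r (s.mem (s.reg x))) 1
  | store (s : State) (x y : ℕ) :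
      Exec w inp (.store x y) s ((s.touch (s.reg x)).setMem (s.reg x) (s.reg y)) 1
  | seq {p q : Prog} {s s₁ s₂ : State} {t₁ t₂ : ℕ} :
      Exec w inp p s s₁ t₁ → Exec w inp q s₁ s₂ t₂ → Exec w inp (.seq p q) s s₂ (t₁ + t₂)
  | iteTrue {b : Cmp} {x y : ℕ} {p q : Prog} {s s₁ : State} {t : ℕ} :
      b.holds (s.reg x) (s.reg y) → Exec w inp p s s₁ t →
        Exec w inp (.ite b x y p q) s s₁ (t + 1)
  | iteFalse {b : Cmp} {x y : ℕ} {p q : Prog} {s s₁ : State} {t : ℕ} :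
      ¬ b.holds (s.reg x) (s.reg y) → Exec w inp q s s₁ t →
        Exec w inp (.ite b x y p q) s s₁ (t + 1)
  | loopTrue {b : Cmp} {x y : ℕ} {p : Prog} {s s₁ s₂ : State} {t₁ t₂ : ℕ} :
      b.holds (s.reg x) (s.reg y) → Exec w inp p s s₁ t₁ →
        Exec w inp (.loop b x y p) s₁ s₂ t₂ → Exec w inp (.loop b x y p) s s₂ (t₁ + t₂ + 1)
  | loopFalse {b : Cmp} {x y : ℕ} {p : Prog} {s : State} :
      ¬ b.holds (s.reg x) (s.reg y) → Exec w inp (.loop b x y p) s s 1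

/-- Space in bits of a run of `p` that ends in `s`: the registers and the used part of the working
memory, with `w` bits each. -/
def spaceBits (w : ℕ) (p : Prog) (s : State) : ℕ := (p.numRegs + s.top) * w

open Classical in
/-- The neighbours of `v` in increasing order. -/
noncomputable def neighborList {n : ℕ} (G : SimpleGraph (Fin n)) (v : Fin n) : List (Fin n) :=
  (List.finRange n).filter (fun u => G.Adj v u)

/-- Adjacency-array representation of the instance `(G, k)`: the words `n` and `k`, then `n + 1`
words of which the `i`-th (`i = 0, …, n`) is the address at which the neighbours of vertex `i` begin
(and those of vertex `i - 1` have ended), then the neighbours of `0`, of `1`, …, of `n - 1`. -/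
noncomputable def encode {n : ℕ} (G : SimpleGraph (Fin n)) (k : ℕ) : List ℕ :=
  [n, k] ++
    (List.range (n + 1)).map
      (fun i => n + 3 + (((List.finRange n).take i).flatMap (neighborList G)).length) ++
    ((List.finRange n).flatMap (neighborList G)).map (fun u => (u : ℕ))

/-- The program has answered "no-instance": register `0` holds `0`. -/
def AnswersNo (s : State) : Prop := s.reg 0 = 0

/-- The program has returned `X`: register `0` holds `1`, and the cells `0, …, ℓ - 1` of the working
memory, where `ℓ` is the content of register `1`, list the vertices in `X`. -/
def Returns {n : ℕ} (s : State) (X : Finset (Fin n)) : Prop :=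
  s.reg 0 = 1 ∧ (Finset.range (s.reg 1)).image s.mem = X.map Fin.valEmbedding

/-- Binary logarithm, at least `1`. -/
def lg (x : ℕ) : ℕ := Nat.log 2 (x + 2)

end ROWordRAM

/-! The algorithm grows a set X, starting from the empty set, for at most k rounds. In a round let W
be the complement of X and K the 2-core of G[W], which is what survives the repeated removal of
vertices of degree at most one. If K is empty, G[W] is a forest and X is returned. Otherwise T,
consisting of 3k vertices of largest degree in K (or of all of K, if it has fewer), is added to X.
Each round decreases the least size of a feedback vertex set of what remains, provided that this
size is at most k (`exists_smaller_feedback`). Hence a core that is still nonempty after k rounds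
proves a no-instance, and X never exceeds 3k² vertices.

The decrease has two cases. If all degrees in T are at least three, a count of degrees in K shows
that a feedback vertex set F with at most k vertices must meet T, so F \ T does for the rest
(`not_disjoint_of_three_le`). If T has a vertex of degree two, then every vertex of K outside T has
degree two as well. Deleting T then destroys all cycles in one component of K, and a vertex that F
spends there can be saved (`isForestOn_of_two`).

There is no room to store the core, so degrees in it are recomputed. The degree of v counts the
neighbours u such that the part of G[W] hanging at u, seen from v, is not a tree (`coreDeg_eq`).
This is tested by the contour walk that leaves v for u and always takes the next edge in cyclic
order. The part is a tree exactly when, until the walk is back at v, every return to a vertex y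
comes from the neighbour to which y was last left (`dangling_iff_forall_not_mismatch`). To check
this with constantly many words, the walk is repeated for each y. Beyond that, the memory holds only
X as a sorted array of at most 3k² cells and a list of at most 3k candidates.

For the time, let M be the sum of all degrees. A walk has at most M steps, each with binary searches
of cost O(log n); there are n walks for each of M darts, so a round costs O(M²n log n) up to smaller
terms. If M > 2(k+1)n, the instance is a no-instance (`not_solvable_of_lt`); if n ≤ 3k², all
vertices may be returned. Otherwise the total is O(k³n³ log n), and k² log n = O(n log k) because
3k² < n (`sq_mul_lg_le`), up to the shifts that keep the bounds positive. -/

namespace ROWordRAM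

set_option linter.unusedSectionVars false

/-! ### The 2-core, and why a round makes progress -/

section Core

open scoped Classical

variable {V : Type*} [DecidableEq V] (G : SimpleGraph V)

/-- The neighbours of `v` in `S`. -/
noncomputable def nbrs (S : Finset V) (v : V) : Finset V := S.filter (G.Adj v)

variable {G} in
theorem mem_nbrs {S : Finset V} {v u : V} : u ∈ nbrs G S v ↔ u ∈ S ∧ G.Adj v u := by
  simp [nbrs]

/-- Every nonempty set of vertices in `W` induces a subgraph with a vertex of degree at most one. -/
def IsForestOn (W : Finset V) : Prop :=
  ∀ S ⊆ W, S.Nonempty → ∃ v ∈ S, (nbrs G S v).card ≤ 1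

/-- In the graph induced by `W`, what hangs at `u`, as seen from its neighbour `v`, is a tree. -/
inductive Dangling (W : Finset V) : V → V → Prop
  | intro (v u : V) : (∀ w ∈ W, G.Adj u w → w ≠ v → Dangling W u w) → Dangling W v u

/-- Number of neighbours of `v` in `W` at which no tree is dangling. -/
noncomputable def coreDeg (W : Finset V) (v : V) : ℕ :=
  (W.filter (fun u => G.Adj v u ∧ ¬ Dangling G W v u)).card

/-- The vertices that survive when vertices of degree at most one are removed repeatedly. -/
noncomputable def core (W : Finset V) : Finset V := W.filter (fun v => 2 ≤ coreDeg G W v)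

variable {G}

theorem mem_core {W : Finset V} {v : V} : v ∈ core G W ↔ v ∈ W ∧ 2 ≤ coreDeg G W v := by
  simp [core]

theorem core_subset (W : Finset V) : core G W ⊆ W := Finset.filter_subset _ _

/-- Inside S one can always go on without turning back, whereas `Dangling` is well founded. -/
theorem not_dangling_of_mem {W S : Finset V} (hS : S ⊆ W)
    (h2 : ∀ v ∈ S, 2 ≤ (nbrs G S v).card) {v u : V} (hu : u ∈ S) : ¬ Dangling G W v u := by
  intro h
  induction h with
  | intro v u _ ih =>
    obtain ⟨w, hw, hwv⟩ := Finset.exists_mem_ne (h2 u hu) v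
    rw [mem_nbrs] at hw
    exact ih w (hS hw.1) hw.2 hwv hw.1

theorem subset_core {W S : Finset V} (hS : S ⊆ W) (h2 : ∀ v ∈ S, 2 ≤ (nbrs G S v).card) :
    S ⊆ core G W := by
  intro v hv
  refine mem_core.2 ⟨hS hv, (h2 v hv).trans (Finset.card_le_card fun u hu => ?_)⟩
  rw [mem_nbrs] at hu
  exact Finset.mem_filter.2 ⟨hS hu.1, hu.2, not_dangling_of_mem hS h2 hu.1⟩

theorem exists_not_dangling {W : Finset V} {v u : V} (h : ¬ Dangling G W v u) :
    ∃ w ∈ W, G.Adj u w ∧ w ≠ v ∧ ¬ Dangling G W u w := by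
  by_contra! hc
  exact h (.intro v u hc)

theorem exists_not_dangling_of_core {W : Finset V} {v : V} (hv : v ∈ core G W) (u : V) :
    ∃ w ∈ W, G.Adj v w ∧ w ≠ u ∧ ¬ Dangling G W v w := by
  obtain ⟨w, hw, hwu⟩ := Finset.exists_mem_ne (mem_core.1 hv).2 u
  simp only [Finset.mem_filter] at hw
  exact ⟨w, hw.1, hw.2.1, hwu, hw.2.2⟩

/-- A core vertex, entered from any side, has a further neighbour at which no tree dangles. So v
serves as one of the two such neighbours of u, the other being a continuation beyond u; conversely a
core vertex u always offers a continuation. -/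
theorem not_dangling_iff_mem_core {W : Finset V} {v u : V} (hv : v ∈ core G W) (hu : u ∈ W)
    (hvu : G.Adj v u) : ¬ Dangling G W v u ↔ u ∈ core G W := by
  constructor
  · intro h
    obtain ⟨w, hw, huw, hwv, hd⟩ := exists_not_dangling h
    refine mem_core.2 ⟨hu, Finset.one_lt_card.2 ⟨w, ?_, v, ?_, hwv⟩⟩
    · exact Finset.mem_filter.2 ⟨hw, huw, hd⟩
    · refine Finset.mem_filter.2 ⟨core_subset W hv, hvu.symm, ?_⟩
      rintro ⟨_, _, h'⟩
      obtain ⟨x, hx, hvx, hxu, hd'⟩ := exists_not_dangling_of_core hv u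
      exact hd' (h' x hx hvx hxu)
  · rintro h ⟨_, _, h'⟩
    obtain ⟨x, hx, hvx, hxu, hd'⟩ := exists_not_dangling_of_core h v
    exact hd' (h' x hx hvx hxu)

theorem coreDeg_eq {W : Finset V} {v : V} (hv : v ∈ core G W) :
    coreDeg G W v = (nbrs G (core G W) v).card := by
  unfold coreDeg
  congr 1
  ext u
  simp only [Finset.mem_filter, mem_nbrs]
  constructor
  · rintro ⟨hu, hvu, hd⟩
    exact ⟨(not_dangling_iff_mem_core hv hu hvu).1 hd, hvu⟩
  · rintro ⟨hu, hvu⟩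
    exact ⟨core_subset W hu, hvu, (not_dangling_iff_mem_core hv (core_subset W hu) hvu).2 hu⟩

theorem IsForestOn.mono {W W' : Finset V} (h : IsForestOn G W) (hW : W' ⊆ W) : IsForestOn G W' :=
  fun S hS hn => h S (hS.trans hW) hn

theorem isForestOn_sdiff_core (W : Finset V) : IsForestOn G (W \ core G W) := by
  intro S hS hn
  by_contra! h
  obtain ⟨v, hv⟩ := hn
  have := subset_core (hS.trans Finset.sdiff_subset) (fun v hv => h v hv) hv
  exact (Finset.mem_sdiff.1 (hS hv)).2 this

theorem isForestOn_iff_core_eq_empty {W : Finset V} : IsForestOn G W ↔ core G W = ∅ := by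
  constructor
  · intro h
    by_contra hne
    obtain ⟨v, hv, hd⟩ := h _ (core_subset W) (Finset.nonempty_iff_ne_empty.2 hne)
    have := (mem_core.1 hv).2
    rw [coreDeg_eq hv] at this
    omega
  · intro h
    have := isForestOn_sdiff_core (G := G) W
    rwa [h, Finset.sdiff_empty] at this

theorem card_nbrs_disjUnion {S T : Finset V} (h : Disjoint S T) (v : V) :
    (nbrs G (S ∪ T) v).card = (nbrs G S v).card + (nbrs G T v).card := by
  unfold nbrs
  rw [Finset.filter_union, Finset.card_union_of_disjoint (Finset.disjoint_filter_filter h)]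

theorem sum_card_nbrs_comm (S T : Finset V) :
    ∑ v ∈ S, (nbrs G T v).card = ∑ v ∈ T, (nbrs G S v).card := by
  have := Finset.sum_card_bipartiteAbove_eq_sum_card_bipartiteBelow (s := S) (t := T) G.Adj
  simpa [Finset.bipartiteAbove, Finset.bipartiteBelow, nbrs, G.adj_comm] using this

theorem sum_card_nbrs_union {S T : Finset V} (h : Disjoint S T) :
    ∑ v ∈ S ∪ T, (nbrs G (S ∪ T) v).card =
      ∑ v ∈ S, (nbrs G S v).card + 2 * ∑ v ∈ T, (nbrs G S v).card +
        ∑ v ∈ T, (nbrs G T v).card := by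
  rw [Finset.sum_union h]
  simp only [card_nbrs_disjUnion h, Finset.sum_add_distrib]
  rw [sum_card_nbrs_comm S T]
  ring

/-- Removing a vertex of degree at most one lowers the degree sum by at most two and the right-hand
side by exactly two. -/
theorem IsForestOn.sum_card_nbrs_le {W : Finset V} (h : IsForestOn G W) :
    ∀ S ⊆ W, S.Nonempty → ∑ v ∈ S, (nbrs G S v).card + 2 ≤ 2 * S.card := by
  intro S
  induction S using Finset.strongInduction with
  | H S ih =>
    intro hS hn
    obtain ⟨v, hv, hd⟩ := h S hS hn
    have hself : nbrs G {v} v = ∅ := by ext u; simp +contextual [mem_nbrs]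
    have hdis : Disjoint (S.erase v) {v} := by simp
    have hun : S.erase v ∪ {v} = S := by
      rw [Finset.union_comm, ← Finset.insert_eq, Finset.insert_erase hv]
    have hsum := sum_card_nbrs_union (G := G) hdis
    have hdeg := card_nbrs_disjUnion (G := G) hdis v
    rw [hun] at hsum hdeg
    simp only [Finset.sum_singleton, hself, Finset.card_empty] at hsum hdeg
    have hcard := Finset.card_erase_add_one hv
    rcases (S.erase v).eq_empty_or_nonempty with he | he
    · have h0 : (nbrs G ∅ v).card = 0 := by simp [nbrs]
      rw [he] at hsum hcard
      rw [Finset.sum_empty, h0] at hsum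
      rw [Finset.card_empty] at hcard
      omega
    · have := ih _ (Finset.erase_ssubset hv) ((Finset.erase_subset _ _).trans hS) he
      omega

/-- Every edge in S that is not inside S \ F has an end in F, and contributes two to the degree sum
of S. -/
theorem sum_card_nbrs_le_sdiff (S F : Finset V) :
    ∑ v ∈ S, (nbrs G S v).card ≤
      ∑ v ∈ S \ F, (nbrs G (S \ F) v).card + 2 * ∑ v ∈ S ∩ F, (nbrs G S v).card := by
  have hdis : Disjoint (S \ F) (S ∩ F) := Finset.disjoint_sdiff_inter S F
  have hsum := sum_card_nbrs_union (G := G) hdis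
  have hdeg := fun v => card_nbrs_disjUnion (G := G) hdis v
  rw [Finset.sdiff_union_inter] at hsum hdeg
  simp only [hdeg, Finset.sum_add_distrib] at hsum ⊢
  omega

/-- The forest outside F accounts for at most 2|U|, and each of the at most k vertices of F for at
most 2|U| more. This justifies rejecting dense graphs at once. -/
theorem sum_card_nbrs_le_of_feedback {U F : Finset V} {k : ℕ} (hF : F.card ≤ k)
    (h : IsForestOn G (U \ F)) : ∑ v ∈ U, (nbrs G U v).card ≤ 2 * ((k + 1) * U.card) := by
  have h1 := sum_card_nbrs_le_sdiff (G := G) U F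
  have h2 : ∑ v ∈ U ∩ F, (nbrs G U v).card ≤ k * U.card := by
    refine (Finset.sum_le_card_nsmul _ _ U.card
      fun v _ => Finset.card_le_card (Finset.filter_subset _ _)).trans ?_
    exact Nat.mul_le_mul_right _ ((Finset.card_le_card Finset.inter_subset_right).trans hF)
  have h3 : ∑ v ∈ U \ F, (nbrs G (U \ F) v).card ≤ 2 * U.card := by
    rcases (U \ F).eq_empty_or_nonempty with he | he
    · simp [he]
    · have := h.sum_card_nbrs_le _ subset_rfl he
      have := Finset.card_le_card (Finset.sdiff_subset (s := U) (t := F))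
      omega
  nlinarith

theorem sdiff_ssubset_of_not_disjoint {S T : Finset V} (h : ¬ Disjoint S T) : S \ T ⊂ S := by
  obtain ⟨x, hx, hxT⟩ := Finset.not_disjoint_iff.1 h
  exact ⟨Finset.sdiff_subset, fun hs => (Finset.mem_sdiff.1 (hs hx)).2 hxT⟩

/-- A feedback vertex set with at most `k` vertices meets any `3 k` vertices of largest degree in
the core, if these degrees are at least three. -/
theorem not_disjoint_of_three_le {W F T : Finset V} {k : ℕ} (hF : F.card ≤ k)
    (h : IsForestOn G (W \ F)) (hT : T ⊆ core G W) (hne : T.Nonempty) (hcard : T.card = 3 * k)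
    (htop : ∀ v ∈ T, ∀ x ∈ core G W, x ∉ T → coreDeg G W x ≤ coreDeg G W v)
    (h3 : ∀ v ∈ T, 3 ≤ coreDeg G W v) : ¬ Disjoint F T := by
  intro hdis
  set K := core G W with hK
  have hdeg : ∀ v ∈ K, (nbrs G K v).card = coreDeg G W v := fun v hv => (coreDeg_eq hv).symm
  obtain ⟨b, hb, hmin⟩ := Finset.exists_min_image T (coreDeg G W) hne
  have hTF : T ⊆ K \ F := fun v hv =>
    Finset.mem_sdiff.2 ⟨hT hv, fun hvF => Finset.disjoint_left.1 hdis hvF hv⟩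
  have h1 := sum_card_nbrs_le_sdiff (G := G) K F
  have h2 := (h.mono (Finset.sdiff_subset_sdiff (core_subset W) le_rfl)).sum_card_nbrs_le _
    subset_rfl (hne.mono hTF)
  rw [Finset.sum_congr rfl hdeg, Finset.sum_congr rfl (fun v hv => hdeg v (Finset.mem_inter.1 hv).1)]
    at h1
  have hsplit : ∑ v ∈ K, coreDeg G W v =
      ∑ v ∈ T, coreDeg G W v + ∑ v ∈ (K \ F) \ T, coreDeg G W v +
        ∑ v ∈ K ∩ F, coreDeg G W v := by
    rw [← Finset.sum_inter_add_sum_sdiff K F, add_comm, ← Finset.sum_sdiff hTF]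
    ring
  have hTsum : T.card * coreDeg G W b ≤ ∑ v ∈ T, coreDeg G W v :=
    Finset.card_nsmul_le_sum T (coreDeg G W) _ hmin
  have hRsum : ((K \ F) \ T).card * 2 ≤ ∑ v ∈ (K \ F) \ T, coreDeg G W v := by
    refine Finset.card_nsmul_le_sum _ (coreDeg G W) _ fun v hv => ?_
    exact (mem_core.1 (Finset.mem_sdiff.1 (Finset.mem_sdiff.1 hv).1).1).2
  have hFsum : ∑ v ∈ K ∩ F, coreDeg G W v ≤ (K ∩ F).card * coreDeg G W b := by
    refine Finset.sum_le_card_nsmul _ (coreDeg G W) _ fun v hv => ?_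
    rw [Finset.mem_inter] at hv
    exact htop b hb v hv.1 fun hvT => Finset.disjoint_left.1 hdis hv.2 hvT
  have hc := Finset.card_sdiff_add_card_eq_card hTF
  have hFk : (K ∩ F).card ≤ k := (Finset.card_le_card Finset.inter_subset_right).trans hF
  have hb3 := h3 b hb
  have hFk' := Nat.mul_le_mul_right (coreDeg G W b) hFk
  rw [hcard] at hTsum hc
  -- With b the smallest degree in T, the counts give 3kb + 2(|K \ F| - 3k) + 2 ≤ 2|K \ F| + kb,
  -- that is 2kb + 2 ≤ 6k, which contradicts b ≥ 3.
  have : 3 * k ≤ k * coreDeg G W b := by nlinarith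
  nlinarith

/-- Let Q be the component of v in the core. It has minimum degree two, so F meets it, and F \ Q is
smaller than F. A subgraph S of minimum degree two avoiding T and F \ Q lies in the core. All its
vertices have core degree two, so it is a union of components of the core. It meets F, hence Q,
hence it contains v, although v is in T. -/
theorem isForestOn_of_two {W F T : Finset V} {v : V} (hT : T ⊆ core G W) (hv : v ∈ T)
    (h : IsForestOn G (W \ F)) (h2 : ∀ x ∈ core G W, x ∉ T → coreDeg G W x = 2) :
    ∃ F' ⊂ F, IsForestOn G ((W \ T) \ F') := by
  set K := core G W with hK
  let R : V → V → Prop := fun a b => G.Adj a b ∧ b ∈ K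
  let Q := K.filter (fun x => Relation.ReflTransGen R v x)
  have hvQ : v ∈ Q := Finset.mem_filter.2 ⟨hT hv, .refl⟩
  have hQdeg : ∀ x ∈ Q, 2 ≤ (nbrs G Q x).card := by
    intro x hx
    have hxK := (Finset.mem_filter.1 hx).1
    have : nbrs G Q x = nbrs G K x := by
      ext y
      simp only [mem_nbrs, Q, Finset.mem_filter]
      constructor
      · rintro ⟨⟨h1, _⟩, h3⟩
        exact ⟨h1, h3⟩
      · rintro ⟨h1, h3⟩
        exact ⟨⟨h1, (Finset.mem_filter.1 hx).2.tail ⟨h3, h1⟩⟩, h3⟩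
    rw [this, ← coreDeg_eq hxK]
    exact (mem_core.1 hxK).2
  have hex : ∃ f ∈ F, f ∈ Q := by
    by_contra! hc
    obtain ⟨x, hx, hd⟩ := h Q (fun x hx => Finset.mem_sdiff.2
      ⟨core_subset W (Finset.mem_filter.1 hx).1, fun hF => hc x hF hx⟩) ⟨v, hvQ⟩
    have := hQdeg x hx
    omega
  obtain ⟨f, hf, hfQ⟩ := hex
  refine ⟨F \ Q, sdiff_ssubset_of_not_disjoint (Finset.not_disjoint_iff.2 ⟨f, hf, hfQ⟩), ?_⟩
  intro S hS hn
  by_contra! hc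
  have hSW : S ⊆ W := hS.trans (Finset.sdiff_subset.trans Finset.sdiff_subset)
  have hST : ∀ x ∈ S, x ∉ T := fun x hx => by
    have := hS hx
    simp only [Finset.mem_sdiff] at this
    exact this.1.2
  have hSK : S ⊆ K := subset_core hSW fun v hv => hc v hv
  have hSnb : ∀ x ∈ S, nbrs G S x = nbrs G K x := by
    intro x hx
    refine Finset.eq_of_subset_of_card_le
      (Finset.filter_subset_filter _ hSK) ?_
    rw [← coreDeg_eq (hSK hx), h2 x (hSK hx) (hST x hx)]
    exact hc x hx
  -- By `hSnb` no edge of the core leaves S, so membership in S is constant along walks in the core.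
  have hclosed : ∀ x y, Relation.ReflTransGen R x y → x ∈ K → (x ∈ S ↔ y ∈ S) := by
    intro x y hxy hxK
    induction hxy with
    | refl => rfl
    | tail hab hbc ih =>
      rename_i b c
      have hbK : b ∈ K := by
        rcases Relation.ReflTransGen.cases_tail hab with rfl | ⟨_, _, hR⟩
        · exact hxK
        · exact hR.2
      rw [ih]
      constructor
      · intro hb
        have : c ∈ nbrs G K b := mem_nbrs.2 ⟨hbc.2, hbc.1⟩
        rw [← hSnb b hb] at this
        exact (mem_nbrs.1 this).1
      · intro hc'
        have : b ∈ nbrs G K c := mem_nbrs.2 ⟨hbK, hbc.1.symm⟩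
        rw [← hSnb c hc'] at this
        exact (mem_nbrs.1 this).1
  obtain ⟨g, hg, hgF⟩ : ∃ g ∈ S, g ∈ F := by
    by_contra! hc'
    obtain ⟨x, hx, hd⟩ := h S (fun x hx => Finset.mem_sdiff.2 ⟨hSW hx, hc' x hx⟩) hn
    have := hc x hx
    omega
  have hgQ : g ∈ Q := by
    have := hS hg
    simp only [Finset.mem_sdiff] at this
    by_contra hgQ
    exact this.2 ⟨hgF, hgQ⟩
  have := (hclosed v g (Finset.mem_filter.1 hgQ).2 (hT hv)).2 hg
  exact hST v this hv

/-- Removing all vertices of the core, or `3 k` of them with largest degree in the core, decreases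
the smallest size of a feedback vertex set, if that size is at most `k`. -/
theorem exists_smaller_feedback {W F T : Finset V} {k : ℕ} (hF : F.card ≤ k)
    (h : IsForestOn G (W \ F)) (hne : (core G W).Nonempty) (hT : T ⊆ core G W)
    (hcard : T = core G W ∨ (T.card = 3 * k ∧
      ∀ v ∈ T, ∀ x ∈ core G W, x ∉ T → coreDeg G W x ≤ coreDeg G W v)) :
    ∃ F' : Finset V, F'.card < F.card ∧ IsForestOn G ((W \ T) \ F') := by
  have hFne : F.Nonempty := by
    rw [Finset.nonempty_iff_ne_empty]
    rintro rfl
    rw [Finset.sdiff_empty] at h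
    exact hne.ne_empty (isForestOn_iff_core_eq_empty.1 h)
  rcases hcard with rfl | ⟨hcard, htop⟩
  · exact ⟨∅, by simpa using hFne, (isForestOn_sdiff_core W).mono Finset.sdiff_subset⟩
  · have hTne : T.Nonempty := by
      rw [← Finset.card_pos, hcard]
      have := hFne.card_pos
      omega
    by_cases h3 : ∀ v ∈ T, 3 ≤ coreDeg G W v
    · have := not_disjoint_of_three_le hF h hT hTne hcard htop h3
      refine ⟨F \ T, Finset.card_lt_card (sdiff_ssubset_of_not_disjoint this), h.mono ?_⟩
      intro x
      simp only [Finset.mem_sdiff]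
      tauto
    · push Not at h3
      obtain ⟨v, hv, hv3⟩ := h3
      obtain ⟨F', hF', hfor⟩ := isForestOn_of_two hT hv h (fun x hx hxT => by
        have := htop v hv x hx hxT
        have := (mem_core.1 hx).2
        omega)
      exact ⟨F', Finset.card_lt_card hF', hfor⟩

end Core

/-! ### Agreement with acyclicity in the sense of Mathlib -/

section Bridge

open scoped Classical

variable {V : Type*} [DecidableEq V] {G : SimpleGraph V}

/-- The start of a longest path works: a neighbour off the path would extend it, and a neighbour on
the path other than the second vertex would close a cycle. -/
theorem exists_card_nbrs_le_one_of_isAcyclic {S : Finset V} (hn : S.Nonempty)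
    (h : (G.induce (S : Set V)).IsAcyclic) : ∃ v ∈ S, (nbrs G S v).card ≤ 1 := by
  obtain ⟨x, hx⟩ := hn
  have : Nonempty (S : Set V) := ⟨⟨x, hx⟩⟩
  obtain ⟨u, v, p, hp, hmax⟩ :=
    SimpleGraph.Walk.exists_isPath_forall_isPath_length_le_length (G.induce (S : Set V))
  refine ⟨u, u.2, ?_⟩
  have key : ∀ w (hw : w ∈ S) (hadj : G.Adj u w), (⟨w, hw⟩ : (S : Set V)) = p.snd := by
    intro w hw hadj
    have hadj' : (G.induce (S : Set V)).Adj u ⟨w, hw⟩ := hadj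
    have : ¬(p.cons hadj'.symm).IsPath := by
      intro hq
      have := hmax _ _ _ hq
      simp at this
    refine h.eq_snd_of_adj_start hp hadj' ?_
    by_contra hns
    exact this (hp.cons hns)
  refine Finset.card_le_one.2 fun a ha b hb => ?_
  rw [mem_nbrs] at ha hb
  exact congrArg Subtype.val ((key a ha.1 ha.2).trans (key b hb.1 hb.2).symm)

/-- The vertices of a cycle form a set in which each has two neighbours. The converse applies the
longest path argument to every subset of W. -/
theorem isForestOn_iff_isAcyclic {W : Finset V} :
    IsForestOn G W ↔ (G.induce (W : Set V)).IsAcyclic := by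
  constructor
  · intro h u p hp
    have hc : ∀ w ∈ p.support, ∃ a ∈ p.support, ∃ b ∈ p.support, a ≠ b ∧
        G.Adj w.1 a.1 ∧ G.Adj w.1 b.1 := by
      intro w hw
      have h2 := hp.ncard_neighborSet_toSubgraph_eq_two hw
      obtain ⟨a, b, hab, heq⟩ := Set.ncard_eq_two.1 h2
      have ha : a ∈ p.toSubgraph.neighborSet w := by rw [heq]; simp
      have hb : b ∈ p.toSubgraph.neighborSet w := by rw [heq]; simp
      refine ⟨a, ?_, b, ?_, hab, ha.adj_sub, hb.adj_sub⟩
      · exact (p.mem_verts_toSubgraph).1 (p.toSubgraph.edge_vert ha.symm)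
      · exact (p.mem_verts_toSubgraph).1 (p.toSubgraph.edge_vert hb.symm)
    let S : Finset V := (p.support.map Subtype.val).toFinset
    obtain ⟨v, hv, hd⟩ := h S (fun x hx => by
      simp only [S, List.mem_toFinset, List.mem_map] at hx
      obtain ⟨y, _, rfl⟩ := hx
      exact y.2) ⟨u.1, by simp [S]⟩
    simp only [S, List.mem_toFinset, List.mem_map] at hv
    obtain ⟨w, hw, rfl⟩ := hv
    obtain ⟨a, ha, b, hb, hab, hwa, hwb⟩ := hc w hw
    refine hab (Subtype.ext (Finset.card_le_one.1 hd a.1 ?_ b.1 ?_)) <;> rw [mem_nbrs]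
    · exact ⟨by simp only [S, List.mem_toFinset, List.mem_map]; exact ⟨a, ha, rfl⟩, hwa⟩
    · exact ⟨by simp only [S, List.mem_toFinset, List.mem_map]; exact ⟨b, hb, rfl⟩, hwb⟩
  · intro h S hS hn
    refine exists_card_nbrs_le_one_of_isAcyclic hn (h.comap ⟨fun x => ⟨x.1, hS x.2⟩, ?_⟩ ?_)
    · intro a b hab
      exact hab
    · intro a b hab
      exact Subtype.ext (congrArg (fun x : (W : Set V) => x.1) hab)

end Bridge

end ROWordRAM

namespace ROWordRAM

set_option linter.unusedSectionVars false

/-! ### Contour walks recognise dangling trees -/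

section Contour

open Relation

variable {V : Type*} [DecidableEq V] {G : SimpleGraph V} {W : Finset V}

/-- A cyclic order of the neighbours of each vertex: `rot x z` follows `z` around `x`. -/
structure IsRotation (G : SimpleGraph V) (rot : V → V → V) : Prop where
  adj : ∀ {x z}, G.Adj x z → G.Adj x (rot x z)
  inj : ∀ {x z z'}, G.Adj x z → G.Adj x z' → rot x z = rot x z' → z = z'
  trans : ∀ {x z z'}, G.Adj x z → G.Adj x z' → ∃ i, (rot x)^[i] z = z'

/-- The next dart of a contour walk in the graph induced by `W`. A dart to a vertex outside of `W`
is passed over. -/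
def dartNext (W : Finset V) (rot : V → V → V) (d : V × V) : V × V :=
  if d.2 ∈ W then (d.2, rot d.2 d.1) else (d.1, rot d.1 d.2)

/-- The contour walk that starts with the dart `d`. -/
def contour (W : Finset V) (rot : V → V → V) (d : V × V) (t : ℕ) : V × V :=
  (dartNext W rot)^[t] d

/-- The vertex to which the contour walk has left `y` for the last time before time `t`. -/
def lastExit (W : Finset V) (rot : V → V → V) (d : V × V) (y : V) : ℕ → Option V
  | 0 => none
  | t + 1 =>
    if (contour W rot d t).2 ∈ W ∧ (contour W rot d t).1 = y then some (contour W rot d t).2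
    else lastExit W rot d y t

/-- At time `t`, the contour walk returns to `y`, but not from the vertex to which it has left. -/
def Mismatch (W : Finset V) (rot : V → V → V) (d : V × V) (y : V) (t : ℕ) : Prop :=
  (contour W rot d t).2 ∈ W ∧ (contour W rot d t).2 = y ∧
    ∃ z, lastExit W rot d y t = some z ∧ z ≠ (contour W rot d t).1

theorem contour_succ (rot : V → V → V) (d : V × V) (t : ℕ) :
    contour W rot d (t + 1) = dartNext W rot (contour W rot d t) :=
  Function.iterate_succ_apply' _ _ _

/-- A step in `W` that avoids `a`. -/
def StepAvoiding (G : SimpleGraph V) (W : Finset V) (a x y : V) : Prop :=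
  G.Adj x y ∧ y ∈ W ∧ y ≠ a

/-- Cut the walk at its last visit to u. -/
theorem exists_step_avoiding_start {R : V → V → Prop} {u s : V} (h : ReflTransGen R u s)
    (hs : s ≠ u) : ∃ w, R u w ∧ ReflTransGen (fun x y => R x y ∧ y ≠ u) w s := by
  induction h with
  | refl => exact absurd rfl hs
  | @tail b c hub hbc ih =>
    by_cases hb : b = u
    · subst hb
      exact ⟨c, hbc, .refl⟩
    · obtain ⟨w, hw, hwb⟩ := ih hb
      exact ⟨w, hw, hwb.tail ⟨hbc, hs⟩⟩

theorem reflTransGen_stepAvoiding_symm {a x y : V} (hx : x ∈ W) (hxa : x ≠ a)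
    (h : ReflTransGen (StepAvoiding G W a) x y) : ReflTransGen (StepAvoiding G W a) y x := by
  induction h with
  | refl => exact .refl
  | @tail b c hxb hbc ih =>
    have hb : b ∈ W ∧ b ≠ a := by
      rcases hxb.cases_tail with rfl | ⟨_, _, hR⟩
      · exact ⟨hx, hxa⟩
      · exact hR.2
    exact .head ⟨hbc.1.symm, hb⟩ ih

/-- Otherwise there is a cycle through a and b. Let d be the first vertex after the last visit to b.
From d one reaches c, and then a, without passing b, so the induction hypothesis for the tree at d
identifies its neighbours d and a of b, although d avoids a. -/
theorem Dangling.eq_of_reach {a b : V} (h : Dangling G W a b) :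
    ∀ {c : V}, G.Adj a b → a ∈ W → b ∈ W → ReflTransGen (StepAvoiding G W a) b c →
      G.Adj c a → c = b := by
  induction h with
  | intro a b _ ih =>
    intro c hab ha hb hbc hca
    by_contra hne
    obtain ⟨d, ⟨hbd, hd, hda⟩, hdc⟩ := exists_step_avoiding_start hbc hne
    have h1 : ReflTransGen (StepAvoiding G W b) d c :=
      ReflTransGen.mono (fun x y hxy => ⟨hxy.1.1, hxy.1.2.1, hxy.2⟩) _ _ hdc
    exact hda (ih d hd hbd hda hbd hb hd (h1.tail ⟨hca, ha, hab.ne⟩) hab).symm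

/-- The exceptional p is the parent of y in the tree rooted at v: the rest of the tree hangs below
y. -/
theorem Dangling.exists_of_reach {v u : V} (h : Dangling G W v u) :
    ∀ {y : V}, ReflTransGen (StepAvoiding G W v) u y →
      ∃ p, ∀ w ∈ W, G.Adj y w → w ≠ p → Dangling G W y w := by
  induction h with
  | intro v u hvu ih =>
    intro y huy
    by_cases hyu : y = u
    · subst hyu
      exact ⟨v, hvu⟩
    · obtain ⟨d, ⟨hbd, hd, hda⟩, hdc⟩ := exists_step_avoiding_start huy hyu
      exact ih d hd hbd hda (ReflTransGen.mono (fun x y hxy => ⟨hxy.1.1, hxy.1.2.1, hxy.2⟩) _ _ hdc)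

theorem contour_adj {rot : V → V → V} (hrot : IsRotation G rot) {d : V × V} (hd : G.Adj d.1 d.2)
    (hW : d.1 ∈ W) (t : ℕ) :
    G.Adj (contour W rot d t).1 (contour W rot d t).2 ∧ (contour W rot d t).1 ∈ W := by
  induction t with
  | zero => exact ⟨hd, hW⟩
  | succ t ih =>
    rw [contour_succ, dartNext]
    split_ifs with h
    · exact ⟨hrot.adj ih.1.symm, h⟩
    · exact ⟨hrot.adj ih.1, ih.2⟩

/-- At a mismatch, y has two different neighbours joined by a walk that avoids y: the one to which
it was left and the one from which the walk returns. In a tree only one of them can be the parent of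
y, so the other is the root of a dangling tree, and `Dangling.eq_of_reach` makes the two equal. -/
theorem Dangling.not_mismatch {rot : V → V → V} (hrot : IsRotation G rot) {v u : V}
    (hvu : G.Adj v u) (hv : v ∈ W) (hu : u ∈ W) (h : Dangling G W v u) {T : ℕ}
    (hT : ∀ t < T, (contour W rot (v, u) t).2 ≠ v) (y : V) : ¬ Mismatch W rot (v, u) y T := by
  have hadj := contour_adj (d := (v, u)) hrot hvu hv
  -- After the start the walk stays in the part hanging at u; and while it is away from y, it is
  -- connected outside y to the vertex z to which it last left y.
  have inv : ∀ t ≤ T,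
      (t = 0 ∨ (ReflTransGen (StepAvoiding G W v) u (contour W rot (v, u) t).1 ∧
        (contour W rot (v, u) t).1 ≠ v)) ∧
      ∀ z, lastExit W rot (v, u) y t = some z → z ∈ W ∧ G.Adj y z ∧ y ∈ W ∧
        ((y = v ∧ z = u) ∨ ReflTransGen (StepAvoiding G W v) u y) ∧
        ((contour W rot (v, u) t).1 ≠ y →
          ReflTransGen (StepAvoiding G W y) z (contour W rot (v, u) t).1) := by
    intro t
    induction t with
    | zero => intro _; simp [lastExit]
    | succ t ih =>
      intro ht
      obtain ⟨ih1, ih2⟩ := ih (by omega)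
      have hnv := hT t (by omega)
      obtain ⟨ha, hxW⟩ := hadj t
      have h1 : t + 1 = 0 ∨ (ReflTransGen (StepAvoiding G W v) u
          (contour W rot (v, u) (t + 1)).1 ∧ (contour W rot (v, u) (t + 1)).1 ≠ v) := by
        right
        rcases ih1 with rfl | ⟨ih1, ih1'⟩
        · have : (contour W rot (v, u) (0 + 1)).1 = u := by
            simp [contour, dartNext, hu]
          rw [this]
          exact ⟨.refl, hvu.ne'⟩
        · rw [contour_succ, dartNext]
          split_ifs with hz
          · exact ⟨ih1.tail ⟨ha, hz, hnv⟩, hnv⟩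
          · exact ⟨ih1, ih1'⟩
      refine ⟨h1, fun z hz => ?_⟩
      rw [lastExit] at hz
      split_ifs at hz with hc
      · obtain ⟨hzW, hxy⟩ := hc
        have hz' := Option.some.inj hz
        subst hxy
        have hx1 : (contour W rot (v, u) (t + 1)).1 = z := by
          rw [contour_succ, dartNext, if_pos hzW, hz']
        refine ⟨hz' ▸ hzW, hz' ▸ ha, hxW, ?_, fun _ => hx1 ▸ .refl⟩
        rcases ih1 with rfl | ⟨ih1, _⟩
        · exact Or.inl ⟨rfl, hz'.symm⟩
        · exact Or.inr ih1
      · obtain ⟨i1, i2, i3, i4, i5⟩ := ih2 z hz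
        refine ⟨i1, i2, i3, i4, ?_⟩
        rw [contour_succ, dartNext]
        split_ifs with hzW
        · intro hzy
          have hxy : (contour W rot (v, u) t).1 ≠ y := fun h => hc ⟨hzW, h⟩
          exact (i5 hxy).tail ⟨ha, hzW, hzy⟩
        · exact i5
  rintro ⟨hzW, hzy, z, hz, hne⟩
  obtain ⟨i1, i2, i3, i4, i5⟩ := (inv T le_rfl).2 z hz
  obtain ⟨ha, hxW⟩ := hadj T
  rw [hzy] at ha
  have hreach := i5 ha.ne
  have key : Dangling G W y z ∨ Dangling G W y (contour W rot (v, u) T).1 := by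
    rcases i4 with ⟨rfl, rfl⟩ | i4
    · exact Or.inl h
    · obtain ⟨p, hp⟩ := h.exists_of_reach i4
      by_cases hzp : z = p
      · exact Or.inr (hp _ hxW ha.symm (fun h => hne (hzp.trans h.symm)))
      · exact Or.inl (hp z i1 i2 hzp)
  rcases key with hd | hd
  · exact hne (hd.eq_of_reach i2 i3 i1 hreach ha).symm
  · exact hne (hd.eq_of_reach ha.symm i3 hxW
      (reflTransGen_stepAvoiding_symm i1 i2.ne' hreach) i2.symm)

/-- The tail of the dart changes only when the walk follows a dart into W, so just before the tail
first becomes u the walk follows a dart to u. -/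
theorem exists_arrival {rot : V → V → V} {d : V × V} {u : V} {a b : ℕ} (hab : a < b)
    (ha : (contour W rot d a).1 ≠ u) (hb : (contour W rot d b).1 = u) :
    ∃ j, a ≤ j ∧ j < b ∧ (contour W rot d j).2 = u ∧ (contour W rot d j).2 ∈ W ∧
      ∀ t, a ≤ t → t ≤ j → (contour W rot d t).1 ≠ u := by
  have hex : ∃ t, a ≤ t ∧ (contour W rot d t).1 = u := ⟨b, hab.le, hb⟩
  obtain ⟨h1, h2⟩ := Nat.find_spec hex
  have hmin : ∀ t, a ≤ t → t < Nat.find hex → (contour W rot d t).1 ≠ u :=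
    fun t hat ht hu => Nat.find_min hex ht ⟨hat, hu⟩
  have hle : Nat.find hex ≤ b := Nat.find_min' hex ⟨hab.le, hb⟩
  have hne : Nat.find hex ≠ a := fun h => ha (h ▸ h2)
  obtain ⟨j, hj⟩ : ∃ j, Nat.find hex = j + 1 := ⟨Nat.find hex - 1, by omega⟩
  rw [hj] at h1 h2 hmin hle hne
  have hxj := hmin j (by omega) (by omega)
  rw [contour_succ, dartNext] at h2
  split_ifs at h2 with hz
  · exact ⟨j, by omega, by omega, h2, hz, fun t h1 h2 => hmin t h1 (by omega)⟩
  · exact absurd h2 hxj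

/-- Induction on the length of an excursion from v over u and back. At u the walk starts with the
dart after the one to v. A dart into W opens a shorter excursion, which has to come back from where
it went, so that the walk resumes with the next dart of u. In this way all neighbours of u in W
other than v are seen before v, and the induction hypothesis makes the part hanging at each of them
a tree. -/
theorem dangling_of_matched {rot : V → V → V} (hrot : IsRotation G rot) {d : V × V}
    (hd : G.Adj d.1 d.2) (hW : d.1 ∈ W) {L : ℕ}
    (hm : ∀ i j, i < j → j ≤ L → (contour W rot d i).2 ∈ W →
      (contour W rot d j).2 = (contour W rot d i).1 →
      (∀ t, i < t → t ≤ j → (contour W rot d t).1 ≠ (contour W rot d i).1) →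
      (contour W rot d j).1 = (contour W rot d i).2) :
    ∀ N s l, l - s ≤ N → s < l → l ≤ L → (contour W rot d s).2 ∈ W →
      (contour W rot d l).2 = (contour W rot d s).1 →
      (∀ t, s < t → t ≤ l → (contour W rot d t).1 ≠ (contour W rot d s).1) →
      Dangling G W (contour W rot d s).1 (contour W rot d s).2 := by
  intro N
  induction N with
  | zero => intros; omega
  | succ N ih =>
    intro s l hN hsl hlL hs hl hne
    have hadj := contour_adj hrot hd hW
    have hxl := hm s l hsl hlL hs hl hne
    obtain ⟨hvu, hv⟩ := hadj s
    set v := (contour W rot d s).1 with hvdef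
    set u := (contour W rot d s).2 with hudef
    -- As long as the rotation has not come round to v, its i-th dart at u occurs in the walk, and
    -- all earlier ones into W are settled.
    have claim : ∀ i, (∀ i' < i, (rot u)^[i'] (rot u v) ≠ v) →
        (∃ τ, s < τ ∧ τ ≤ l ∧ contour W rot d τ = (u, (rot u)^[i] (rot u v))) ∧
        ∀ i' < i, (rot u)^[i'] (rot u v) ∈ W → Dangling G W u ((rot u)^[i'] (rot u v)) := by
      intro i
      induction i with
      | zero =>
        intro _
        refine ⟨⟨s + 1, by omega, by omega, ?_⟩, by simp⟩
        rw [contour_succ, dartNext, if_pos hs]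
        rfl
      | succ i ihi =>
        intro hi
        obtain ⟨⟨τ, hsτ, hτl, hτ⟩, hdang⟩ := ihi fun i' hi' => hi i' (by omega)
        have hiv := hi i (by omega)
        have hτne : τ ≠ l := by
          rintro rfl
          rw [hτ] at hl
          exact hiv hl
        by_cases hwW : (rot u)^[i] (rot u v) ∈ W
        · have hau := (hadj τ).1
          rw [hτ] at hau
          have hx1 : (contour W rot d (τ + 1)).1 ≠ u := by
            rw [contour_succ, dartNext, hτ, if_pos hwW]
            exact hau.ne'
          have hτl' : τ + 1 < l := by
            rcases Nat.lt_or_ge (τ + 1) l with h | h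
            · exact h
            · have : τ + 1 = l := by omega
              rw [this] at hx1
              exact absurd hxl hx1
          obtain ⟨j, hj1, hj2, hj3, hj4, hj5⟩ := exists_arrival hτl' hx1 hxl
          have hτ1 : (contour W rot d τ).1 = u := by rw [hτ]
          have hτ2 : (contour W rot d τ).2 = (rot u)^[i] (rot u v) := by rw [hτ]
          have hnot : ∀ t, τ < t → t ≤ j → (contour W rot d t).1 ≠ (contour W rot d τ).1 :=
            fun t h1 h2 => by rw [hτ1]; exact hj5 t h1 h2
          have hD := ih τ j (by omega) (by omega) (by omega) (by rwa [hτ2]) (by rw [hj3, hτ1]) hnot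
          have hmj := hm τ j (by omega) (by omega) (by rwa [hτ2]) (by rw [hj3, hτ1]) hnot
          rw [hτ1, hτ2] at hD
          rw [hτ2] at hmj
          refine ⟨⟨j + 1, by omega, by omega, ?_⟩, fun i' hi' hW' => ?_⟩
          · rw [contour_succ, dartNext, if_pos hj4, hj3, hmj, Function.iterate_succ_apply']
          · rcases Nat.lt_succ_iff_lt_or_eq.1 hi' with h | rfl
            · exact hdang i' h hW'
            · exact hD
        · refine ⟨⟨τ + 1, by omega, by omega, ?_⟩, fun i' hi' hW' => ?_⟩
          · rw [contour_succ, dartNext, hτ, if_neg hwW, Function.iterate_succ_apply']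
          · rcases Nat.lt_succ_iff_lt_or_eq.1 hi' with h | rfl
            · exact hdang i' h hW'
            · exact absurd hW' hwW
    refine .intro v u fun w hw huw hwv => ?_
    have hex := hrot.trans (hrot.adj hvu.symm) huw
    have hspec := Nat.find_spec hex
    have hmin := fun m (hm : m < Nat.find hex) => Nat.find_min hex hm
    generalize Nat.find hex = m at hspec hmin
    -- Were v passed on the way, w would be reached from v's successor in fewer than m steps.
    have hmv : ∀ i' < m + 1, (rot u)^[i'] (rot u v) ≠ v := by
      intro i' hi' hv'
      rcases Nat.lt_succ_iff_lt_or_eq.1 hi' with h | rfl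
      · refine hmin (m - (i' + 1)) (by omega) ?_
        have : (rot u)^[m - (i' + 1) + (i' + 1)] (rot u v) = w := by
          rw [Nat.sub_add_cancel h]; exact hspec
        rwa [Function.iterate_add_apply, Function.iterate_succ_apply' (rot u) i', hv'] at this
      · exact hwv (hspec.symm.trans hv')
    have := (claim (m + 1) hmv).2 m (by omega)
    rw [hspec] at this
    exact this hw

theorem lastExit_eq {rot : V → V → V} {d : V × V} {i : ℕ} (hi : (contour W rot d i).2 ∈ W) :
    ∀ j, i < j → (∀ t, i < t → t < j → (contour W rot d t).1 ≠ (contour W rot d i).1) →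
      lastExit W rot d (contour W rot d i).1 j = some (contour W rot d i).2 := by
  intro j hij
  induction j, hij using Nat.le_induction with
  | base => intro _; simp [lastExit, hi]
  | succ j hj ih =>
    intro h
    rw [lastExit, if_neg (fun hc => h j hj (by omega) hc.2)]
    exact ih fun t h1 h2 => h t h1 (by omega)

/-- Whether a tree is dangling can be seen from the contour walk around it. -/
theorem dangling_iff_forall_not_mismatch {rot : V → V → V} (hrot : IsRotation G rot) {v u : V}
    (hvu : G.Adj v u) (hv : v ∈ W) (hu : u ∈ W) {T : ℕ}
    (hT : ∀ t < T, (contour W rot (v, u) t).2 ≠ v) (hTv : (contour W rot (v, u) T).2 = v) :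
    Dangling G W v u ↔ ∀ y, ∀ t ≤ T, ¬ Mismatch W rot (v, u) y t := by
  constructor
  · intro h y t ht
    exact h.not_mismatch hrot hvu hv hu (fun t' ht' => hT t' (by omega)) y
  · intro h
    have hT0 : 0 < T := by
      rcases Nat.eq_zero_or_pos T with rfl | h
      · exact absurd hTv hvu.ne'
      · exact h
    refine dangling_of_matched hrot (d := (v, u)) hvu hv (L := T) ?_ T 0 T (by omega) hT0 le_rfl
      hu hTv ?_
    · intro i j hij hjT hi hj hne
      have hlast := lastExit_eq hi j hij fun t h1 h2 => hne t h1 h2.le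
      by_contra hc
      refine h _ j hjT ⟨?_, hj, _, hlast, fun he => hc he.symm⟩
      rw [hj]
      exact (contour_adj (d := (v, u)) hrot hvu hv i).2
    · intro t h0 htT
      have : ∀ t, 0 < t → t ≤ T → (contour W rot (v, u) t).1 ≠ v := by
        intro t h0
        induction t, h0 using Nat.le_induction with
        | base =>
          intro _
          simp [dartNext, contour, hu, hvu.ne']
        | succ t ht ih =>
          intro htT
          rw [contour_succ, dartNext]
          split_ifs
          · exact hT t (by omega)
          · exact ih (by omega)
      exact this t h0 htT

/-- A dart reached by moving has a predecessor in the rotation that lies in W, namely the old tail;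
a dart reached by passing over has one outside W. So the two cases cannot collide. -/
theorem dartNext_inj {rot : V → V → V} (hrot : IsRotation G rot) {d d' : V × V}
    (hd : G.Adj d.1 d.2) (hW : d.1 ∈ W) (hd' : G.Adj d'.1 d'.2) (hW' : d'.1 ∈ W)
    (h : dartNext W rot d = dartNext W rot d') : d = d' := by
  obtain ⟨x, z⟩ := d
  obtain ⟨x', z'⟩ := d'
  simp only [dartNext] at *
  split_ifs at h with h1 h2 h2 <;> rw [Prod.mk.injEq] at h <;> obtain ⟨h3, h4⟩ := h <;> subst h3
  · rw [hrot.inj hd.symm hd'.symm h4]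
  · exact absurd (hrot.inj hd.symm hd' h4 ▸ hW) h2
  · exact absurd (hrot.inj hd hd'.symm h4 ▸ hW') h1
  · rw [hrot.inj hd hd' h4]

/-- The walk is the orbit of an injective map on finitely many darts, hence periodic. It therefore
leaves from v again, and to do so must have arrived there. -/
theorem exists_first_arrival {rot : V → V → V} (hrot : IsRotation G rot) {v u : V}
    (hvu : G.Adj v u) (hv : v ∈ W) (hu : u ∈ W) (D : Finset (V × V))
    (hD : ∀ x z, x ∈ W → G.Adj x z → (x, z) ∈ D) :
    ∃ T < D.card, (∀ t < T, (contour W rot (v, u) t).2 ≠ v) ∧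
      (contour W rot (v, u) T).2 = v := by
  have hadj := contour_adj (d := (v, u)) hrot hvu hv
  have hmem : ∀ t, contour W rot (v, u) t ∈ D := fun t => hD _ _ (hadj t).2 (hadj t).1
  obtain ⟨i, hi, j, hj, hij, heq⟩ := Finset.exists_ne_map_eq_of_card_lt_of_maps_to
    (s := Finset.range (D.card + 1)) (t := D) (by simp) (fun t _ => hmem t)
  -- Injectivity shifts a repetition in the walk back to time zero.
  have key : ∀ i r, contour W rot (v, u) i = contour W rot (v, u) (i + r) →
      contour W rot (v, u) 0 = contour W rot (v, u) r := by
    intro i r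
    induction i with
    | zero => rw [Nat.zero_add]; exact id
    | succ i ih =>
      intro h
      refine ih ?_
      rw [Nat.add_right_comm, contour_succ, contour_succ] at h
      exact dartNext_inj hrot (hadj i).1 (hadj i).2 (hadj (i + r)).1 (hadj (i + r)).2 h
  obtain ⟨r, hr0, hrD, hr⟩ : ∃ r, 0 < r ∧ r ≤ D.card ∧
      contour W rot (v, u) 0 = contour W rot (v, u) r := by
    simp only [Finset.mem_range] at hi hj
    rcases Nat.lt_or_gt_of_ne hij with h | h
    · exact ⟨j - i, by omega, by omega, key i _ (by rw [Nat.add_sub_cancel' h.le]; exact heq)⟩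
    · exact ⟨i - j, by omega, by omega, key j _ (by rw [Nat.add_sub_cancel' h.le]; exact heq.symm)⟩
  have hx1 : (contour W rot (v, u) 1).1 ≠ v := by
    simp [contour, dartNext, hu, hvu.ne']
  have hxr : (contour W rot (v, u) r).1 = v := by rw [← hr]; rfl
  have hr1 : 1 < r := by
    rcases Nat.lt_or_ge 1 r with h | h
    · exact h
    · have : r = 1 := by omega
      rw [this] at hxr
      exact absurd hxr hx1
  obtain ⟨j, _, hj2, hj3, _, _⟩ := exists_arrival hr1 hx1 hxr
  have hex : ∃ t, (contour W rot (v, u) t).2 = v := ⟨j, hj3⟩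
  exact ⟨Nat.find hex, (Nat.find_min' hex hj3).trans_lt (by omega),
    fun t ht => Nat.find_min hex ht, Nat.find_spec hex⟩

end Contour

end ROWordRAM

namespace ROWordRAM

/-! ### Program logic: time bounds with postconditions -/

section Run

infixr:65 " ⨟ " => Prog.seq

/-- Copy register `x` to register `r`, if register `3` holds `1`. -/
def Prog.move (r x : ℕ) : Prog := .op .div r x 3

/-- Started in `s`, the program `p` halts within `b` steps in a state that satisfies `Q`. -/
def Run (w : ℕ) (inp : List ℕ) (p : Prog) (s : State) (b : ℕ) (Q : State → Prop) : Prop :=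
  ∃ s' t, Exec w inp p s s' t ∧ t ≤ b ∧ Q s'

variable {w : ℕ} {inp : List ℕ} {p q : Prog} {s : State} {b b₁ b₂ : ℕ} {Q Q' : State → Prop}

@[simp] theorem State.reg_setReg (s : State) (r v x : ℕ) :
    (s.setReg r v).reg x = if x = r then v else s.reg x := by
  simp [State.setReg, Function.update_apply]

@[simp] theorem State.mem_setReg (s : State) (r v : ℕ) : (s.setReg r v).mem = s.mem := rfl

@[simp] theorem State.top_setReg (s : State) (r v : ℕ) : (s.setReg r v).top = s.top := rfl

@[simp] theorem State.reg_setMem (s : State) (a v : ℕ) : (s.setMem a v).reg = s.reg := rfl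

@[simp] theorem State.top_setMem (s : State) (a v : ℕ) : (s.setMem a v).top = s.top := rfl

@[simp] theorem State.mem_setMem (s : State) (a v : ℕ) :
    (s.setMem a v).mem = Function.update s.mem a v := rfl

/-- `search` raises the high-water mark once; by this lemma all later accesses leave it alone. -/
theorem State.touch_of_lt {s : State} {a : ℕ} (h : a < s.top) : s.touch a = s := by
  simp [State.touch, Nat.max_eq_left (Nat.succ_le_of_lt h)]

theorem Run.mono (h : Run w inp p s b Q) (hb : b ≤ b₁) (hQ : ∀ s', Q s' → Q' s') :
    Run w inp p s b₁ Q' := by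
  obtain ⟨s', t, h1, h2, h3⟩ := h
  exact ⟨s', t, h1, h2.trans hb, hQ s' h3⟩

theorem Run.of_le (h : Run w inp p s b Q) (hb : b ≤ b₁) : Run w inp p s b₁ Q :=
  h.mono hb fun _ => id

/-- The postcondition of the first program is that the second one runs well, so programs can be
executed symbolically, one instruction at a time. -/
theorem Run.seq (h : Run w inp p s b₁ fun s₁ => Run w inp q s₁ b₂ Q) :
    Run w inp (p ⨟ q) s (b₁ + b₂) Q := by
  obtain ⟨s₁, t₁, h1, h2, s₂, t₂, h3, h4, h5⟩ := h
  exact ⟨s₂, t₁ + t₂, .seq h1 h3, Nat.add_le_add h2 h4, h5⟩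

theorem Run.bind (h : Run w inp p s b₁ Q') (h' : ∀ s₁, Q' s₁ → Run w inp q s₁ b₂ Q) :
    Run w inp (p ⨟ q) s (b₁ + b₂) Q :=
  .seq (h.mono le_rfl h')

theorem Run.skip (h : Q s) : Run w inp .skip s 1 Q := ⟨s, 1, .skip s, le_rfl, h⟩

theorem Run.const {r c : ℕ} (hc : c < 2 ^ w) (h : Q (s.setReg r c)) :
    Run w inp (.const r c) s 1 Q :=
  ⟨_, 1, .const s r c, le_rfl, by rwa [Nat.mod_eq_of_lt hc]⟩

theorem Run.op {o : Op} {r x y : ℕ} (v : ℕ) (hv : o.eval w (s.reg x) (s.reg y) = v)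
    (h : Q (s.setReg r v)) : Run w inp (.op o r x y) s 1 Q :=
  ⟨_, 1, .op s o r x y, le_rfl, by rwa [hv]⟩

theorem Run.add {r x y a c : ℕ} (hx : s.reg x = a) (hy : s.reg y = c) (hw : a + c < 2 ^ w)
    (h : Q (s.setReg r (a + c))) : Run w inp (.op .add r x y) s 1 Q :=
  .op _ (by rw [hx, hy]; exact Nat.mod_eq_of_lt hw) h

theorem Run.mul {r x y a c : ℕ} (hx : s.reg x = a) (hy : s.reg y = c) (hw : a * c < 2 ^ w)
    (h : Q (s.setReg r (a * c))) : Run w inp (.op .mul r x y) s 1 Q :=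
  .op _ (by rw [hx, hy]; exact Nat.mod_eq_of_lt hw) h

theorem Run.sub {r x y a c : ℕ} (hx : s.reg x = a) (hy : s.reg y = c) (hca : c ≤ a)
    (hw : a < 2 ^ w) (h : Q (s.setReg r (a - c))) : Run w inp (.op .sub r x y) s 1 Q := by
  refine .op _ ?_ h
  rw [hx, hy]
  show (a + (2 ^ w - c)) % 2 ^ w = _
  have : a + (2 ^ w - c) = (a - c) + 2 ^ w := by omega
  rw [this, Nat.add_mod_right, Nat.mod_eq_of_lt (by omega)]

theorem Run.mod {r x y a c : ℕ} (hx : s.reg x = a) (hy : s.reg y = c)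
    (h : Q (s.setReg r (a % c))) : Run w inp (.op .mod r x y) s 1 Q :=
  .op _ (by rw [hx, hy]; rfl) h

theorem Run.half {r x a : ℕ} (hx : s.reg x = a) (h3 : s.reg 3 = 1)
    (h : Q (s.setReg r (a / 2))) : Run w inp (.op .shr r x 3) s 1 Q :=
  .op _ (by rw [hx, h3]; simp [Op.eval]) h

theorem Run.move {r x a : ℕ} (hx : s.reg x = a) (h3 : s.reg 3 = 1) (h : Q (s.setReg r a)) :
    Run w inp (.move r x) s 1 Q :=
  .op _ (by rw [hx, h3]; simp [Op.eval]) h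

theorem Run.read {r x a v : ℕ} (hx : s.reg x = a) (hv : inp.getD a 0 = v) (hw : v < 2 ^ w)
    (h : Q (s.setReg r v)) : Run w inp (.read r x) s 1 Q :=
  ⟨_, 1, .read s r x, le_rfl, by rwa [hx, hv, Nat.mod_eq_of_lt hw]⟩

theorem Run.load {r x a v : ℕ} (hx : s.reg x = a) (hv : s.mem a = v) (ha : a < s.top)
    (h : Q (s.setReg r v)) : Run w inp (.load r x) s 1 Q :=
  ⟨_, 1, .load s r x, le_rfl, by rwa [hx, hv, State.touch_of_lt ha]⟩

theorem Run.store {x y a v : ℕ} (hx : s.reg x = a) (hy : s.reg y = v) (ha : a < s.top)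
    (h : Q (s.setMem a v)) : Run w inp (.store x y) s 1 Q :=
  ⟨_, 1, .store s x y, le_rfl, by rwa [hx, hy, State.touch_of_lt ha]⟩

theorem Run.ite {c : Cmp} {x y : ℕ} (h1 : c.holds (s.reg x) (s.reg y) → Run w inp p s b Q)
    (h2 : ¬ c.holds (s.reg x) (s.reg y) → Run w inp q s b Q) :
    Run w inp (.ite c x y p q) s (b + 1) Q := by
  by_cases h : c.holds (s.reg x) (s.reg y)
  · obtain ⟨s', t, h3, h4, h5⟩ := h1 h
    exact ⟨s', t + 1, .iteTrue h h3, by omega, h5⟩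
  · obtain ⟨s', t, h3, h4, h5⟩ := h2 h
    exact ⟨s', t + 1, .iteFalse h h3, by omega, h5⟩

/-- Rule for loops: `f` bounds the number of iterations that are left. -/
theorem Run.loop {c : Cmp} {x y : ℕ} {I : ℕ → State → Prop} (b : ℕ)
    (h : ∀ f s, I f s → c.holds (s.reg x) (s.reg y) →
      ∃ f', f = f' + 1 ∧ Run w inp p s b (I f')) :
    ∀ (f : ℕ) (s : State), I f s → (∀ f s, I f s → ¬ c.holds (s.reg x) (s.reg y) → Q s) →
      Run w inp (.loop c x y p) s (f * (b + 1) + 1) Q := by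
  intro f
  induction f with
  | zero =>
    intro s hI hQ
    have hn : ¬ c.holds (s.reg x) (s.reg y) := by
      intro hc
      obtain ⟨f', hf', _⟩ := h 0 s hI hc
      omega
    exact ⟨s, 1, .loopFalse hn, by omega, hQ 0 s hI hn⟩
  | succ f ih =>
    intro s hI hQ
    by_cases hc : c.holds (s.reg x) (s.reg y)
    · obtain ⟨f', hf', s₁, t₁, h1, h2, h3⟩ := h _ s hI hc
      obtain rfl : f = f' := by omega
      obtain ⟨s₂, t₂, h4, h5, h6⟩ := ih s₁ h3 hQ
      exact ⟨s₂, t₁ + t₂ + 1, .loopTrue hc h1 h4, by rw [Nat.add_mul]; omega, h6⟩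
    · exact ⟨s, 1, .loopFalse hc, by omega, hQ _ s hI hc⟩

/-- Rule for loops with a counter from `i` to `N` and varying cost of the iterations. -/
theorem Run.loop_range {c : Cmp} {x y : ℕ} {I : ℕ → State → Prop} (b : ℕ → ℕ) (N : ℕ)
    (h : ∀ i s, i < N → I i s → c.holds (s.reg x) (s.reg y) ∧ Run w inp p s (b i) (I (i + 1)))
    (hN : ∀ s, I N s → ¬ c.holds (s.reg x) (s.reg y) ∧ Q s) :
    ∀ (i : ℕ) (s : State), i ≤ N → I i s →
      Run w inp (.loop c x y p) s (∑ j ∈ Finset.Ico i N, (b j + 1) + 1) Q := by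
  intro i s hi
  induction hi using Nat.decreasingInduction generalizing s with
  | self =>
    intro hI
    exact ⟨s, 1, .loopFalse (hN s hI).1, by simp, (hN s hI).2⟩
  | of_succ i hi ih =>
    intro hI
    obtain ⟨hc, s₁, t₁, h1, h2, h3⟩ := h i s hi hI
    obtain ⟨s₂, t₂, h4, h5, h6⟩ := ih s₁ h3
    refine ⟨s₂, t₁ + t₂ + 1, .loopTrue hc h1 h4, ?_, h6⟩
    rw [Finset.sum_eq_sum_Ico_succ_bot hi]
    omega

theorem Run.loop_range_const {c : Cmp} {x y : ℕ} {I : ℕ → State → Prop} (b : ℕ) (N : ℕ)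
    (h : ∀ i s, i < N → I i s → c.holds (s.reg x) (s.reg y) ∧ Run w inp p s b (I (i + 1)))
    (hN : ∀ s, I N s → ¬ c.holds (s.reg x) (s.reg y) ∧ Q s) (hI : I 0 s) :
    Run w inp (.loop c x y p) s (N * (b + 1) + 1) Q := by
  refine (Run.loop_range (fun _ => b) N h hN 0 s (Nat.zero_le _) hI).of_le ?_
  simp

/-- The states agree up to registers with index at least `m`. -/
structure Frame (m : ℕ) (s s' : State) : Prop where
  mem : s'.mem = s.mem
  top : s'.top = s.top
  reg : ∀ r < m, s'.reg r = s.reg r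

theorem Frame.refl (m : ℕ) (s : State) : Frame m s s := ⟨rfl, rfl, fun _ _ => rfl⟩

theorem Frame.trans {m : ℕ} {s₁ s₂ s₃ : State} (h : Frame m s₁ s₂) (h' : Frame m s₂ s₃) :
    Frame m s₁ s₃ :=
  ⟨h'.mem.trans h.mem, h'.top.trans h.top, fun r hr => (h'.reg r hr).trans (h.reg r hr)⟩

theorem Frame.mono {m m' : ℕ} {s s' : State} (h : Frame m s s') (hm : m' ≤ m) : Frame m' s s' :=
  ⟨h.mem, h.top, fun r hr => h.reg r (hr.trans_le hm)⟩

theorem Frame.setReg {m r v : ℕ} {s s' : State} (h : Frame m s s') (hr : m ≤ r) :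
    Frame m s (s'.setReg r v) :=
  ⟨h.mem, h.top, fun x hx => by rw [State.reg_setReg, if_neg (by omega), h.reg x hx]⟩

end Run

/-! ### Binary search -/

section LowerBound

variable {w : ℕ} {inp : List ℕ}

/-- Binary search in the increasing sequence of the words that `fetch` gets from the addresses
between register `30` and register `31`: afterwards, register `30` holds the address of the
first word that is not smaller than register `34`. -/
def lowerBound (fetch : ℕ → ℕ → Prog) : Prog :=
  .loop .lt 30 31 (
    .op .add 32 30 31 ⨟ .op .shr 32 32 3 ⨟ fetch 33 32 ⨟
    .ite .lt 33 34 (.op .add 30 32 3) (.move 31 32))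

/-- `fetch` is left open because the search serves both the array of X in the working memory and the
adjacency arrays in the input. The bound on 2·hi keeps the sum of the two ends from overflowing. -/
theorem lowerBound_run {fetch : ℕ → ℕ → Prog} {s : State} {f : ℕ → ℕ} {lo hi key N : ℕ}
    (h3 : s.reg 3 = 1) (h30 : s.reg 30 = lo) (h31 : s.reg 31 = hi) (h34 : s.reg 34 = key)
    (hle : lo ≤ hi) (hw : 2 * hi < 2 ^ w) (hN : hi - lo < 2 ^ N)
    (hmono : ∀ i j, lo ≤ i → i ≤ j → j < hi → f i ≤ f j)
    (hfetch : ∀ (s₁ : State) (a : ℕ) (Q : State → Prop), Frame 30 s s₁ → s₁.reg 32 = a → lo ≤ a →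
      a < hi → Q (s₁.setReg 33 (f a)) → Run w inp (fetch 33 32) s₁ 1 Q) :
    Run w inp (lowerBound fetch) s (N * 6 + 1) fun s' =>
      Frame 30 s s' ∧ s'.reg 34 = key ∧ lo ≤ s'.reg 30 ∧ s'.reg 30 ≤ hi ∧
      (∀ i, lo ≤ i → i < s'.reg 30 → f i < key) ∧ ∀ i, s'.reg 30 ≤ i → i < hi → key ≤ f i := by
  let I : ℕ → State → Prop := fun N s' => ∃ l r, Frame 30 s s' ∧ s'.reg 30 = l ∧ s'.reg 31 = r ∧
    s'.reg 34 = key ∧ lo ≤ l ∧ l ≤ r ∧ r ≤ hi ∧ r - l < 2 ^ N ∧ (∀ i, lo ≤ i → i < l → f i < key) ∧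
    ∀ i, r ≤ i → i < hi → key ≤ f i
  refine Run.loop (I := I) 5 ?_ N s
    ⟨lo, hi, .refl _ _, h30, h31, h34, le_rfl, hle, le_rfl, hN, by omega, by omega⟩ ?_
  · rintro N s₁ ⟨l, r, hF, hl, hr, hk, h1, h2, h4, h5, h6, h7⟩ hc
    simp only [Cmp.holds, hl, hr] at hc
    obtain ⟨N', rfl⟩ : ∃ N', N = N' + 1 := by
      cases N with
      | zero => simp at h5; omega
      | succ N' => exact ⟨N', rfl⟩
    rw [pow_succ] at h5
    refine ⟨N', rfl, ?_⟩
    have h3' : s₁.reg 3 = 1 := by rw [hF.reg 3 (by norm_num), h3]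
    refine Run.of_le (b := 1 + (1 + (1 + (1 + 1)))) ?_ le_rfl
    refine .seq (.add hl hr (by omega) ?_)
    refine .seq (.half (a := l + r) (by simp) (by simp [h3']) ?_)
    refine .seq (hfetch _ ((l + r) / 2) _ ?_ (by simp) (by omega) (by omega) ?_)
    · exact (hF.setReg (by norm_num)).setReg (by norm_num)
    · refine (Run.ite (fun hc' => ?_) (fun hc' => ?_))
      · refine .add (a := (l + r) / 2) (c := 1) (by simp) (by simp [h3']) (by omega) ?_
        simp only [Cmp.holds, State.reg_setReg] at hc'
        simp [hk] at hc'
        refine ⟨(l + r) / 2 + 1, r, ?_, by simp, by simp [hr], by simp [hk], by omega, by omega,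
          h4, by omega, ?_, h7⟩
        · exact (((hF.setReg (by norm_num)).setReg (by norm_num)).setReg (by norm_num)).setReg
            (by norm_num)
        · intro i h8 h9
          exact (hmono i ((l + r) / 2) h8 (by omega) (by omega)).trans_lt hc'
      · refine .move (a := (l + r) / 2) (by simp) (by simp [h3']) ?_
        simp only [Cmp.holds, State.reg_setReg] at hc'
        simp [hk] at hc'
        refine ⟨l, (l + r) / 2, ?_, by simp [hl], by simp, by simp [hk], by omega, by omega,
          by omega, by omega, h6, ?_⟩
        · exact (((hF.setReg (by norm_num)).setReg (by norm_num)).setReg (by norm_num)).setReg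
            (by norm_num)
        · intro i h8 h9
          exact hc'.trans (hmono ((l + r) / 2) i (by omega) h8 h9)
  · rintro N s₁ ⟨l, r, hF, hl, hr, hk, h1, h2, h4, h5, h6, h7⟩ hc
    simp only [Cmp.holds, hl, hr] at hc
    obtain rfl : l = r := by omega
    exact ⟨hF, hk, by omega, by omega, by rwa [hl], by rwa [hl]⟩

end LowerBound

end ROWordRAM

namespace ROWordRAM

/-! ### Adjacency arrays as a rotation system -/

section Representation

/-- The address at which the neighbours of vertex `i` begin. -/
def off (inp : List ℕ) (i : ℕ) : ℕ := inp.getD (i + 2) 0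

/-- The word list `inp` starts with `n` and contains the adjacency arrays of the graph `G` with
vertices in `{0, …, n - 1}`. -/
structure Represents (inp : List ℕ) (n : ℕ) (G : SimpleGraph ℕ) : Prop where
  head : inp.getD 0 0 = n
  off_zero : off inp 0 = n + 3
  off_le_succ : ∀ i < n, off inp i ≤ off inp (i + 1)
  adj_iff : ∀ v < n, ∀ u,
    G.Adj v u ↔ ∃ p, off inp v ≤ p ∧ p < off inp (v + 1) ∧ inp.getD p 0 = u
  lt : ∀ v < n, ∀ p q, off inp v ≤ p → p < q → q < off inp (v + 1) →
    inp.getD p 0 < inp.getD q 0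
  lt_of_adj : ∀ v u, G.Adj v u → v < n

/-- The position cyclically after position `p` in the adjacency array of `x`. -/
def nextPos (inp : List ℕ) (x p : ℕ) : ℕ := if p + 1 = off inp (x + 1) then off inp x else p + 1

open scoped Classical in
/-- The position of `z` in the adjacency array of `x`. -/
noncomputable def pos (inp : List ℕ) (x z : ℕ) : ℕ :=
  if h : ∃ p, off inp x ≤ p ∧ p < off inp (x + 1) ∧ inp.getD p 0 = z then h.choose else 0

/-- The neighbour cyclically after `z` in the adjacency array of `x`. -/
noncomputable def nextNbr (inp : List ℕ) (x z : ℕ) : ℕ :=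
  inp.getD (nextPos inp x (pos inp x z)) 0

namespace Represents

variable {inp : List ℕ} {n : ℕ} {G : SimpleGraph ℕ}

theorem eq_of_getD_eq (h : Represents inp n G) {v p q : ℕ} (hv : v < n) (hp : off inp v ≤ p)
    (hp' : p < off inp (v + 1)) (hq : off inp v ≤ q) (hq' : q < off inp (v + 1))
    (hpq : inp.getD p 0 = inp.getD q 0) : p = q := by
  rcases Nat.lt_trichotomy p q with hlt | rfl | hlt
  · exact absurd hpq (h.lt v hv p q hp hlt hq').ne
  · rfl
  · exact absurd hpq (h.lt v hv q p hq hlt hp').ne'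

theorem pos_eq (h : Represents inp n G) {v p : ℕ} (hv : v < n) (hp : off inp v ≤ p)
    (hp' : p < off inp (v + 1)) : pos inp v (inp.getD p 0) = p := by
  have hex : ∃ q, off inp v ≤ q ∧ q < off inp (v + 1) ∧ inp.getD q 0 = inp.getD p 0 :=
    ⟨p, hp, hp', rfl⟩
  rw [pos, dif_pos hex]
  exact h.eq_of_getD_eq hv hex.choose_spec.1 hex.choose_spec.2.1 hp hp' hex.choose_spec.2.2

theorem nextNbr_eq (h : Represents inp n G) {v p : ℕ} (hv : v < n) (hp : off inp v ≤ p)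
    (hp' : p < off inp (v + 1)) :
    nextNbr inp v (inp.getD p 0) = inp.getD (nextPos inp v p) 0 := by
  rw [nextNbr, h.pos_eq hv hp hp']

theorem nextPos_mem {v p : ℕ} (hp : off inp v ≤ p) (hp' : p < off inp (v + 1)) :
    off inp v ≤ nextPos inp v p ∧ nextPos inp v p < off inp (v + 1) := by
  unfold nextPos
  split_ifs <;> omega

theorem lt_right (h : Represents inp n G) {v u : ℕ} (hvu : G.Adj v u) : u < n :=
  h.lt_of_adj u v hvu.symm

theorem adj_getD (h : Represents inp n G) {v p : ℕ} (hv : v < n) (hp : off inp v ≤ p)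
    (hp' : p < off inp (v + 1)) : G.Adj v (inp.getD p 0) :=
  (h.adj_iff v hv _).2 ⟨p, hp, hp', rfl⟩

theorem iterate_nextPos_of_le {v p q : ℕ} (hpq : p ≤ q) (hq : q < off inp (v + 1)) :
    (nextPos inp v)^[q - p] p = q := by
  induction q, hpq using Nat.le_induction with
  | base => simp
  | succ q hpq ih =>
    rw [Nat.succ_sub hpq, Function.iterate_succ_apply', ih (by omega), nextPos,
      if_neg (by omega)]

theorem exists_iterate_nextPos {v p q : ℕ} (hp' : p < off inp (v + 1))
    (hq : off inp v ≤ q) (hq' : q < off inp (v + 1)) : ∃ i, (nextPos inp v)^[i] p = q := by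
  have h1 := iterate_nextPos_of_le (inp := inp) (v := v) (p := p) (q := off inp (v + 1) - 1)
    (by omega) (by omega)
  refine ⟨(q - off inp v) + ((off inp (v + 1) - 1 - p) + 1), ?_⟩
  rw [Function.iterate_add_apply, Function.iterate_succ_apply', h1, nextPos, if_pos (by omega)]
  exact iterate_nextPos_of_le hq hq'

/-- Within one vertex, positions and neighbours correspond bijectively because the array is strictly
increasing; the cyclic successor of positions is carried over to neighbours. -/
theorem isRotation (h : Represents inp n G) : IsRotation G (nextNbr inp) := by
  refine ⟨fun {x z} hxz => ?_, fun {x z z'} hz hz' he => ?_, fun {x z z'} hz hz' => ?_⟩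
  · have hx := h.lt_of_adj x z hxz
    obtain ⟨p, hp, hp', rfl⟩ := (h.adj_iff x hx z).1 hxz
    rw [h.nextNbr_eq hx hp hp']
    exact h.adj_getD hx (nextPos_mem hp hp').1 (nextPos_mem hp hp').2
  · have hx := h.lt_of_adj x z hz
    obtain ⟨p, hp, hp', rfl⟩ := (h.adj_iff x hx z).1 hz
    obtain ⟨q, hq, hq', rfl⟩ := (h.adj_iff x hx z').1 hz'
    rw [h.nextNbr_eq hx hp hp', h.nextNbr_eq hx hq hq'] at he
    have := h.eq_of_getD_eq hx (nextPos_mem hp hp').1 (nextPos_mem hp hp').2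
      (nextPos_mem hq hq').1 (nextPos_mem hq hq').2 he
    unfold nextPos at this
    have : p = q := by split_ifs at this <;> omega
    rw [this]
  · have hx := h.lt_of_adj x z hz
    obtain ⟨p, hp, hp', rfl⟩ := (h.adj_iff x hx z).1 hz
    obtain ⟨q, hq, hq', rfl⟩ := (h.adj_iff x hx z').1 hz'
    obtain ⟨i, rfl⟩ := exists_iterate_nextPos hp' hq hq'
    refine ⟨i, ?_⟩
    have key : ∀ i, (off inp x ≤ (nextPos inp x)^[i] p ∧
        (nextPos inp x)^[i] p < off inp (x + 1)) ∧
        (nextNbr inp x)^[i] (inp.getD p 0) = inp.getD ((nextPos inp x)^[i] p) 0 := by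
      intro i
      induction i with
      | zero => exact ⟨⟨hp, hp'⟩, rfl⟩
      | succ i ih =>
        rw [Function.iterate_succ_apply', Function.iterate_succ_apply', ih.2]
        exact ⟨nextPos_mem ih.1.1 ih.1.2, h.nextNbr_eq hx ih.1.1 ih.1.2⟩
    exact (key i).2

theorem off_mono (h : Represents inp n G) {i j : ℕ} (hij : i ≤ j) (hj : j ≤ n) :
    off inp i ≤ off inp j := by
  induction j, hij using Nat.le_induction with
  | base => exact le_rfl
  | succ j hij ih => exact (ih (by omega)).trans (h.off_le_succ j (by omega))

theorem sum_off (h : Represents inp n G) :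
    ∑ v ∈ Finset.range n, (off inp (v + 1) - off inp v) = off inp n - off inp 0 := by
  have : ∀ m ≤ n, ∑ v ∈ Finset.range m, (off inp (v + 1) - off inp v) =
      off inp m - off inp 0 := by
    intro m
    induction m with
    | zero => simp
    | succ m ih =>
      intro hm
      rw [Finset.sum_range_succ, ih (by omega)]
      have := h.off_le_succ m (by omega)
      have := h.off_mono (Nat.zero_le m) (by omega)
      omega
  exact this n le_rfl

theorem degree_eq (h : Represents inp n G) {v : ℕ} (hv : v < n) :
    off inp (v + 1) - off inp v = (nbrs G (Finset.range n) v).card := by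
  rw [← Nat.card_Ico]
  refine Finset.card_bij (fun p _ => inp.getD p 0) ?_ ?_ ?_
  · intro p hp
    rw [Finset.mem_Ico] at hp
    have := h.adj_getD hv hp.1 hp.2
    exact mem_nbrs.2 ⟨Finset.mem_range.2 (h.lt_right this), this⟩
  · intro p hp q hq hpq
    rw [Finset.mem_Ico] at hp hq
    exact h.eq_of_getD_eq hv hp.1 hp.2 hq.1 hq.2 hpq
  · intro u hu
    obtain ⟨p, hp, hp', rfl⟩ := (h.adj_iff v hv u).1 (mem_nbrs.1 hu).2
    exact ⟨p, Finset.mem_Ico.2 ⟨hp, hp'⟩, rfl⟩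

theorem degree_le (h : Represents inp n G) {v : ℕ} (hv : v < n) :
    off inp (v + 1) - off inp v ≤ n := by
  rw [h.degree_eq hv]
  exact (Finset.card_le_card fun u hu => (mem_nbrs.1 hu).1).trans (Finset.card_range n).le

/-- Addresses are thus quadratic in n, which is why words of a constant multiple of log n bits
suffice. -/
theorem off_le (h : Represents inp n G) {i : ℕ} (hi : i ≤ n) : off inp i ≤ n + 3 + n * n := by
  have h1 : ∑ v ∈ Finset.range n, (off inp (v + 1) - off inp v) ≤ n * n := by
    refine (Finset.sum_le_card_nsmul _ _ n fun v hv => ?_).trans (by simp)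
    exact h.degree_le (Finset.mem_range.1 hv)
  rw [h.sum_off, h.off_zero] at h1
  have := h.off_mono hi le_rfl
  have := h.off_mono (Nat.zero_le n) le_rfl
  rw [h.off_zero] at this
  omega

theorem exists_darts (h : Represents inp n G) :
    ∃ D : Finset (ℕ × ℕ), D.card ≤ off inp n - off inp 0 ∧
      ∀ x z, G.Adj x z → (x, z) ∈ D := by
  refine ⟨(Finset.range n).biUnion fun x =>
    (Finset.Ico (off inp x) (off inp (x + 1))).image fun p => (x, inp.getD p 0), ?_, ?_⟩
  · rw [← h.sum_off]
    refine Finset.card_biUnion_le.trans (Finset.sum_le_sum fun x _ => ?_)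
    exact Finset.card_image_le.trans (by simp)
  · intro x z hxz
    have hx := h.lt_of_adj x z hxz
    obtain ⟨p, hp, hp', rfl⟩ := (h.adj_iff x hx z).1 hxz
    simp only [Finset.mem_biUnion, Finset.mem_image, Finset.mem_range, Finset.mem_Ico]
    exact ⟨x, hx, p, ⟨hp, hp'⟩, rfl⟩

end Represents

end Representation

/-! ### Membership in the current set -/

section Member

/-- The registers `2`, `3`, `4`, `5` hold `0`, `1`, `n`, `2`, and the first cells of the working
memory hold the elements of `X` in increasing order; their number is in register `1`. -/
structure Ready (n : ℕ) (X : Finset ℕ) (s : State) : Prop where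
  reg_one : s.reg 1 = X.card
  reg_two : s.reg 2 = 0
  reg_three : s.reg 3 = 1
  reg_four : s.reg 4 = n
  reg_five : s.reg 5 = 2
  card_le_top : X.card ≤ s.top
  lt : ∀ i j, i < j → j < X.card → s.mem i < s.mem j
  mem_iff : ∀ x, x ∈ X ↔ ∃ i < X.card, s.mem i = x
  subset : X ⊆ Finset.range n

theorem Ready.frame {n m : ℕ} {X : Finset ℕ} {s s' : State} (h : Ready n X s) (hF : Frame m s s')
    (hm : 6 ≤ m) : Ready n X s' := by
  constructor
  · rw [hF.reg 1 (by omega), h.reg_one]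
  · rw [hF.reg 2 (by omega), h.reg_two]
  · rw [hF.reg 3 (by omega), h.reg_three]
  · rw [hF.reg 4 (by omega), h.reg_four]
  · rw [hF.reg 5 (by omega), h.reg_five]
  · rw [hF.top]; exact h.card_le_top
  · rw [hF.mem]; exact h.lt
  · rw [hF.mem]; exact h.mem_iff
  · exact h.subset

theorem Ready.card_le {n : ℕ} {X : Finset ℕ} {s : State} (h : Ready n X s) : X.card ≤ n := by
  simpa using Finset.card_le_card h.subset

theorem Ready.le {n : ℕ} {X : Finset ℕ} {s : State} (h : Ready n X s) {i j : ℕ} (hij : i ≤ j)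
    (hj : j < X.card) : s.mem i ≤ s.mem j := by
  rcases hij.lt_or_eq with hlt | rfl
  · exact (h.lt i j hlt hj).le
  · exact le_rfl

variable {w : ℕ} {inp : List ℕ}

/-- Find the position that the content of register `29` has, or would have, among the elements
of the current set. -/
def locate : Prog := .move 34 29 ⨟ .move 30 2 ⨟ .move 31 1 ⨟ lowerBound .load

theorem locate_run {n N x : ℕ} {X : Finset ℕ} {s : State} (h : Ready n X s) (hx : s.reg 29 = x)
    (hN : n < 2 ^ N) (hw : 2 * n < 2 ^ w) :
    Run w inp locate s (N * 6 + 4) fun s' => Frame 30 s s' ∧ s'.reg 30 ≤ X.card ∧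
      (∀ i, i < s'.reg 30 → s.mem i < x) ∧ ∀ i, s'.reg 30 ≤ i → i < X.card → x ≤ s.mem i := by
  have hc := h.card_le
  refine Run.of_le (b := 1 + (1 + (1 + (N * 6 + 1)))) ?_ (by omega)
  refine .seq (.move hx h.reg_three ?_)
  refine .seq (.move (a := 0) (by simp [h.reg_two]) (by simp [h.reg_three]) ?_)
  refine .seq (.move (a := X.card) (by simp [h.reg_one]) (by simp [h.reg_three]) ?_)
  set s₁ := ((s.setReg 34 x).setReg 30 0).setReg 31 X.card with hs₁
  have hF : Frame 30 s s₁ := (((Frame.refl 30 s).setReg (by norm_num)).setReg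
    (by norm_num)).setReg (by norm_num)
  refine (lowerBound_run (f := s.mem) (lo := 0) (hi := X.card) (key := x) (N := N)
    (by simp [hs₁, h.reg_three]) (by simp [hs₁]) (by simp [hs₁]) (by simp [hs₁]) (Nat.zero_le _)
    (by omega) (by omega) (fun i j _ hij hj => h.le hij hj) ?_).mono le_rfl ?_
  · intro s₂ a Q hF₂ ha _ haX hQ
    refine .load ha ?_ ?_ hQ
    · rw [hF₂.mem, hF.mem]
    · rw [hF₂.top, hF.top]
      exact haX.trans_le h.card_le_top
  · rintro s' ⟨hF', _, _, h2, h3, h4⟩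
    exact ⟨hF.trans hF', h2, fun i hi => h3 i (Nat.zero_le _) hi, h4⟩

/-- Put `1` into register `28` if the content of register `29` is in the current set, and `0`
otherwise. -/
def member : Prog :=
  locate ⨟ .const 28 0 ⨟
  .ite .lt 30 1 (.load 33 30 ⨟ .ite .eq 33 29 (.const 28 1) .skip) .skip

theorem member_run {n N x : ℕ} {X : Finset ℕ} {s : State} (h : Ready n X s) (hx : s.reg 29 = x)
    (hN : n < 2 ^ N) (hw : 2 * n < 2 ^ w) (hw1 : 1 < 2 ^ w) :
    Run w inp member s (N * 6 + 9) fun s' =>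
      Frame 28 s s' ∧ s'.reg 29 = x ∧ s'.reg 28 = if x ∈ X then 1 else 0 := by
  refine Run.of_le (b := (N * 6 + 4) + (1 + ((1 + (1 + 1)) + 1))) ?_ (by omega)
  refine .bind (locate_run h hx hN hw) ?_
  rintro s₁ ⟨hF, hle, hlt, hge⟩
  refine .seq (.const (by omega) ?_)
  have hF' : Frame 28 s (s₁.setReg 28 0) := (hF.mono (by norm_num)).setReg le_rfl
  have h29 : (s₁.setReg 28 0).reg 29 = x := by simp [hF.reg, hx]
  have h1 : s₁.reg 1 = X.card := by rw [hF.reg 1 (by norm_num), h.reg_one]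
  refine .ite (fun hc => ?_) (fun hc => ?_)
  · simp [Cmp.holds, h1] at hc
    refine .seq (.load (a := s₁.reg 30) (v := s.mem (s₁.reg 30)) (by simp) (by simp [hF.mem]) ?_ ?_)
    · simp only [State.top_setReg, hF.top]
      exact hc.trans_le h.card_le_top
    · refine .ite (fun hc' => .const hw1 ?_) (fun hc' => .skip ?_)
      · simp [Cmp.holds, hF.reg, hx] at hc'
        refine ⟨(hF'.setReg (by norm_num)).setReg (by norm_num), by simpa using h29, ?_⟩
        rw [if_pos ((h.mem_iff x).2 ⟨_, hc, hc'⟩)]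
        simp
      · simp [Cmp.holds, hF.reg, hx] at hc'
        refine ⟨hF'.setReg (by norm_num), by simpa using h29, ?_⟩
        rw [if_neg]
        · simp
        · intro hxX
          obtain ⟨i, hi, rfl⟩ := (h.mem_iff _).1 hxX
          rcases Nat.lt_trichotomy i (s₁.reg 30) with hl | rfl | hl
          · exact absurd (hlt i hl) (lt_irrefl _)
          · exact hc' rfl
          · have := h.lt _ _ hl hi
            have := hge _ le_rfl hc
            omega
  · simp [Cmp.holds, h1] at hc
    refine (Run.skip (Q := fun s' => Frame 28 s s' ∧ s'.reg 29 = x ∧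
      s'.reg 28 = if x ∈ X then 1 else 0) ⟨hF', h29, ?_⟩).of_le (by norm_num)
    rw [if_neg]
    · simp
    · intro hxX
      obtain ⟨i, hi, rfl⟩ := (h.mem_iff _).1 hxX
      exact absurd (hlt i (by omega)) (lt_irrefl _)

end Member

end ROWordRAM

namespace ROWordRAM

/-! ### One step of the contour walk as a program -/

section Walk

/-- The input represents `G`, words of `w` bits suffice for addresses, and `n < 2 ^ N`. -/
structure Setting (w : ℕ) (inp : List ℕ) (n N : ℕ) (G : SimpleGraph ℕ) : Prop where
  rep : Represents inp n G
  small : 4 * ((n + 3) * (n + 3)) ≤ 2 ^ w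
  lt_pow : n < 2 ^ N

variable {w n N : ℕ} {inp : List ℕ} {G : SimpleGraph ℕ} {X : Finset ℕ}

theorem Setting.off_lt (h : Setting w inp n N G) {i : ℕ} (hi : i ≤ n) :
    2 * off inp i + 2 < 2 ^ w := by
  have := h.rep.off_le hi
  have := h.small
  nlinarith

theorem Setting.lin_lt (h : Setting w inp n N G) : 8 * n + 16 < 2 ^ w := by
  have := h.small
  nlinarith

/-- Advance register `20` to the next position in the adjacency array of register `19`. -/
def advance : Prog :=
  .op .add 33 19 5 ⨟ .op .add 33 33 3 ⨟ .op .add 20 20 3 ⨟ .read 32 33 ⨟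
  .ite .eq 20 32 (.op .add 33 19 5 ⨟ .read 20 33) .skip

theorem advance_run (h : Setting w inp n N G) {s : State} {x p : ℕ} (hr : Ready n X s)
    (hx : s.reg 19 = x) (hxn : x < n) (hp : s.reg 20 = p) (hlt : p < off inp (x + 1)) :
    Run w inp advance s 7 fun s' =>
      Frame 20 s s' ∧ s'.reg 29 = s.reg 29 ∧ s'.reg 20 = nextPos inp x p := by
  have hl := h.lin_lt
  have ho := h.off_lt (i := x + 1) hxn
  have ho' := h.off_lt (i := x) hxn.le
  refine Run.of_le (b := 1 + (1 + (1 + (1 + ((1 + 1) + 1))))) ?_ (by omega)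
  refine .seq (.add hx hr.reg_five (by omega) ?_)
  refine .seq (.add (a := x + 2) (c := 1) (by simp) (by simp [hr.reg_three]) (by omega) ?_)
  refine .seq (.add (a := p) (c := 1) (by simp [hp]) (by simp [hr.reg_three]) (by omega) ?_)
  refine .seq (.read (a := x + 1 + 2) (v := off inp (x + 1)) (by simp) rfl (by omega) ?_)
  set s₁ := (((s.setReg 33 (x + 2)).setReg 33 (x + 2 + 1)).setReg 20 (p + 1)).setReg 32
    (off inp (x + 1)) with hs₁
  have hF : Frame 20 s s₁ := (((Frame.setReg (Frame.refl 20 s) (by norm_num)).setReg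
    (by norm_num)).setReg (by norm_num)).setReg (by norm_num)
  refine .ite (fun hc => ?_) (fun hc => (Run.skip ?_).of_le (by norm_num))
  · simp [Cmp.holds, hs₁] at hc
    refine .seq (.add (a := x) (c := 2) (by simp [hs₁, hx]) (by simp [hs₁, hr.reg_five])
      (by omega) ?_)
    refine .read (a := x + 2) (v := off inp x) (by simp) rfl (by omega) ?_
    refine ⟨(hF.setReg (by norm_num)).setReg (by norm_num), by simp [hs₁], ?_⟩
    simp [nextPos, hc]
  · simp [Cmp.holds, hs₁] at hc
    refine ⟨hF, by simp [hs₁], ?_⟩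
    simp [nextPos, hc, hs₁]

/-- Put into register `20` the position of register `19` in the adjacency array of
register `29`. -/
def reverse : Prog :=
  .move 34 19 ⨟ .op .add 33 29 5 ⨟ .read 30 33 ⨟ .op .add 33 33 3 ⨟ .read 31 33 ⨟
  lowerBound .read ⨟ .move 20 30

/-- When the walk moves from x to z, it must continue after x in the array of z. The arrays are
sorted, so binary search finds x there. -/
theorem reverse_run (h : Setting w inp n N G) {s : State} {x z : ℕ} (hr : Ready n X s)
    (hx : s.reg 19 = x) (hz : s.reg 29 = z) (hadj : G.Adj z x) :
    Run w inp reverse s (N * 6 + 7) fun s' => Frame 20 s s' ∧ s'.reg 29 = z ∧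
      off inp z ≤ s'.reg 20 ∧ s'.reg 20 < off inp (z + 1) ∧ inp.getD (s'.reg 20) 0 = x := by
  have hzn := h.rep.lt_of_adj z x hadj
  have hl := h.lin_lt
  have ho := h.off_lt (i := z + 1) hzn
  have ho' := h.off_lt (i := z) hzn.le
  have hdeg := h.rep.degree_le hzn
  have hN := h.lt_pow
  refine Run.of_le (b := 1 + (1 + (1 + (1 + (1 + ((N * 6 + 1) + 1)))))) ?_ (by omega)
  refine .seq (.move hx hr.reg_three ?_)
  refine .seq (.add (a := z) (c := 2) (by simp [hz]) (by simp [hr.reg_five]) (by omega) ?_)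
  refine .seq (.read (a := z + 2) (v := off inp z) (by simp) rfl (by omega) ?_)
  refine .seq (.add (a := z + 2) (c := 1) (by simp) (by simp [hr.reg_three]) (by omega) ?_)
  refine .seq (.read (a := z + 1 + 2) (v := off inp (z + 1)) (by simp) rfl (by omega) ?_)
  set s₁ := ((((s.setReg 34 x).setReg 33 (z + 2)).setReg 30 (off inp z)).setReg 33
    (z + 2 + 1)).setReg 31 (off inp (z + 1)) with hs₁
  have hF : Frame 30 s s₁ := (((((Frame.refl 30 s).setReg (by norm_num)).setReg
    (by norm_num)).setReg (by norm_num)).setReg (by norm_num)).setReg (by norm_num)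
  refine .bind (lowerBound_run (f := fun p => inp.getD p 0) (lo := off inp z)
    (hi := off inp (z + 1)) (key := x) (N := N) (by simp [hs₁, hr.reg_three]) (by simp [hs₁])
    (by simp [hs₁]) (by simp [hs₁]) (h.rep.off_le_succ z hzn) (by omega) (by omega) ?_ ?_) ?_
  · intro i j hi hij hj
    rcases hij.lt_or_eq with hlt | rfl
    · exact (h.rep.lt z hzn i j hi hlt hj).le
    · exact le_rfl
  · intro s₂ a Q _ ha hla hah hQ
    refine .read ha rfl ?_ hQ
    have := h.rep.lt_right (h.rep.adj_getD hzn hla hah)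
    omega
  · rintro s₂ ⟨hF₂, _, h1, h2, h3, h4⟩
    have hF' := hF.trans hF₂
    refine .move rfl (by rw [hF'.reg 3 (by norm_num), hr.reg_three]) ?_
    refine ⟨(hF'.mono (by norm_num)).setReg le_rfl, ?_, ?_⟩
    · simp [hF'.reg, hz]
    · simp only [State.reg_setReg, if_true]
      obtain ⟨p, hp, hp', hpx⟩ := (h.rep.adj_iff z hzn x).1 hadj
      have hlep : s₂.reg 30 ≤ p := by
        by_contra hc
        have := h3 p hp (by omega)
        omega
      refine ⟨h1, by omega, ?_⟩
      rcases hlep.lt_or_eq with hlt | heq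
      · have := h.rep.lt z hzn _ _ h1 hlt hp'
        have := h4 _ le_rfl (by omega)
        omega
      · rw [heq, hpx]

/-- Record that the walk goes from register `19` to register `29`. -/
def record : Prog :=
  .ite .eq 29 15 (.ite .ne 18 4 (.ite .ne 18 19 (.const 16 1) .skip) .skip) .skip ⨟
  .ite .eq 19 15 (.move 18 29) .skip ⨟
  .ite .eq 29 10 (.move 17 2) .skip

theorem record_run (hw : 1 < 2 ^ w) {s : State} (hr : Ready n X s) :
    Run w inp record s 8 fun s' => Frame 16 s s' ∧ s'.reg 19 = s.reg 19 ∧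
      s'.reg 20 = s.reg 20 ∧ s'.reg 29 = s.reg 29 ∧
      s'.reg 16 = (if s.reg 29 = s.reg 15 ∧ s.reg 18 ≠ n ∧ s.reg 18 ≠ s.reg 19 then 1
        else s.reg 16) ∧
      s'.reg 18 = (if s.reg 19 = s.reg 15 then s.reg 29 else s.reg 18) ∧
      s'.reg 17 = (if s.reg 29 = s.reg 10 then 0 else s.reg 17) := by
  have h4 := hr.reg_four
  have h2 := hr.reg_two
  refine Run.of_le (b := ((((1 + 1) + 1) + 1)) + ((1 + 1) + (1 + 1))) ?_ (by omega)
  refine .bind (Q' := fun s' => s' = s.setReg 16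
    (if s.reg 29 = s.reg 15 ∧ s.reg 18 ≠ n ∧ s.reg 18 ≠ s.reg 19 then 1 else s.reg 16)) ?_ ?_
  · have hself : s.setReg 16 (s.reg 16) = s := by simp [State.setReg]
    refine .ite (fun hc => .ite (fun hc' => .ite (fun hc'' => .const hw ?_) (fun hc'' =>
      .skip ?_)) (fun hc' => (Run.skip ?_).of_le (by norm_num)))
      (fun hc => (Run.skip ?_).of_le (by norm_num)) <;> simp_all [Cmp.holds]
  · rintro _ rfl
    refine .bind (Q' := fun s' => s' = (s.setReg 16
      (if s.reg 29 = s.reg 15 ∧ s.reg 18 ≠ n ∧ s.reg 18 ≠ s.reg 19 then 1 else s.reg 16)).setReg 18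
        (if s.reg 19 = s.reg 15 then s.reg 29 else s.reg 18)) ?_ ?_
    · refine .ite (fun hc => .move (a := s.reg 29) (by simp) (by simp [hr.reg_three]) ?_)
        (fun hc => .skip ?_)
      · simp [Cmp.holds] at hc
        simp [hc]
      · simp [Cmp.holds] at hc
        simp [hc, State.setReg]
    · rintro _ rfl
      refine .ite (fun hc => .move (a := 0) (by simp [h2]) (by simp [hr.reg_three]) ?_)
        (fun hc => .skip ?_)
      · simp [Cmp.holds] at hc
        refine ⟨(((Frame.refl 16 s).setReg (by norm_num)).setReg (by norm_num)).setReg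
          (by norm_num), ?_⟩
        simp [hc]
      · simp [Cmp.holds] at hc
        refine ⟨((Frame.refl 16 s).setReg (by norm_num)).setReg (by norm_num), ?_⟩
        simp [hc]

/-- One step of the contour walk. -/
def walkStep : Prog :=
  .read 29 20 ⨟ member ⨟ .ite .eq 28 2 (record ⨟ reverse ⨟ .move 19 29) .skip ⨟ advance

theorem lastExit_mem {W : Finset ℕ} {rot : ℕ → ℕ → ℕ} {d : ℕ × ℕ} {y z t : ℕ}
    (h : lastExit W rot d y t = some z) : z ∈ W := by
  induction t with
  | zero => simp [lastExit] at h
  | succ t ih =>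
    rw [lastExit] at h
    split_ifs at h with hc
    · rw [← Option.some.inj h]
      exact hc.1
    · exact ih h

/-- The registers describe the contour walk after `t` steps; it is finished after `T + 1` steps. -/
structure WalkState (inp : List ℕ) (n : ℕ) (X : Finset ℕ) (d : ℕ × ℕ) (y T b : ℕ) (s₀ : State)
    (t : ℕ) (s : State) : Prop where
  frame : Frame 16 s₀ s
  owner : s.reg 19 = (contour (Finset.range n \ X) (nextNbr inp) d t).1
  off_le : off inp (s.reg 19) ≤ s.reg 20
  lt_off : s.reg 20 < off inp (s.reg 19 + 1)
  target : inp.getD (s.reg 20) 0 = (contour (Finset.range n \ X) (nextNbr inp) d t).2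
  last : s.reg 18 = (lastExit (Finset.range n \ X) (nextNbr inp) d y t).getD n
  bad : s.reg 16 = 0 ↔ b = 0 ∧ ∀ t' < t, ¬ Mismatch (Finset.range n \ X) (nextNbr inp) d y t'
  run : s.reg 17 = if t = T + 1 then 0 else 1

theorem walkStep_run (h : Setting w inp n N G) {s₀ s : State} (hr : Ready n X s₀) {v u y T b t : ℕ}
    (hvu : G.Adj v u) (hv : v ∈ Finset.range n \ X)
    (hT : ∀ t < T, (contour (Finset.range n \ X) (nextNbr inp) (v, u) t).2 ≠ v)
    (hTv : (contour (Finset.range n \ X) (nextNbr inp) (v, u) T).2 = v)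
    (h10 : s₀.reg 10 = v) (h15 : s₀.reg 15 = y) (ht : t < T + 1)
    (hs : WalkState inp n X (v, u) y T b s₀ t s) :
    Run w inp walkStep s (N * 12 + 34) (WalkState inp n X (v, u) y T b s₀ (t + 1)) := by
  have hl := h.lin_lt
  have hrot := h.rep.isRotation
  obtain ⟨hF, hown, hoff, hlt, htar, hlast, hbad, hrun⟩ := hs
  obtain ⟨hadj, hxW⟩ := contour_adj (d := (v, u)) hrot hvu hv t
  have hsucc := contour_succ (W := Finset.range n \ X) (nextNbr inp) (v, u) t
  have hltmem := @lastExit_mem (Finset.range n \ X) (nextNbr inp) (v, u) y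
  have hTt := hT t
  have hTtv : t = T → (contour (Finset.range n \ X) (nextNbr inp) (v, u) t).2 = v := by
    rintro rfl; exact hTv
  obtain ⟨⟨x, z⟩, hc⟩ : ∃ c, contour (Finset.range n \ X) (nextNbr inp) (v, u) t = c := ⟨_, rfl⟩
  obtain ⟨c', hc'⟩ : ∃ c, contour (Finset.range n \ X) (nextNbr inp) (v, u) (t + 1) = c :=
    ⟨_, rfl⟩
  have hlsucc : lastExit (Finset.range n \ X) (nextNbr inp) (v, u) y (t + 1) =
      if z ∈ Finset.range n \ X ∧ x = y then some z
      else lastExit (Finset.range n \ X) (nextNbr inp) (v, u) y t := by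
    rw [lastExit, hc]
  have hmis : Mismatch (Finset.range n \ X) (nextNbr inp) (v, u) y t ↔
      z ∈ Finset.range n \ X ∧ z = y ∧
        ∃ l, lastExit (Finset.range n \ X) (nextNbr inp) (v, u) y t = some l ∧ l ≠ x := by
    rw [Mismatch, hc]
  rw [hc] at hadj hxW htar hown hsucc hTt hTtv
  rw [hc'] at hsucc
  simp only at hadj hxW htar hown hTt hTtv
  have hxn : x < n := h.rep.lt_of_adj x z hadj
  have hzn : z < n := h.rep.lt_right hadj
  have hrs := hr.frame hF (by norm_num)
  rw [hown] at hoff hlt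
  refine Run.of_le (b := 1 + ((N * 6 + 9) + (((8 + ((N * 6 + 7) + 1)) + 1) + 7))) ?_ (by omega)
  refine .seq (.read rfl htar (by omega) ?_)
  have hF₁ : Frame 29 s (s.setReg 29 z) := (Frame.refl 29 s).setReg le_rfl
  refine .bind (member_run (x := z) (hrs.frame hF₁ (by norm_num)) (by simp) h.lt_pow (by omega)
    (by omega)) ?_
  rintro s₁ ⟨hF₁', h29, h28⟩
  have hF₂ : Frame 28 s s₁ := (hF₁.mono (by norm_num)).trans hF₁'
  have hr₁ := hrs.frame hF₂ (by norm_num)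
  have hF₀ : Frame 16 s₀ s₁ := hF.trans (hF₂.mono (by norm_num))
  -- Whether the walk moves or passes over a dart, register 20 is left at the position just before
  -- the next dart `c'`, so one `advance` serves both branches.
  refine .bind (Q' := fun s₂ => Frame 16 s₀ s₂ ∧ s₂.reg 19 = c'.1 ∧
    (∃ p, s₂.reg 20 = p ∧ off inp c'.1 ≤ p ∧ p < off inp (c'.1 + 1) ∧
      inp.getD (nextPos inp c'.1 p) 0 = c'.2) ∧ c'.1 < n ∧
    s₂.reg 18 = (lastExit (Finset.range n \ X) (nextNbr inp) (v, u) y (t + 1)).getD n ∧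
    (s₂.reg 16 = 0 ↔
      b = 0 ∧ ∀ t' < t + 1, ¬ Mismatch (Finset.range n \ X) (nextNbr inp) (v, u) y t') ∧
    s₂.reg 17 = if t + 1 = T + 1 then 0 else 1) ?_ ?_
  · refine .ite (fun hc => ?_) (fun hc => ?_)
    · simp only [Cmp.holds, hr₁.reg_two, h28] at hc
      have hzX : z ∉ X := by
        intro hzX
        simp [hzX] at hc
      have hzW : z ∈ Finset.range n \ X := by simp [hzn, hzX]
      rw [dartNext, if_pos hzW] at hsucc
      subst hsucc
      refine .bind (record_run (by omega) hr₁) ?_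
      rintro s₂ ⟨hF₃, h19, h20, h29', h16, h18, h17⟩
      have hr₂ := hr₁.frame hF₃ (by norm_num)
      have h19' : s₁.reg 19 = x := by rw [hF₂.reg 19 (by norm_num), hown]
      refine .bind (reverse_run h hr₂ (h19.trans h19') (h29'.trans h29) hadj.symm) ?_
      rintro s₃ ⟨hF₄, h29'', hp, hp', hpx⟩
      refine .move h29'' (by rw [hF₄.reg 3 (by norm_num), hr₂.reg_three]) ?_
      have h15' : s₁.reg 15 = y := by rw [hF₀.reg 15 (by norm_num), h15]
      have h10' : s₁.reg 10 = v := by rw [hF₀.reg 10 (by norm_num), h10]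
      have h18' : s₁.reg 18 = _ := (hF₂.reg 18 (by norm_num)).trans hlast
      have h16' : s₁.reg 16 = _ := hF₂.reg 16 (by norm_num)
      have h17' : s₁.reg 17 = _ := (hF₂.reg 17 (by norm_num)).trans hrun
      refine ⟨((hF₀.trans hF₃).trans (hF₄.mono (by norm_num))).setReg (by norm_num), by simp,
        ⟨s₃.reg 20, by simp, hp, hp', ?_⟩, hzn, ?_, ?_, ?_⟩
      · rw [← h.rep.nextNbr_eq hzn hp hp', hpx]
      · simp only [State.reg_setReg]
        rw [if_neg (by norm_num), hF₄.reg 18 (by norm_num), h18, h19', h15', h29, h18', hlsucc]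
        by_cases hxy : x = y <;> simp [hxy, hzW]
      · simp only [State.reg_setReg]
        rw [if_neg (by norm_num), hF₄.reg 16 (by norm_num), h16, h29, h15', h18', h19', h16']
        -- Register 18 holds n for "not left yet", which is unambiguous because vertices are smaller
        -- than n.
        have hm : Mismatch (Finset.range n \ X) (nextNbr inp) (v, u) y t ↔ (z = y ∧
            (lastExit (Finset.range n \ X) (nextNbr inp) (v, u) y t).getD n ≠ n ∧
            (lastExit (Finset.range n \ X) (nextNbr inp) (v, u) y t).getD n ≠ x) := by
          rw [hmis]
          cases hle : lastExit (Finset.range n \ X) (nextNbr inp) (v, u) y t with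
          | none => simp
          | some l =>
            have := hltmem hle
            simp only [Finset.mem_sdiff, Finset.mem_range] at this
            simp [hzW, this.1.ne]
        rw [Nat.forall_lt_succ_right]
        split_ifs with hmm <;> rw [← hm] at hmm
        · simp [hmm]
        · rw [hbad]
          simp [hmm]
      · simp only [State.reg_setReg]
        rw [if_neg (by norm_num), hF₄.reg 17 (by norm_num), h17, h29, h10', h17']
        by_cases htT : t = T
        · simp [htT, hTtv htT]
        · rw [if_neg (hTt (by omega)), if_neg (by omega), if_neg (by omega)]
    · simp only [Cmp.holds, hr₁.reg_two, h28] at hc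
      have hzX : z ∈ X := by
        by_contra hzX
        simp [hzX] at hc
      have hzW : z ∉ Finset.range n \ X := by simp [hzX]
      rw [dartNext, if_neg hzW] at hsucc
      subst hsucc
      refine (Run.skip ?_).of_le (by omega)
      -- At time T the target is v, which is in W, so this branch never ends the walk.
      have htT : t ≠ T := by
        rintro rfl
        rw [hTtv rfl] at hzW
        exact hzW hv
      refine ⟨hF₀, by rw [hF₂.reg 19 (by norm_num), hown], ⟨s.reg 20, ?_, hoff, hlt, ?_⟩, hxn,
        ?_, ?_, ?_⟩
      · rw [hF₂.reg 20 (by norm_num)]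
      · rw [← h.rep.nextNbr_eq hxn hoff hlt, htar]
      · rw [hF₂.reg 18 (by norm_num), hlast, hlsucc, if_neg (fun h => hzW h.1)]
      · rw [hF₂.reg 16 (by norm_num), hbad, Nat.forall_lt_succ_right]
        have : ¬ Mismatch (Finset.range n \ X) (nextNbr inp) (v, u) y t :=
          fun hm => hzW (hmis.1 hm).1
        simp [this]
      · rw [hF₂.reg 17 (by norm_num), hrun, if_neg (by omega), if_neg (by omega)]
  · rintro s₂ ⟨hF₃, h19, ⟨p, h20, hp, hp', hpt⟩, hcn, h18, h16, h17⟩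
    refine (advance_run h (hr.frame hF₃ (by norm_num)) h19 hcn h20 hp').mono le_rfl ?_
    rintro s₃ ⟨hF₄, _, h20'⟩
    have h19' : s₃.reg 19 = c'.1 := by rw [hF₄.reg 19 (by norm_num), h19]
    refine ⟨hF₃.trans (hF₄.mono (by norm_num)), by rw [h19', hc'], ?_, ?_, ?_, ?_, ?_, ?_⟩
    · rw [h19', h20']
      exact (Represents.nextPos_mem hp hp').1
    · rw [h19', h20']
      exact (Represents.nextPos_mem hp hp').2
    · rw [h20', hpt, hc']
    · rw [hF₄.reg 18 (by norm_num), h18]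
    · rw [hF₄.reg 16 (by norm_num), h16]
    · rw [hF₄.reg 17 (by norm_num), h17]

end Walk

end ROWordRAM

namespace ROWordRAM

/-! ### Degrees in the core, computed with constantly many words -/

section Degree

variable {w n N : ℕ} {inp : List ℕ} {G : SimpleGraph ℕ} {X : Finset ℕ}

/-- Walk around the contour that starts with the dart at position `11` of vertex `10`. Set
register `16` to `1` if there is a mismatch at the vertex in register `15`. -/
def walk : Prog :=
  .move 19 10 ⨟ .move 20 11 ⨟ .move 18 4 ⨟ .move 17 3 ⨟ .loop .ne 17 2 walkStep

theorem walk_run (h : Setting w inp n N G) {s : State} (hr : Ready n X s) {v p T : ℕ}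
    (hv : v ∈ Finset.range n \ X) (h10 : s.reg 10 = v) (h11 : s.reg 11 = p)
    (hp : off inp v ≤ p) (hp' : p < off inp (v + 1))
    (hT : ∀ t < T, (contour (Finset.range n \ X) (nextNbr inp) (v, inp.getD p 0) t).2 ≠ v)
    (hTv : (contour (Finset.range n \ X) (nextNbr inp) (v, inp.getD p 0) T).2 = v) :
    Run w inp walk s ((T + 1) * (N * 12 + 35) + 5) fun s' => Frame 16 s s' ∧
      (s'.reg 16 = 0 ↔ s.reg 16 = 0 ∧ ∀ t < T + 1,
        ¬ Mismatch (Finset.range n \ X) (nextNbr inp) (v, inp.getD p 0) (s.reg 15) t) := by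
  have h3 := hr.reg_three
  refine Run.of_le (b := 1 + (1 + (1 + (1 + ((T + 1) * (N * 12 + 34 + 1) + 1)))))
    ?_ (le_of_eq (by ring))
  refine .seq (.move h10 h3 ?_)
  refine .seq (.move (a := p) (by simp [h11]) (by simp [h3]) ?_)
  refine .seq (.move (a := n) (by simp [hr.reg_four]) (by simp [h3]) ?_)
  refine .seq (.move (a := 1) (by simp [h3]) (by simp [h3]) ?_)
  have hvn : v < n := by simpa using (Finset.mem_sdiff.1 hv).1
  refine Run.loop_range_const (I := WalkState inp n X (v, inp.getD p 0) (s.reg 15) T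
    (s.reg 16) s) _ _ (fun t s₁ ht hs => ⟨?_, ?_⟩) (fun s₁ hs => ⟨?_, hs.frame, ?_⟩) ?_
  · simp [Cmp.holds, hs.run, (hr.frame hs.frame (by norm_num)).reg_two, ht.ne]
  · exact walkStep_run h hr (h.rep.adj_getD hvn hp hp') hv hT hTv h10 rfl ht hs
  · simp [Cmp.holds, hs.run, (hr.frame hs.frame (by norm_num)).reg_two]
  · exact hs.bad
  · refine ⟨((((Frame.refl 16 s).setReg (by norm_num)).setReg (by norm_num)).setReg
      (by norm_num)).setReg (by norm_num), by simp [contour], by simpa using hp,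
      by simpa using hp', by simp [contour], by simp [lastExit], by simp, by simp⟩

/-- Set register `16` to `0` if the dart at position `11` of vertex `10` leads to a dangling tree,
and to `1` otherwise. -/
def checkDangling : Prog :=
  .move 15 2 ⨟ .move 16 2 ⨟ .loop .lt 15 4 (walk ⨟ .op .add 15 15 3)

/-- A single register remembers the last exit of a single vertex, so the walk is repeated for every
y < n. This pays a factor n of time for not keeping a stack. -/
theorem checkDangling_run (h : Setting w inp n N G) {s : State} (hr : Ready n X s) {v p : ℕ}
    (hv : v ∈ Finset.range n \ X) (h10 : s.reg 10 = v) (h11 : s.reg 11 = p)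
    (hp : off inp v ≤ p) (hp' : p < off inp (v + 1))
    (hu : inp.getD p 0 ∈ Finset.range n \ X) :
    Run w inp checkDangling s (n * ((off inp n - off inp 0) * (N * 12 + 35) + 7) + 3) fun s' =>
      Frame 15 s s' ∧
      (s'.reg 16 = 0 ↔ Dangling G (Finset.range n \ X) v (inp.getD p 0)) := by
  have h3 := hr.reg_three
  have hl := h.lin_lt
  have hvn : v < n := by simpa using (Finset.mem_sdiff.1 hv).1
  have hvu := h.rep.adj_getD hvn hp hp'
  obtain ⟨D, hDM, hD⟩ := h.rep.exists_darts
  obtain ⟨T, hTD, hT, hTv⟩ := exists_first_arrival h.rep.isRotation hvu hv hu D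
    (fun x z _ hxz => hD x z hxz)
  have hcost : (T + 1) * (N * 12 + 35) + 5 ≤
      (off inp n - off inp 0) * (N * 12 + 35) + 5 := by gcongr; omega
  refine Run.of_le (b := 1 + (1 + (n * (((off inp n - off inp 0) * (N * 12 + 35) + 5 + 1) + 1)
    + 1))) ?_ (le_of_eq (by ring))
  refine .seq (.move hr.reg_two h3 ?_)
  refine .seq (.move (a := 0) (by simp [hr.reg_two]) (by simp [h3]) ?_)
  refine Run.loop_range_const (I := fun y s' => Frame 15 s s' ∧ s'.reg 15 = y ∧
    (s'.reg 16 = 0 ↔ ∀ y' < y, ∀ t < T + 1,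
      ¬ Mismatch (Finset.range n \ X) (nextNbr inp) (v, inp.getD p 0) y' t)) _ _ ?_ ?_ ?_
  · rintro y s₁ hy ⟨hF, h15, h16⟩
    have hr₁ := hr.frame hF (by norm_num)
    refine ⟨by simp [Cmp.holds, h15, hr₁.reg_four, hy], ?_⟩
    refine .bind (b₂ := 1) ((walk_run h hr₁ hv (by rw [hF.reg 10 (by norm_num), h10])
      (by rw [hF.reg 11 (by norm_num), h11]) hp hp' hT hTv).of_le hcost) ?_
    rintro s₂ ⟨hF₂, h16'⟩
    have hr₂ := hr₁.frame hF₂ (by norm_num)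
    refine .add (a := y) (c := 1) (by rw [hF₂.reg 15 (by norm_num), h15]) hr₂.reg_three
      (by omega) ?_
    refine ⟨(hF.trans (hF₂.mono (by norm_num))).setReg le_rfl, by simp, ?_⟩
    rw [h15] at h16'
    rw [State.reg_setReg, if_neg (by norm_num), h16', h16,
      Nat.forall_lt_succ_right (p := fun y' => ∀ t < T + 1, _)]
  · rintro s₁ ⟨hF, h15, h16⟩
    refine ⟨by simp [Cmp.holds, h15, (hr.frame hF (by norm_num)).reg_four], hF, ?_⟩
    rw [h16, dangling_iff_forall_not_mismatch h.rep.isRotation hvu hv hu hT hTv]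
    constructor
    -- A mismatch can only occur at a vertex of W, so checking y < n is enough.
    · intro hm y t ht hmm
      have := hmm.1
      rw [hmm.2.1] at this
      exact hm y (by simpa using (Finset.mem_sdiff.1 this).1) t (by omega) hmm
    · intro hm y _ t ht
      exact hm y t (by omega)
  · exact ⟨((Frame.refl 15 s).setReg (by norm_num)).setReg (by norm_num), by simp, by simp⟩

/-- Put into register `13` the degree of vertex `10` in the core. -/
def countCore : Prog :=
  .op .add 33 10 5 ⨟ .read 11 33 ⨟ .op .add 33 33 3 ⨟ .read 12 33 ⨟ .move 13 2 ⨟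
  .loop .lt 11 12 (
    .read 29 11 ⨟ member ⨟
    .ite .eq 28 2 (checkDangling ⨟ .ite .ne 16 2 (.op .add 13 13 3) .skip) .skip ⨟
    .op .add 11 11 3)

/-- Bound on the number of steps for one neighbour. -/
def checkCost (n M N : ℕ) : ℕ := n * (M * (N * 12 + 35) + 7) + N * 6 + 20

open scoped Classical in
theorem coreDeg_eq_card_positions (h : Setting w inp n N G) {v : ℕ} (hv : v < n)
    (W : Finset ℕ) : coreDeg G W v = ((Finset.Ico (off inp v) (off inp (v + 1))).filter
      fun p => inp.getD p 0 ∈ W ∧ ¬ Dangling G W v (inp.getD p 0)).card := by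
  symm
  refine Finset.card_bij (fun p _ => inp.getD p 0) ?_ ?_ ?_
  · intro p hp
    simp only [Finset.mem_filter, Finset.mem_Ico] at hp ⊢
    exact ⟨hp.2.1, h.rep.adj_getD hv hp.1.1 hp.1.2, hp.2.2⟩
  · intro p hp q hq hpq
    simp only [Finset.mem_filter, Finset.mem_Ico] at hp hq
    exact h.rep.eq_of_getD_eq hv hp.1.1 hp.1.2 hq.1.1 hq.1.2 hpq
  · intro u hu
    simp only [Finset.mem_filter] at hu
    obtain ⟨p, hp, hp', rfl⟩ := (h.rep.adj_iff v hv u).1 hu.2.1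
    exact ⟨p, by simp only [Finset.mem_filter, Finset.mem_Ico]; exact ⟨⟨hp, hp'⟩, hu.1, hu.2.2⟩,
      rfl⟩

theorem coreDeg_le (h : Setting w inp n N G) {v : ℕ} (hv : v < n) (W : Finset ℕ) :
    coreDeg G W v ≤ n := by
  classical
  rw [coreDeg_eq_card_positions h hv]
  refine (Finset.card_filter_le _ _).trans ?_
  rw [Nat.card_Ico]
  exact h.rep.degree_le hv

open scoped Classical in
theorem countCore_run (h : Setting w inp n N G) {s : State} (hr : Ready n X s) {v : ℕ}
    (hv : v ∈ Finset.range n \ X) (h10 : s.reg 10 = v) :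
    Run w inp countCore s ((off inp (v + 1) - off inp v) *
      checkCost n (off inp n - off inp 0) N + 6) fun s' =>
      Frame 11 s s' ∧ s'.reg 13 = coreDeg G (Finset.range n \ X) v := by
  have h3 := hr.reg_three
  have hl := h.lin_lt
  have hvn : v < n := by simpa using (Finset.mem_sdiff.1 hv).1
  have ho := h.off_lt (i := v + 1) hvn
  have ho' := h.off_lt (i := v) hvn.le
  have hcd := coreDeg_le h hvn (Finset.range n \ X)
  set W := Finset.range n \ X with hW
  refine Run.of_le (b := 1 + (1 + (1 + (1 + (1 + ((off inp (v + 1) - off inp v) *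
    (1 + ((N * 6 + 9) + ((n * ((off inp n - off inp 0) * (N * 12 + 35) + 7) + 3 + (1 + 1) + 1)
      + 1)) + 1) + 1)))))) ?_ ?_
  rotate_left
  · have : 1 + ((N * 6 + 9) + ((n * ((off inp n - off inp 0) * (N * 12 + 35) + 7) + 3 + (1 + 1)
      + 1) + 1)) + 1 ≤ checkCost n (off inp n - off inp 0) N := by
      rw [checkCost]; omega
    have := Nat.mul_le_mul_left (off inp (v + 1) - off inp v) this
    omega
  refine .seq (.add h10 hr.reg_five (by omega) ?_)
  refine .seq (.read (a := v + 2) (v := off inp v) (by simp) rfl (by omega) ?_)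
  refine .seq (.add (a := v + 2) (c := 1) (by simp) (by simp [h3]) (by omega) ?_)
  refine .seq (.read (a := v + 1 + 2) (v := off inp (v + 1)) (by simp) rfl (by omega) ?_)
  refine .seq (.move (a := 0) (by simp [hr.reg_two]) (by simp [h3]) ?_)
  set s₀ := ((((s.setReg 33 (v + 2)).setReg 11 (off inp v)).setReg 33 (v + 2 + 1)).setReg 12
    (off inp (v + 1))).setReg 13 0 with hs₀
  have hF₀ : Frame 11 s s₀ := (((((Frame.refl 11 s).setReg (by norm_num)).setReg
    (by norm_num)).setReg (by norm_num)).setReg (by norm_num)).setReg (by norm_num)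
  -- Partial counts stay at most n, so the counter cannot overflow.
  have hsub : ∀ p ≤ off inp (v + 1), ((Finset.Ico (off inp v) p).filter
      fun q => inp.getD q 0 ∈ W ∧ ¬ Dangling G W v (inp.getD q 0)).card ≤ n := by
    intro p hp
    refine (Finset.card_le_card (Finset.filter_subset_filter _
      (Finset.Ico_subset_Ico_right hp))).trans ?_
    rwa [← coreDeg_eq_card_positions h hvn W]
  have key := Run.loop_range (w := w) (inp := inp) (c := .lt) (x := 11) (y := 12)
    (p := .read 29 11 ⨟ member ⨟
      .ite .eq 28 2 (checkDangling ⨟ .ite .ne 16 2 (.op .add 13 13 3) .skip) .skip ⨟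
      .op .add 11 11 3)
    (Q := fun s' => Frame 11 s s' ∧ s'.reg 13 = coreDeg G W v)
    (I := fun p s' => Frame 11 s s' ∧ s'.reg 11 = p ∧ off inp v ≤ p ∧
      s'.reg 12 = off inp (v + 1) ∧ s'.reg 13 = ((Finset.Ico (off inp v) p).filter
        fun q => inp.getD q 0 ∈ W ∧ ¬ Dangling G W v (inp.getD q 0)).card)
    (fun _ => 1 + ((N * 6 + 9) +
      ((n * ((off inp n - off inp 0) * (N * 12 + 35) + 7) + 3 + (1 + 1) + 1) + 1)))
    (off inp (v + 1)) ?_ ?_ (off inp v) s₀ (h.rep.off_le_succ v hvn)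
    ⟨hF₀, by simp [hs₀], le_rfl, by simp [hs₀], by simp [hs₀]⟩
  · simpa using key
  · rintro p s₁ hp ⟨hF, h11, hle, h12, h13⟩
    have hr₁ := hr.frame hF (by norm_num)
    have hun := h.rep.lt_right (h.rep.adj_getD hvn hle hp)
    refine ⟨by simp [Cmp.holds, h11, h12, hp], ?_⟩
    refine .seq (.read h11 rfl (by omega) ?_)
    have hF₁ : Frame 29 s₁ (s₁.setReg 29 (inp.getD p 0)) := (Frame.refl 29 s₁).setReg le_rfl
    refine .bind (member_run (x := inp.getD p 0) (hr₁.frame hF₁ (by norm_num)) (by simp)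
      h.lt_pow (by omega) (by omega)) ?_
    rintro s₂ ⟨hF₂, _, h28⟩
    have hF₂ : Frame 28 s₁ s₂ := (hF₁.mono (by norm_num)).trans hF₂
    have hF' : Frame 11 s s₂ := hF.trans (hF₂.mono (by norm_num))
    have hr₂ := hr₁.frame hF₂ (by norm_num)
    refine .bind (Q' := fun s' => Frame 11 s s' ∧ s'.reg 11 = p ∧
      s'.reg 12 = off inp (v + 1) ∧ s'.reg 13 = ((Finset.Ico (off inp v) (p + 1)).filter
        fun q => inp.getD q 0 ∈ W ∧ ¬ Dangling G W v (inp.getD q 0)).card) ?_ ?_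
    · have hcount : ((Finset.Ico (off inp v) (p + 1)).filter
          fun q => inp.getD q 0 ∈ W ∧ ¬ Dangling G W v (inp.getD q 0)).card =
          s₁.reg 13 + if inp.getD p 0 ∈ W ∧ ¬ Dangling G W v (inp.getD p 0) then 1 else 0 := by
        rw [Nat.Ico_succ_right_eq_insert_Ico hle, Finset.filter_insert, h13]
        split_ifs
        · rw [Finset.card_insert_of_notMem (by simp)]
        · rfl
      have hbound := hsub (p + 1) hp
      rw [hcount] at hbound ⊢
      have h11' : s₂.reg 11 = p := by rw [hF₂.reg 11 (by norm_num), h11]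
      have h12' : s₂.reg 12 = off inp (v + 1) := by rw [hF₂.reg 12 (by norm_num), h12]
      have h13' : s₂.reg 13 = s₁.reg 13 := hF₂.reg 13 (by norm_num)
      refine .ite (fun hc => ?_) (fun hc => ?_)
      · simp only [Cmp.holds, hr₂.reg_two, h28] at hc
        have huW : inp.getD p 0 ∈ W := by
          rw [hW, Finset.mem_sdiff, Finset.mem_range]
          refine ⟨hun, fun huX => ?_⟩
          rw [if_pos huX] at hc
          omega
        refine .bind (b₂ := 1 + 1) (checkDangling_run h hr₂ hv (by rw [hF'.reg 10 (by norm_num), h10]) h11'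
          hle hp huW) ?_
        rintro s₃ ⟨hF₃, h16⟩
        have hr₃ := hr₂.frame hF₃ (by norm_num)
        have hF'' : Frame 11 s s₃ := hF'.trans (hF₃.mono (by norm_num))
        rw [← hF₃.reg 11 (by norm_num)] at h11'
        rw [← hF₃.reg 12 (by norm_num)] at h12'
        rw [← hF₃.reg 13 (by norm_num)] at h13'
        refine .ite (fun hc' => ?_) (fun hc' => ?_)
        · simp only [Cmp.holds, hr₃.reg_two, ne_eq, h16] at hc'
          rw [if_pos ⟨huW, hc'⟩] at hbound ⊢
          refine .add h13' hr₃.reg_three (by omega) ?_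
          exact ⟨hF''.setReg (by norm_num), by simpa using h11', by simpa using h12', by simp⟩
        · simp only [Cmp.holds, hr₃.reg_two, ne_eq, h16, not_not] at hc'
          rw [if_neg (fun hh => hh.2 hc')] at hbound ⊢
          exact .skip ⟨hF'', h11', h12', h13'⟩
      · simp only [Cmp.holds, hr₂.reg_two, h28] at hc
        have huW : inp.getD p 0 ∉ W := by
          rw [hW, Finset.mem_sdiff]
          rintro ⟨_, huX⟩
          rw [if_neg huX] at hc
          exact hc rfl
        rw [if_neg (fun hh => huW hh.1)]
        exact (Run.skip (Q := fun s' => Frame 11 s s' ∧ s'.reg 11 = p ∧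
          s'.reg 12 = off inp (v + 1) ∧ s'.reg 13 = s₁.reg 13 + 0)
          ⟨hF', h11', h12', h13'⟩).of_le (by omega)
    · rintro s₃ ⟨hF₃, h11', h12', h13'⟩
      refine .add h11' (hr.frame hF₃ (by norm_num)).reg_three (by omega) ?_
      exact ⟨hF₃.setReg le_rfl, by simp, by omega, by simpa using h12', by simpa using h13'⟩
  · rintro s₁ ⟨hF, h11, _, h12, h13⟩
    refine ⟨by simp [Cmp.holds, h11, h12], hF, ?_⟩
    rw [h13, ← coreDeg_eq_card_positions h hvn W]

end Degree

end ROWordRAM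

namespace ROWordRAM

/-! ### The candidate list and insertion into the sorted array -/

section Candidates

variable {w n N : ℕ} {inp : List ℕ} {G : SimpleGraph ℕ} {X : Finset ℕ}

/-- The cells `B, …, B + c - 1` hold the elements of `E`, each of them once. -/
structure Holds (B c : ℕ) (E : Finset ℕ) (mem : ℕ → ℕ) : Prop where
  inj : ∀ i j, i < c → j < c → mem (B + i) = mem (B + j) → i = j
  mem_iff : ∀ x, x ∈ E ↔ ∃ i < c, mem (B + i) = x

theorem Holds.card {B c : ℕ} {E : Finset ℕ} {mem : ℕ → ℕ} (h : Holds B c E mem) : E.card = c := by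
  have : E = (Finset.range c).image (fun i => mem (B + i)) := by
    ext x
    simp [h.mem_iff]
  rw [this, Finset.card_image_of_injOn, Finset.card_range]
  intro i hi j hj hij
  exact h.inj i j (by simpa using hi) (by simpa using hj) hij

theorem Holds.replace {B c i y : ℕ} {E : Finset ℕ} {mem : ℕ → ℕ} (h : Holds B c E mem)
    (hi : i < c) (hy : y ∉ E) :
    Holds B c (insert y (E.erase (mem (B + i)))) (Function.update mem (B + i) y) := by
  have hne : ∀ j < c, mem (B + j) ≠ y := fun j hj hjy => hy ((h.mem_iff y).2 ⟨j, hj, hjy⟩)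
  constructor
  · intro j l hj hl hjl
    simp only [Function.update_apply, Nat.add_left_cancel_iff] at hjl
    split_ifs at hjl with h1 h2 h2
    · omega
    · exact absurd hjl.symm (hne l hl)
    · exact absurd hjl (hne j hj)
    · exact h.inj j l hj hl hjl
  · intro x
    simp only [Finset.mem_insert, Finset.mem_erase, h.mem_iff, Function.update_apply,
      Nat.add_left_cancel_iff]
    constructor
    · rintro (rfl | ⟨hx, j, hj, rfl⟩)
      · exact ⟨i, hi, by simp⟩
      · exact ⟨j, hj, if_neg (by rintro rfl; exact hx rfl)⟩
    · rintro ⟨j, hj, hjx⟩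
      split_ifs at hjx with hji
      · exact Or.inl hjx.symm
      · refine Or.inr ⟨?_, j, hj, hjx⟩
        rw [← hjx]
        exact fun he => hji (h.inj j i hj hi he)

theorem Holds.append {B c y : ℕ} {E : Finset ℕ} {mem : ℕ → ℕ} (h : Holds B c E mem)
    (hy : y ∉ E) : Holds B (c + 1) (insert y E) (Function.update mem (B + c) y) := by
  have hne : ∀ j < c, mem (B + j) ≠ y := fun j hj hjy => hy ((h.mem_iff y).2 ⟨j, hj, hjy⟩)
  constructor
  · intro j l hj hl hjl
    simp only [Function.update_apply, Nat.add_left_cancel_iff] at hjl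
    split_ifs at hjl with h1 h2 h2
    · omega
    · exact absurd hjl.symm (hne l (by omega))
    · exact absurd hjl (hne j (by omega))
    · exact h.inj j l (by omega) (by omega) hjl
  · intro x
    simp only [Finset.mem_insert, h.mem_iff, Function.update_apply, Nat.add_left_cancel_iff]
    constructor
    · rintro (rfl | ⟨j, hj, rfl⟩)
      · exact ⟨c, by omega, by simp⟩
      · exact ⟨j, by omega, if_neg (by omega)⟩
    · rintro ⟨j, hj, hjx⟩
      split_ifs at hjx with hji
      · exact Or.inl hjx.symm
      · exact Or.inr ⟨j, by omega, hjx⟩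

/-- `E` consists of the `K` largest elements of `S`, or of all of them if they are fewer. -/
structure TopOf (K : ℕ) (S E : Finset ℕ) : Prop where
  subset : E ⊆ S
  card_le : E.card ≤ K
  eq_of_lt : E.card < K → E = S
  le : ∀ x ∈ E, ∀ z ∈ S, z ∉ E → z ≤ x

/-- The result of putting `c` into a list `E` of at most `K` elements, and then removing the
smallest one if the list has become too long. -/
def IsTopInsert (K c : ℕ) (E E' : Finset ℕ) : Prop :=
  (E.card < K ∧ E' = insert c E) ∨
    (E.card = K ∧ ∃ m ∈ insert c E, (∀ x ∈ insert c E, m ≤ x) ∧ E' = (insert c E).erase m)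

/-- The only comparison that needs a detour is between the new element c, if kept, and some z of S
outside E: then the removed m belongs to E, and z ≤ m ≤ c. -/
theorem TopOf.insert {K c : ℕ} {S E E' : Finset ℕ} (h : TopOf K S E) (hc : c ∉ S)
    (hE : IsTopInsert K c E E') : TopOf K (insert c S) E' := by
  have hcE : c ∉ E := fun h' => hc (h.subset h')
  rcases hE with ⟨hK, rfl⟩ | ⟨hK, m, hm, hle, rfl⟩
  · obtain rfl := h.eq_of_lt hK
    exact ⟨subset_rfl, by rw [Finset.card_insert_of_notMem hcE]; omega, fun _ => rfl,
      fun x _ z hz hz' => absurd hz hz'⟩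
  · have hcard : ((Insert.insert c E).erase m).card = K := by
      rw [Finset.card_erase_of_mem hm, Finset.card_insert_of_notMem hcE]
      omega
    refine ⟨?_, hcard.le, by omega, ?_⟩
    · exact (Finset.erase_subset _ _).trans (Finset.insert_subset_insert _ h.subset)
    · intro x hx z hz hz'
      rw [Finset.mem_erase] at hx hz'
      by_cases hzE : z ∈ Insert.insert c E
      · have : z = m := by
          by_contra hzm
          exact hz' ⟨hzm, hzE⟩
        exact this ▸ hle x hx.2
      · rw [Finset.mem_insert, not_or] at hzE
        have hzS := Finset.mem_of_mem_insert_of_ne hz hzE.1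
        by_cases hxE : x ∈ E
        · exact h.le x hxE z hzS hzE.2
        · have hxc : x = c := (Finset.mem_insert.1 hx.2).resolve_right hxE
          have hmE : m ∈ E := (Finset.mem_insert.1 hm).resolve_left (fun he => hx.1 (hxc.trans he.symm))
          exact (h.le m hmE z hzS hzE.2).trans (hle x hx.2)

/-- Combine register `10`, a vertex, and register `13`, its degree in the core, to one number and
put it into the list that begins at the address in register `7` and whose length is in
register `9`, unless the list has the length in register `6` and no smaller element. -/
def addCandidate : Prog :=
  .op .mul 17 13 4 ⨟ .op .add 17 17 10 ⨟ .move 18 7 ⨟ .op .add 19 7 9 ⨟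
  .loop .lt 18 19 (
    .load 20 18 ⨟ .ite .lt 20 17 (.store 18 17 ⨟ .move 17 20) .skip ⨟ .op .add 18 18 3) ⨟
  .ite .lt 9 6 (.store 19 17 ⨟ .op .add 9 9 3) .skip

theorem addCandidate_run {s : State} (hr : Ready n X s) {K B c v d : ℕ} {E : Finset ℕ}
    (h6 : s.reg 6 = K) (h7 : s.reg 7 = B) (h9 : s.reg 9 = c) (h10 : s.reg 10 = v)
    (h13 : s.reg 13 = d) (hE : Holds B c E s.mem) (hcK : c ≤ K) (htop : B + K ≤ s.top)
    (hw : d * n + v < 2 ^ w) (hw' : B + K < 2 ^ w) (hv : d * n + v ∉ E) :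
    Run w inp addCandidate s (K * 6 + 8) fun s' => s'.top = s.top ∧
      (∀ r < 17, r ≠ 9 → s'.reg r = s.reg r) ∧ (∀ a < B, s'.mem a = s.mem a) ∧
      ∃ c' E', s'.reg 9 = c' ∧ c' ≤ K ∧ Holds B c' E' s'.mem ∧
        IsTopInsert K (d * n + v) E E' := by
  have h3 := hr.reg_three
  have hEc := hE.card
  refine Run.of_le (b := 1 + (1 + (1 + (1 + ((c * ((1 + ((1 + 1) + 1 + 1)) + 1) + 1) +
    ((1 + 1) + 1)))))) ?_ (by have := Nat.mul_le_mul_right 6 hcK; omega)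
  refine .seq (.mul h13 hr.reg_four (by omega) ?_)
  refine .seq (.add (a := d * n) (c := v) (by simp) (by simp [h10]) hw ?_)
  refine .seq (.move (a := B) (by simp [h7]) (by simp [h3]) ?_)
  refine .seq (.add (a := B) (c := c) (by simp [h7]) (by simp [h9]) (by omega) ?_)
  -- Register 17 carries a value through the list and swaps it with any smaller entry. List and
  -- carried value together never change as a set, and the carried value is at most every entry
  -- passed, so at the end it is the overall minimum. It is appended if there is room and dropped
  -- otherwise.
  refine .bind (b₁ := c * ((1 + ((1 + 1) + 1 + 1)) + 1) + 1) (b₂ := 1 + 1 + 1)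
    (Run.loop_range_const (Q := fun s' => s'.top = s.top ∧
      (∀ r < 17, s'.reg r = s.reg r) ∧ (∀ a < B, s'.mem a = s.mem a) ∧ s'.reg 19 = B + c ∧
      ∃ M, Holds B c M s'.mem ∧ s'.reg 17 ∉ M ∧ insert (s'.reg 17) M = insert (d * n + v) E ∧
        ∀ i < c, s'.reg 17 ≤ s'.mem (B + i))
    (I := fun i s' => s'.top = s.top ∧ (∀ r < 17, s'.reg r = s.reg r) ∧
      (∀ a < B, s'.mem a = s.mem a) ∧ s'.reg 19 = B + c ∧ s'.reg 18 = B + i ∧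
      ∃ M, Holds B c M s'.mem ∧ s'.reg 17 ∉ M ∧ insert (s'.reg 17) M = insert (d * n + v) E ∧
        ∀ i' < i, s'.reg 17 ≤ s'.mem (B + i')) _ _ ?_ ?_ ?_) ?_
  · rintro i s₁ hi ⟨ht, hreg, hmem, h19, h18, M, hM, hy, hins, hle⟩
    refine ⟨by simp [Cmp.holds, h18, h19, hi], ?_⟩
    have h3' : s₁.reg 3 = 1 := (hreg 3 (by norm_num)).trans h3
    refine .seq (.load (v := s₁.mem (B + i)) h18 rfl (by omega) ?_)
    refine .bind (b₁ := 1 + 1 + 1) (b₂ := 1) (Q' := fun s' => s'.top = s.top ∧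
      (∀ r < 17, s'.reg r = s.reg r) ∧ (∀ a < B, s'.mem a = s.mem a) ∧ s'.reg 19 = B + c ∧
      s'.reg 18 = B + i ∧ ∃ M, Holds B c M s'.mem ∧ s'.reg 17 ∉ M ∧
        insert (s'.reg 17) M = insert (d * n + v) E ∧
        ∀ i' < i + 1, s'.reg 17 ≤ s'.mem (B + i')) ?_ ?_
    · refine .ite (fun hc => ?_) (fun hc => ?_)
      · simp [Cmp.holds] at hc
        refine .seq (.store (a := B + i) (v := s₁.reg 17) (by simp [h18]) (by simp)
          (by simp; omega) ?_)
        refine .move (a := s₁.mem (B + i)) (by simp) (by simp [h3']) ?_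
        have hiM : s₁.mem (B + i) ∈ M := (hM.mem_iff _).2 ⟨i, hi, rfl⟩
        refine ⟨ht, fun r hr => ?_, fun a ha => ?_, by simp [h19], by simp [h18],
          insert (s₁.reg 17) (M.erase (s₁.mem (B + i))), ?_, ?_, ?_, ?_⟩
        · simp [show r ≠ 17 by omega, show r ≠ 20 by omega, hreg r hr]
        · simp [show a ≠ B + i by omega, hmem a ha]
        · exact hM.replace hi hy
        · simp [hc.ne]
        · rw [← hins]
          simp only [State.reg_setReg, if_true]
          rw [Finset.insert_comm, Finset.insert_erase hiM]
        · intro i' hi'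
          simp only [State.reg_setReg, if_true, State.mem_setReg, State.mem_setMem,
            Function.update_apply, Nat.add_left_cancel_iff]
          split_ifs with h'
          · exact hc.le
          · exact hc.le.trans (hle i' (by omega))
      · simp [Cmp.holds] at hc
        refine (Run.skip ?_).of_le (by norm_num)
        refine ⟨ht, fun r hr => ?_, hmem, by simp [h19], by simp [h18], M, hM, by simpa using hy,
          by simpa using hins, ?_⟩
        · simp [show r ≠ 20 by omega, hreg r hr]
        · intro i' hi'
          simp only [State.reg_setReg, State.mem_setReg]
          rw [if_neg (by norm_num)]
          rcases Nat.lt_succ_iff_lt_or_eq.1 hi' with h' | rfl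
          · exact hle i' h'
          · exact hc
    · rintro s₂ ⟨ht, hreg, hmem, h19, h18, M, hM, hy, hins, hle⟩
      refine .add h18 ((hreg 3 (by norm_num)).trans h3) (by omega) ?_
      refine ⟨ht, fun r hr => ?_, hmem, by simp [h19], by simp; omega, M, hM, by simpa using hy,
        by simpa using hins, by simpa using hle⟩
      simp [show r ≠ 18 by omega, hreg r hr]
  · rintro s₁ ⟨ht, hreg, hmem, h19, h18, hM⟩
    exact ⟨by simp [Cmp.holds, h18, h19], ht, hreg, hmem, h19, hM⟩
  · refine ⟨rfl, fun r hr => ?_, fun a _ => rfl, by simp, by simp, E, hE, by simpa using hv,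
      by simp, by simp⟩
    simp [show r ≠ 17 by omega, show r ≠ 18 by omega, show r ≠ 19 by omega]
  · rintro s₁ ⟨ht, hreg, hmem, h19, M, hM, hy, hins, hle⟩
    have hMc := hM.card
    refine .ite (fun hc => ?_) (fun hc => ?_)
    · simp only [Cmp.holds, hreg 9 (by norm_num), hreg 6 (by norm_num), h9, h6] at hc
      refine .seq (.store h19 rfl (by omega) ?_)
      refine .add (a := c) (c := 1) (by simp [hreg 9, h9]) (by simp [hreg 3, h3]) (by omega) ?_
      refine ⟨ht, fun r hr hr' => ?_, fun a ha => ?_, c + 1, insert (d * n + v) E, by simp, hc,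
        hins ▸ hM.append hy, Or.inl ⟨by omega, rfl⟩⟩
      · simp [hr', hreg r hr]
      · simp [show a ≠ B + c by omega, hmem a ha]
    · simp only [Cmp.holds, hreg 9 (by norm_num), hreg 6 (by norm_num), h9, h6] at hc
      refine (Run.skip ?_).of_le (by norm_num)
      refine ⟨ht, fun r hr _ => hreg r hr, hmem, c, M, by rw [hreg 9 (by norm_num), h9], hcK, hM,
        Or.inr ⟨by omega, s₁.reg 17, ?_, ?_, ?_⟩⟩
      · rw [← hins]; simp
      · rw [← hins]
        intro x hx
        rcases Finset.mem_insert.1 hx with rfl | hx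
        · exact le_rfl
        · obtain ⟨i, hi, rfl⟩ := (hM.mem_iff x).1 hx
          exact hle i hi
      · rw [← hins, Finset.erase_insert hy]

/-- Insert the content of register `29` into the current set. -/
def insertVertex : Prog :=
  locate ⨟ .move 32 1 ⨟
  .loop .lt 30 32 (.op .sub 33 32 3 ⨟ .load 31 33 ⨟ .store 32 31 ⨟ .move 32 33) ⨟
  .store 30 29 ⨟ .op .add 1 1 3

theorem insertVertex_run {s : State} (hr : Ready n X s) {x : ℕ} (h29 : s.reg 29 = x) (hx : x < n)
    (hxX : x ∉ X) (htop : X.card < s.top) (hN : n < 2 ^ N) (hw : 2 * n + 2 < 2 ^ w) :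
    Run w inp insertVertex s (N * 6 + n * 5 + 8) fun s' => Ready n (insert x X) s' ∧
      s'.top = s.top ∧ (∀ r < 29, r ≠ 1 → s'.reg r = s.reg r) ∧
      ∀ a, X.card < a → s'.mem a = s.mem a := by
  have hXn := hr.card_le
  refine Run.of_le (b := (N * 6 + 4) + (1 + ((n * (4 + 1) + 1) + (1 + 1)))) ?_ (by omega)
  refine .bind (locate_run hr h29 hN (by omega)) ?_
  rintro s₁ ⟨hF, hle, hlt, hge⟩
  have hr₁ := hr.frame hF (by norm_num)
  refine .seq (.move hr₁.reg_one hr₁.reg_three ?_)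
  set q := s₁.reg 30 with hq
  have hgt : ∀ i, q ≤ i → i < X.card → x < s.mem i := by
    intro i h1 h2
    refine lt_of_le_of_ne (hge i h1 h2) fun he => hxX ((hr.mem_iff x).2 ⟨i, h2, he.symm⟩)
  -- With f entries left to shift, cell q + f is the gap: nothing below it has moved, and the old
  -- entries from there on have moved up by one. Cells beyond the array, where the candidates lie,
  -- are untouched.
  let I : ℕ → State → Prop := fun f s' => s'.top = s.top ∧ (∀ r < 30, s'.reg r = s.reg r) ∧
    s'.reg 30 = q ∧ s'.reg 32 = q + f ∧ q + f ≤ X.card ∧ (∀ a < q + f, s'.mem a = s.mem a) ∧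
    (∀ a, q + f < a → a ≤ X.card → s'.mem a = s.mem (a - 1)) ∧
    ∀ a, X.card < a → s'.mem a = s.mem a
  have hloop := Run.loop (w := w) (inp := inp) (c := .lt) (x := 30) (y := 32)
    (p := .op .sub 33 32 3 ⨟ .load 31 33 ⨟ .store 32 31 ⨟ .move 32 33)
    (Q := I 0) (I := I) 4 ?_ (X.card - q) (s₁.setReg 32 X.card) ?_ ?_
  · refine .bind (hloop.of_le ?_) ?_
    · gcongr; omega
    · rintro s₂ ⟨ht, hreg, h30, h32, hq', hm1, hm2, hm3⟩
      simp only [Nat.add_zero] at h32 hq' hm1 hm2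
      refine .seq (.store h30 ((hreg 29 (by norm_num)).trans h29) (by omega) ?_)
      refine .add (a := X.card) (c := 1) (by simp [hreg 1, hr.reg_one])
        (by simp [hreg 3, hr.reg_three]) (by omega) ?_
      have hmem : ∀ a, (Function.update s₂.mem q x) a =
          if a < q then s.mem a else if a = q then x else if a ≤ X.card then s.mem (a - 1)
            else s.mem a := by
        intro a
        rw [Function.update_apply]
        split_ifs with h1 h2 h2
        · omega
        · rfl
        · exact hm1 a h2
        · exact hm2 a (by omega) (by assumption)
        · exact hm3 a (by omega)
      have hcard := Finset.card_insert_of_notMem hxX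
      refine ⟨⟨?_, ?_, ?_, ?_, ?_, ?_, ?_, ?_, ?_⟩, ht, ?_, ?_⟩
      · simp [hcard]
      · simp [hreg 2, hr.reg_two]
      · simp [hreg 3, hr.reg_three]
      · simp [hreg 4, hr.reg_four]
      · simp [hreg 5, hr.reg_five]
      · simp only [State.top_setReg, State.top_setMem]; omega
      · intro i j hij hj
        rw [hcard] at hj
        simp only [State.mem_setReg, State.mem_setMem, hmem]
        split_ifs <;> first | omega | skip
        · exact hr.lt i j hij (by omega)
        · exact hlt i (by assumption)
        · exact (hlt i (by assumption)).trans (hgt (j - 1) (by omega) (by omega))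
        · exact hgt (j - 1) (by omega) (by omega)
        · exact hr.lt (i - 1) (j - 1) (by omega) (by omega)
      · intro y
        rw [hcard, Finset.mem_insert, hr.mem_iff]
        simp only [State.mem_setReg, State.mem_setMem, hmem]
        constructor
        · rintro (rfl | ⟨i, hi, rfl⟩)
          · exact ⟨q, by omega, by simp⟩
          · by_cases hiq : i < q
            · exact ⟨i, by omega, if_pos hiq⟩
            · exact ⟨i + 1, by omega, by
                rw [if_neg (by omega), if_neg (by omega), if_pos (by omega), Nat.add_sub_cancel]⟩
        · rintro ⟨i, hi, hiy⟩
          split_ifs at hiy with h1 h2 h3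
          · exact Or.inr ⟨i, by omega, hiy⟩
          · exact Or.inl hiy.symm
          · exact Or.inr ⟨i - 1, by omega, hiy⟩
          · omega
      · exact Finset.insert_subset (Finset.mem_range.2 hx) hr.subset
      · intro r hr' hr1
        simp [hr1, hreg r (by omega)]
      · intro a ha
        simp only [State.mem_setReg, State.mem_setMem, hmem]
        rw [if_neg (by omega), if_neg (by omega), if_neg (by omega)]
  · rintro f s₂ ⟨ht, hreg, h30, h32, hq', hm1, hm2, hm3⟩ hc
    simp only [Cmp.holds, h30, h32] at hc
    obtain ⟨f, rfl⟩ : ∃ f', f = f' + 1 := ⟨f - 1, by omega⟩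
    refine ⟨f, rfl, ?_⟩
    have h3 : s₂.reg 3 = 1 := (hreg 3 (by norm_num)).trans hr.reg_three
    refine Run.of_le (b := 1 + (1 + (1 + 1))) ?_ le_rfl
    refine .seq (.sub h32 h3 (by omega) (by omega) ?_)
    refine .seq (.load (a := q + f) (v := s.mem (q + f)) (by simp) ?_ ?_ ?_)
    · exact hm1 (q + f) (by omega)
    · simp only [State.top_setReg]; omega
    refine .seq (.store (a := q + f + 1) (v := s.mem (q + f)) (by simp [h32]; omega) (by simp)
      (by simp; omega) ?_)
    refine .move (a := q + f) (by simp) (by simp [h3]) ?_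
    refine ⟨ht, fun r hr' => ?_, by simp [h30], by simp, by omega, fun a ha => ?_,
      fun a ha ha' => ?_, fun a ha => ?_⟩
    · simp [show r ≠ 32 by omega, show r ≠ 31 by omega, show r ≠ 33 by omega, hreg r hr']
    · simp [show a ≠ q + f + 1 by omega, hm1 a (by omega)]
    · simp only [State.mem_setReg, State.mem_setMem, Function.update_apply]
      split_ifs with h
      · rw [h, Nat.add_sub_cancel]
      · exact hm2 a (by omega) ha'
    · simp [show a ≠ q + f + 1 by omega, hm3 a ha]
  · refine ⟨hF.top, fun r hr' => ?_, by simp [hq], by simp; omega, by omega, fun a _ => ?_,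
      fun a h1 h2 => ?_, fun a _ => ?_⟩
    · simp [show r ≠ 32 by omega, hF.reg r hr']
    · simp [hF.mem]
    · omega
    · simp [hF.mem]
  · rintro f s₂ hI hc
    have hI' := hI
    obtain ⟨ht, hreg, h30, h32, -⟩ := hI'
    simp only [Cmp.holds, h30, h32] at hc
    obtain rfl : f = 0 := by omega
    exact hI

end Candidates

end ROWordRAM

namespace ROWordRAM

/-! ### One round of the algorithm -/

section Round

variable {w n N : ℕ} {inp : List ℕ} {G : SimpleGraph ℕ} {X : Finset ℕ}

/-- Replaces `Ready.frame` where the working memory behind the array of X, or register 0, is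
written. -/
theorem Ready.congr {s s' : State} (h : Ready n X s) (ht : s'.top = s.top)
    (hreg : ∀ r < 6, r ≠ 0 → s'.reg r = s.reg r) (hmem : ∀ a < X.card, s'.mem a = s.mem a) :
    Ready n X s' := by
  refine ⟨?_, ?_, ?_, ?_, ?_, ?_, ?_, fun x => ?_, h.subset⟩
  · rw [hreg 1 (by norm_num) (by norm_num), h.reg_one]
  · rw [hreg 2 (by norm_num) (by norm_num), h.reg_two]
  · rw [hreg 3 (by norm_num) (by norm_num), h.reg_three]
  · rw [hreg 4 (by norm_num) (by norm_num), h.reg_four]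
  · rw [hreg 5 (by norm_num) (by norm_num), h.reg_five]
  · rw [ht]; exact h.card_le_top
  · intro i j hij hj
    rw [hmem i (by omega), hmem j hj]
    exact h.lt i j hij hj
  · rw [h.mem_iff]
    constructor <;> rintro ⟨i, hi, hx⟩
    · exact ⟨i, hi, by rw [hmem i hi, hx]⟩
    · exact ⟨i, hi, by rw [← hmem i hi, hx]⟩

/-- A vertex and its degree in the core as one number. -/
noncomputable def code (G : SimpleGraph ℕ) (W : Finset ℕ) (n v : ℕ) : ℕ := coreDeg G W v * n + v

/-- Codes are compared by degree first and by vertex second, so the largest codes belong to vertices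
of largest degree, and distinct vertices have distinct codes. -/
theorem code_mod (W : Finset ℕ) {v : ℕ} (hv : v < n) : code G W n v % n = v := by
  rw [code, Nat.mul_add_mod_self_right, Nat.mod_eq_of_lt hv]

theorem code_div (W : Finset ℕ) {v : ℕ} (hv : v < n) : code G W n v / n = coreDeg G W v := by
  rw [code, add_comm, Nat.add_mul_div_right _ _ (by omega), Nat.div_eq_of_lt hv, Nat.zero_add]

/-- The codes of the vertices of the core that are smaller than `i`. -/
noncomputable def codes (G : SimpleGraph ℕ) (W : Finset ℕ) (n i : ℕ) : Finset ℕ :=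
  ((core G W).filter (· < i)).image (code G W n)

/-- Collect in the candidate list the vertices with largest degree in the core. Set register `0`
to `1` if the core is not empty, and to `0` otherwise. -/
def collect : Prog :=
  .move 9 2 ⨟ .move 0 2 ⨟ .move 10 2 ⨟
  .loop .lt 10 4 (
    .move 29 10 ⨟ member ⨟
    .ite .eq 28 2 (countCore ⨟ .ite .le 5 13 (.const 0 1 ⨟ addCandidate) .skip) .skip ⨟
    .op .add 10 10 3)

/-- Bound on the number of steps of `collect`. -/
def collectCost (n M N K : ℕ) : ℕ := M * checkCost n M N + n * (N * 6 + K * 6 + 32) + 4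

theorem collect_run (h : Setting w inp n N G) {s : State} (hr : Ready n X s) {K B : ℕ}
    (h6 : s.reg 6 = K) (h7 : s.reg 7 = B) (hXB : X.card ≤ B) (htop : B + K ≤ s.top)
    (hw : B + K < 2 ^ w) :
    Run w inp collect s (collectCost n (off inp n - off inp 0) N K) fun s' => s'.top = s.top ∧
      (∀ r < 9, r ≠ 0 → s'.reg r = s.reg r) ∧ (∀ a < B, s'.mem a = s.mem a) ∧
      (s'.reg 0 = 0 ↔ core G (Finset.range n \ X) = ∅) ∧
      ∃ E, Holds B (s'.reg 9) E s'.mem ∧ TopOf K (codes G (Finset.range n \ X) n n) E := by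
  have h3 := hr.reg_three
  have hl := h.lin_lt
  have hsmall := h.small
  set W := Finset.range n \ X with hW
  set CC := checkCost n (off inp n - off inp 0) N with hCC
  have hWn : ∀ v ∈ W, v < n := fun v hv => by simpa using (Finset.mem_sdiff.1 hv).1
  refine Run.of_le (b := 1 + (1 + (1 + (∑ v ∈ Finset.Ico 0 n, ((1 + ((N * 6 + 9) +
    ((((off inp (v + 1) - off inp v) * CC + 6 + ((1 + (K * 6 + 8)) + 1)) + 1) + 1))) + 1) + 1))))
    ?_ ?_
  rotate_left
  -- The cost for v is proportional to its degree, so the sum over all v telescopes to the number of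
  -- darts instead of n times the largest degree.
  · rw [Nat.Ico_zero_eq_range, collectCost, ← h.rep.sum_off, Finset.sum_mul, h.rep.sum_off, ← hCC]
    have : ∀ v ∈ Finset.range n, ((1 + ((N * 6 + 9) +
        ((((off inp (v + 1) - off inp v) * CC + 6 + ((1 + (K * 6 + 8)) + 1)) + 1) + 1))) + 1) =
        (off inp (v + 1) - off inp v) * CC + (N * 6 + K * 6 + 29) := fun v _ => by ring
    rw [Finset.sum_congr rfl this, Finset.sum_add_distrib, Finset.sum_const, Finset.card_range,
      smul_eq_mul]
    nlinarith
  refine .seq (.move hr.reg_two h3 ?_)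
  refine .seq (.move (a := 0) (by simp [hr.reg_two]) (by simp [h3]) ?_)
  refine .seq (.move (a := 0) (by simp [hr.reg_two]) (by simp [h3]) ?_)
  have hcodes : ∀ v < n, (v ∈ core G W → codes G W n (v + 1) =
      insert (code G W n v) (codes G W n v)) ∧
      (v ∉ core G W → (core G W).filter (· < v + 1) = (core G W).filter (· < v)) := by
    intro v hv
    constructor
    · intro hvc
      rw [codes, codes, ← Finset.image_insert]
      congr 1
      ext x
      simp only [Finset.mem_filter, Finset.mem_insert, Nat.lt_succ_iff_lt_or_eq]
      constructor
      · rintro ⟨h1, h2 | h2⟩ <;> tauto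
      · rintro (rfl | h1) <;> tauto
    · intro hvc
      ext x
      simp only [Finset.mem_filter, Nat.lt_succ_iff_lt_or_eq, and_congr_right_iff,
        or_iff_left_iff_imp]
      rintro hx rfl
      exact absurd hx hvc
  refine Run.loop_range (I := fun v s' => s'.top = s.top ∧
      (∀ r < 9, r ≠ 0 → s'.reg r = s.reg r) ∧ (∀ a < B, s'.mem a = s.mem a) ∧ s'.reg 10 = v ∧
      (s'.reg 0 = 0 ↔ (core G W).filter (· < v) = ∅) ∧
      ∃ E, Holds B (s'.reg 9) E s'.mem ∧ TopOf K (codes G W n v) E) _ n ?_ ?_ 0 _ (Nat.zero_le n) ?_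
  · rintro v s₁ hv ⟨ht, hreg, hmem, h10, h0, E, hE, hTop⟩
    have hr₁ : Ready n X s₁ := hr.congr ht (fun r hr hr0 => hreg r (by omega) hr0)
      (fun a ha => hmem a (by omega))
    refine ⟨by simp [Cmp.holds, h10, hr₁.reg_four, hv], ?_⟩
    refine .seq (.move h10 hr₁.reg_three ?_)
    have hF₁ : Frame 29 s₁ (s₁.setReg 29 v) := (Frame.refl 29 s₁).setReg le_rfl
    refine .bind (member_run (x := v) (hr₁.frame hF₁ (by norm_num)) (by simp)
      h.lt_pow (by omega) (by omega)) ?_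
    rintro s₂ ⟨hF₂, _, h28⟩
    have hF₂ : Frame 28 s₁ s₂ := (hF₁.mono (by norm_num)).trans hF₂
    have hr₂ := hr₁.frame hF₂ (by norm_num)
    have hskip : ∀ s₃, Frame 11 s₁ s₃ → v ∉ core G W → (s₃.top = s.top ∧
        (∀ r < 9, r ≠ 0 → s₃.reg r = s.reg r) ∧ (∀ a < B, s₃.mem a = s.mem a) ∧ s₃.reg 10 = v ∧
        (s₃.reg 0 = 0 ↔ (core G W).filter (· < v + 1) = ∅) ∧
        ∃ E, Holds B (s₃.reg 9) E s₃.mem ∧ TopOf K (codes G W n (v + 1)) E) := by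
      intro s₃ hF₃ hvc
      have hf := (hcodes v hv).2 hvc
      refine ⟨hF₃.top.trans ht, fun r hr hr0 => (hF₃.reg r (by omega)).trans (hreg r hr hr0),
        fun a ha => by rw [hF₃.mem, hmem a ha], by rw [hF₃.reg 10 (by norm_num), h10], ?_, E, ?_, ?_⟩
      · rw [hF₃.reg 0 (by norm_num), h0, hf]
      · rw [hF₃.mem, hF₃.reg 9 (by norm_num)]; exact hE
      · rw [codes, hf]; exact hTop
    refine .bind (b₂ := 1) (Q' := fun s₃ => s₃.top = s.top ∧
        (∀ r < 9, r ≠ 0 → s₃.reg r = s.reg r) ∧ (∀ a < B, s₃.mem a = s.mem a) ∧ s₃.reg 10 = v ∧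
        (s₃.reg 0 = 0 ↔ (core G W).filter (· < v + 1) = ∅) ∧
        ∃ E, Holds B (s₃.reg 9) E s₃.mem ∧ TopOf K (codes G W n (v + 1)) E) ?_ ?_
    · refine .ite (fun hc => ?_) (fun hc => ?_)
      · simp only [Cmp.holds, hr₂.reg_two, h28] at hc
        have hvW : v ∈ W := by
          rw [hW, Finset.mem_sdiff, Finset.mem_range]
          refine ⟨hv, fun hvX => ?_⟩
          rw [if_pos hvX] at hc
          omega
        refine .bind (b₂ := 1 + (K * 6 + 8) + 1)
          (countCore_run h hr₂ hvW (by rw [hF₂.reg 10 (by norm_num), h10])) ?_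
        rintro s₃ ⟨hF₃, h13⟩
        have hF₃' : Frame 11 s₁ s₃ := (hF₂.mono (by norm_num)).trans hF₃
        have hr₃ := hr₁.frame hF₃' (by norm_num)
        refine .ite (fun hc' => ?_) (fun hc' => ?_)
        · simp only [Cmp.holds, hr₃.reg_five, h13] at hc'
          have hvc : v ∈ core G W := mem_core.2 ⟨hvW, hc'⟩
          refine .seq (.const (by omega) ?_)
          have hnot : code G W n v ∉ codes G W n v := by
            intro hmem'
            obtain ⟨x, hx, hxv⟩ := Finset.mem_image.1 hmem'
            rw [Finset.mem_filter] at hx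
            have : code G W n x % n = code G W n v % n := by rw [hxv]
            rw [code_mod W hv, code_mod W (hWn x (core_subset W hx.1))] at this
            omega
          have hd := coreDeg_le h hv W
          refine (addCandidate_run (K := K) (B := B) (c := s₁.reg 9) (v := v)
            (d := coreDeg G W v) (E := E) (s := s₃.setReg 0 1)
            (hr₃.congr rfl (fun r _ hr0 => by simp [hr0]) (fun _ _ => rfl)) ?_ ?_ ?_ ?_ ?_ ?_ ?_
            ?_ ?_ hw ?_).mono le_rfl ?_
          · simp [hF₃'.reg 6, hreg 6, h6]
          · simp [hF₃'.reg 7, hreg 7, h7]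
          · simp [hF₃'.reg 9]
          · simp [hF₃'.reg 10, h10]
          · simp [h13, hW]
          · simpa [hF₃'.mem] using hE
          · rw [← hE.card]; exact hTop.card_le
          · simp only [State.top_setReg]; rw [hF₃'.top, ht]; exact htop
          · have := Nat.mul_le_mul_right n hd
            nlinarith
          · exact fun hmem' => hnot (hTop.subset hmem')
          · rintro s₄ ⟨ht₄, hreg₄, hmem₄, c', E', h9, _, hE', hins⟩
            refine ⟨?_, fun r hr' hr0 => ?_, fun a ha => ?_, ?_, ?_, E', h9 ▸ hE', ?_⟩
            · rw [ht₄, State.top_setReg, hF₃'.top, ht]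
            · rw [hreg₄ r (by omega) (by omega), State.reg_setReg, if_neg hr0,
                hF₃'.reg r (by omega), hreg r hr' hr0]
            · rw [hmem₄ a ha, State.mem_setReg, hF₃'.mem, hmem a ha]
            · rw [hreg₄ 10 (by norm_num) (by norm_num)]
              simp [hF₃'.reg 10, h10]
            · rw [hreg₄ 0 (by norm_num) (by norm_num)]
              simp only [State.reg_setReg, if_true]
              refine iff_of_false (by norm_num) fun he => ?_
              have : v ∈ (core G W).filter (· < v + 1) := by simp [hvc]
              rw [he] at this
              simp at this
            · rw [(hcodes v hv).1 hvc]
              exact hTop.insert hnot hins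
        · simp only [Cmp.holds, hr₃.reg_five, h13] at hc'
          exact (Run.skip (hskip s₃ hF₃' fun hvc => hc' (mem_core.1 hvc).2)).of_le (by omega)
      · simp only [Cmp.holds, hr₂.reg_two, h28] at hc
        refine (Run.skip (hskip s₂ (hF₂.mono (by norm_num)) fun hvc => ?_)).of_le (by omega)
        have := (Finset.mem_sdiff.1 (core_subset W hvc)).2
        rw [if_neg this] at hc
        exact hc rfl
    · rintro s₃ ⟨ht₃, hreg₃, hmem₃, h10₃, h0₃, E₃, hE₃, hTop₃⟩
      have h3₃ : s₃.reg 3 = 1 := by rw [hreg₃ 3 (by norm_num) (by norm_num), h3]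
      refine .add h10₃ h3₃ (by omega) ?_
      exact ⟨ht₃, fun r hr hr0 => by simp [show r ≠ 10 by omega, hreg₃ r hr hr0], hmem₃, by simp,
        by simpa using h0₃, E₃, by simpa using hE₃, hTop₃⟩
  · rintro s₁ ⟨ht, hreg, hmem, h10, h0, E, hE, hTop⟩
    refine ⟨by simp [Cmp.holds, h10, hreg 4, hr.reg_four], ht, hreg, hmem, ?_, E, hE, hTop⟩
    rw [h0]
    have : (core G W).filter (· < n) = core G W :=
      Finset.filter_true_of_mem fun v hv => hWn v (core_subset W hv)
    rw [this]
  · refine ⟨rfl, fun r hr hr0 => ?_, fun a _ => rfl, by simp, by simp, ∅, ⟨by simp, by simp⟩,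
      ⟨by simp, by simp, fun _ => by simp [codes], by simp⟩⟩
    simp [show r ≠ 9 by omega, show r ≠ 10 by omega, hr0]

/-- Insert all candidates into the current set. -/
def insertAll : Prog :=
  .move 17 7 ⨟ .op .add 18 7 9 ⨟
  .loop .lt 17 18 (.load 29 17 ⨟ .op .mod 29 29 4 ⨟ insertVertex ⨟ .op .add 17 17 3)

theorem insertAll_run (h : Setting w inp n N G) {s : State} (hr : Ready n X s) {B c : ℕ}
    {E : Finset ℕ} (h7 : s.reg 7 = B) (h9 : s.reg 9 = c) (hE : Holds B c E s.mem)
    (hXB : X.card + c ≤ B) (htop : B + c ≤ s.top) (hw : B + c + 1 < 2 ^ w)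
    (hmod : ∀ e ∈ E, e % n < n ∧ e % n ∉ X)
    (hinj : ∀ e ∈ E, ∀ e' ∈ E, e % n = e' % n → e = e') :
    Run w inp insertAll s (c * (N * 6 + n * 5 + 12) + 3) fun s' =>
      Ready n (X ∪ E.image (· % n)) s' ∧ s'.top = s.top ∧
      ∀ r < 17, r ≠ 1 → s'.reg r = s.reg r := by
  have h3 := hr.reg_three
  have hl := h.lin_lt
  refine Run.of_le (b := 1 + (1 + (c * ((1 + (1 + ((N * 6 + n * 5 + 8) + 1))) + 1) + 1))) ?_
    (le_of_eq (by ring))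
  refine .seq (.move h7 h3 ?_)
  refine .seq (.add (a := B) (c := c) (by simp [h7]) (by simp [h9]) (by omega) ?_)
  let Y : ℕ → Finset ℕ := fun i => X ∪ (Finset.range i).image (fun i => s.mem (B + i) % n)
  have hmemE : ∀ i < c, s.mem (B + i) ∈ E := fun i hi => (hE.mem_iff _).2 ⟨i, hi, rfl⟩
  have hYsucc : ∀ i, Y (i + 1) = insert (s.mem (B + i) % n) (Y i) := by
    intro i
    simp only [Y, Finset.range_add_one, Finset.image_insert, Finset.union_insert]
  have hYnot : ∀ i < c, s.mem (B + i) % n ∉ Y i := by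
    intro i hi hmem
    rcases Finset.mem_union.1 hmem with hX | hX
    · exact (hmod _ (hmemE i hi)).2 hX
    · obtain ⟨j, hj, hji⟩ := Finset.mem_image.1 hX
      rw [Finset.mem_range] at hj
      have := hinj _ (hmemE j (by omega)) _ (hmemE i hi) hji
      have := hE.inj j i (by omega) hi this
      omega
  have hYcard : ∀ i ≤ c, (Y i).card = X.card + i := by
    intro i
    induction i with
    | zero => simp [Y]
    | succ i ih =>
      intro hi
      rw [hYsucc, Finset.card_insert_of_notMem (hYnot i (by omega)), ih (by omega)]
      rfl
  have hYc : Y c = X ∪ E.image (· % n) := by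
    have : E = (Finset.range c).image (fun i => s.mem (B + i)) := by
      ext x
      simp [hE.mem_iff]
    rw [this, Finset.image_image]
    rfl
  refine Run.loop_range_const (I := fun i s' => Ready n (Y i) s' ∧ s'.top = s.top ∧
    (∀ r < 17, r ≠ 1 → s'.reg r = s.reg r) ∧ s'.reg 17 = B + i ∧ s'.reg 18 = B + c ∧
    ∀ a, B ≤ a → s'.mem a = s.mem a) _ _ ?_ ?_ ?_
  · rintro i s₁ hi ⟨hr₁, ht, hreg, h17, h18, hmem⟩
    refine ⟨by simp [Cmp.holds, h17, h18, hi], ?_⟩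
    obtain ⟨hm1, hm2⟩ := hmod _ (hmemE i hi)
    refine .seq (.load (v := s.mem (B + i)) h17 (hmem _ (by omega)) (by omega) ?_)
    refine .seq (.mod (a := s.mem (B + i)) (c := n) (by simp) (by simp [hr₁.reg_four]) ?_)
    have hYi := hYcard i hi.le
    have hF : Frame 29 s₁ ((s₁.setReg 29 (s.mem (B + i))).setReg 29 (s.mem (B + i) % n)) :=
      ((Frame.refl 29 s₁).setReg le_rfl).setReg le_rfl
    refine .bind (b₂ := 1) (insertVertex_run (hr₁.frame hF (by norm_num)) (by simp) hm1
      (hYnot i hi) ?_ h.lt_pow (by omega)) ?_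
    · rw [hF.top]; omega
    · rintro s₂ ⟨hr₂, ht₂, hreg₂, hmem₂⟩
      refine .add (a := B + i) (c := 1) ?_ hr₂.reg_three (by omega) ?_
      · rw [hreg₂ 17 (by norm_num) (by norm_num), hF.reg 17 (by norm_num), h17]
      · rw [← hYsucc] at hr₂
        refine ⟨hr₂.frame ((Frame.refl 17 s₂).setReg le_rfl) (by norm_num), ?_, fun r hr' hr1 => ?_,
          by simp; omega, ?_, fun a ha => ?_⟩
        · rw [State.top_setReg, ht₂, hF.top, ht]
        · rw [State.reg_setReg, if_neg (by omega), hreg₂ r (by omega) hr1, hF.reg r (by omega),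
            hreg r hr' hr1]
        · rw [State.reg_setReg, if_neg (by omega), hreg₂ 18 (by norm_num) (by norm_num),
            hF.reg 18 (by omega), h18]
        · rw [State.mem_setReg, hmem₂ a (by omega), hF.mem, hmem a ha]
  · rintro s₁ ⟨hr₁, ht, hreg, h17, h18, -⟩
    exact ⟨by simp [Cmp.holds, h17, h18], hYc ▸ hr₁, ht, hreg⟩
  · have hF : Frame 17 s ((s.setReg 17 B).setReg 18 (B + c)) :=
      ((Frame.refl 17 s).setReg le_rfl).setReg (by norm_num)
    exact ⟨by simpa [Y] using hr.frame hF (by norm_num), rfl, fun r hr' _ => hF.reg r hr', by simp,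
      by simp, fun _ _ => rfl⟩

/-- Extend the current set by the candidates, or stop with register `10` set to `0`. -/
def round : Prog :=
  collect ⨟
  .ite .eq 0 2 (.const 0 1 ⨟ .const 10 0)
    (.ite .eq 8 2 (.const 0 0 ⨟ .const 10 0)
      (insertAll ⨟ .op .sub 8 8 3 ⨟ .const 10 1))

/-- Bound on the number of steps of `round`. -/
def roundCost (n M N K : ℕ) : ℕ := collectCost n M N K + K * (N * 6 + n * 5 + 12) + 7

/-- Here j is the number of extensions still allowed. The last outcome carries the progress: a
feedback vertex set within budget j yields one within j - 1 after the extension. The list has room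
for 3k elements even when j is smaller than k, since `exists_smaller_feedback` needs only that j ≤
k. -/
theorem round_run (h : Setting w inp n N G) {s : State} (hr : Ready n X s) {k B j : ℕ}
    (h6 : s.reg 6 = 3 * k) (h7 : s.reg 7 = B) (h8 : s.reg 8 = j) (hjk : j ≤ k)
    (hXB : X.card + 3 * k * j ≤ B) (htop : B + 3 * k ≤ s.top) (hw : B + 3 * k + 1 < 2 ^ w)
    (hkw : k < 2 ^ w) :
    Run w inp round s (roundCost n (off inp n - off inp 0) N (3 * k)) fun s' => s'.top = s.top ∧
      s'.reg 6 = 3 * k ∧ s'.reg 7 = B ∧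
      ((s'.reg 10 = 0 ∧ s'.reg 0 = 1 ∧ Ready n X s' ∧ IsForestOn G (Finset.range n \ X)) ∨
        (s'.reg 10 = 0 ∧ s'.reg 0 = 0 ∧ j = 0 ∧ Ready n X s' ∧ ¬ IsForestOn G (Finset.range n \ X)) ∨
        (s'.reg 10 = 1 ∧ ∃ j' T, j = j' + 1 ∧ s'.reg 8 = j' ∧ Ready n (X ∪ T) s' ∧
          T.card ≤ 3 * k ∧ Disjoint X T ∧
          ∀ F : Finset ℕ, F.card ≤ j → IsForestOn G ((Finset.range n \ X) \ F) →
            ∃ F' : Finset ℕ, F'.card ≤ j' ∧ IsForestOn G ((Finset.range n \ (X ∪ T)) \ F'))) := by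
  have hl := h.lin_lt
  set W := Finset.range n \ X with hW
  have hWn : ∀ v ∈ W, v < n := fun v hv => by simpa using (Finset.mem_sdiff.1 hv).1
  refine Run.of_le (b := collectCost n (off inp n - off inp 0) N (3 * k) +
    ((((3 * k) * (N * 6 + n * 5 + 12) + 3 + (1 + 1)) + 1) + 1)) ?_ (by rw [roundCost]; omega)
  refine .bind (collect_run h hr h6 h7 (by omega) htop (by omega)) ?_
  rintro s₁ ⟨ht, hreg, hmem, h0, E, hE, hTop⟩
  have hr₁ : Ready n X s₁ := hr.congr ht (fun r hr hr0 => hreg r (by omega) hr0)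
    (fun a ha => hmem a (by omega))
  rw [← hW] at h0 hTop
  have h6₁ : s₁.reg 6 = 3 * k := by rw [hreg 6 (by norm_num) (by norm_num), h6]
  have h7₁ : s₁.reg 7 = B := by rw [hreg 7 (by norm_num) (by norm_num), h7]
  have h8₁ : s₁.reg 8 = j := by rw [hreg 8 (by norm_num) (by norm_num), h8]
  refine .ite (fun hc => ?_) (fun hc => ?_)
  · simp only [Cmp.holds, hr₁.reg_two, h0] at hc
    refine Run.of_le (b := 1 + 1) ?_ (by omega)
    refine .seq (.const (by omega) (.const (by omega) ?_))
    refine ⟨ht, by simp [h6₁], by simp [h7₁], Or.inl ⟨by simp, by simp, ?_,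
      isForestOn_iff_core_eq_empty.2 hc⟩⟩
    exact hr₁.congr rfl (fun r hr' hr0 => by simp [hr0, show r ≠ 10 by omega]) fun _ _ => rfl
  · simp only [Cmp.holds, hr₁.reg_two, h0] at hc
    refine .ite (fun hc' => ?_) (fun hc' => ?_)
    · simp only [Cmp.holds, hr₁.reg_two, h8₁] at hc'
      refine Run.of_le (b := 1 + 1) ?_ (by omega)
      refine .seq (.const (by omega) (.const (by omega) ?_))
      exact ⟨ht, by simp [h6₁], by simp [h7₁], Or.inr (Or.inl ⟨by simp, by simp, hc',
        hr₁.congr rfl (fun r hr' hr0 => by simp [hr0, show r ≠ 10 by omega]) fun _ _ => rfl,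
        fun hf => hc (isForestOn_iff_core_eq_empty.1 hf)⟩)⟩
    · simp only [Cmp.holds, hr₁.reg_two, h8₁] at hc'
      obtain ⟨j', rfl⟩ : ∃ j', j = j' + 1 := ⟨j - 1, by omega⟩
      have hEc := hE.card
      have hEk := hTop.card_le
      have hdec : ∀ e ∈ codes G W n n, ∃ v ∈ core G W, v < n ∧ e = code G W n v := by
        intro e he
        obtain ⟨v, hv, rfl⟩ := Finset.mem_image.1 he
        rw [Finset.mem_filter] at hv
        exact ⟨v, hv.1, hv.2, rfl⟩
      have henc : ∀ v ∈ core G W, code G W n v ∈ codes G W n n := fun v hv =>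
        Finset.mem_image.2 ⟨v, Finset.mem_filter.2 ⟨hv, hWn v (core_subset W hv)⟩, rfl⟩
      have hinj : ∀ e ∈ E, ∀ e' ∈ E, e % n = e' % n → e = e' := by
        intro e he e' he' hee
        obtain ⟨v, _, hvn, rfl⟩ := hdec e (hTop.subset he)
        obtain ⟨v', _, hvn', rfl⟩ := hdec e' (hTop.subset he')
        rw [code_mod W hvn, code_mod W hvn'] at hee
        rw [hee]
      have hT : ∀ v, v ∈ E.image (· % n) ↔ v < n ∧ code G W n v ∈ E := by
        intro v
        rw [Finset.mem_image]
        constructor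
        · rintro ⟨e, he, rfl⟩
          obtain ⟨v, _, hvn, rfl⟩ := hdec e (hTop.subset he)
          rw [code_mod W hvn]
          exact ⟨hvn, he⟩
        · rintro ⟨hvn, he⟩
          exact ⟨_, he, code_mod W hvn⟩
      have hTcore : E.image (· % n) ⊆ core G W := by
        intro v hv
        obtain ⟨hvn, he⟩ := (hT v).1 hv
        obtain ⟨v', hv', hvn', he'⟩ := hdec _ (hTop.subset he)
        have := congrArg (· % n) he'
        simp only [code_mod W hvn, code_mod W hvn'] at this
        rwa [this]
      have hTcard : (E.image (· % n)).card = E.card :=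
        Finset.card_image_of_injOn fun e he e' he' => hinj e he e' he'
      refine Run.of_le (b := s₁.reg 9 * (N * 6 + n * 5 + 12) + 3 + (1 + 1)) ?_ ?_
      rotate_left
      · have : s₁.reg 9 * (N * 6 + n * 5 + 12) ≤ (3 * k) * (N * 6 + n * 5 + 12) := by
          gcongr; omega
        omega
      -- At least one extension is still budgeted for, so the array can grow by 3k cells without
      -- running into the candidates at B.
      have hkj : 3 * k ≤ 3 * k * (j' + 1) := Nat.le_mul_of_pos_right _ (by omega)
      refine .bind (b₂ := 1 + 1) (insertAll_run h hr₁ h7₁ rfl hE (by omega) (by omega) (by omega)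
        ?_ hinj) ?_
      · intro e he
        obtain ⟨v, hv, hvn, rfl⟩ := hdec e (hTop.subset he)
        rw [code_mod W hvn]
        exact ⟨hvn, (Finset.mem_sdiff.1 (core_subset W hv)).2⟩
      · rintro s₂ ⟨hr₂, ht₂, hreg₂⟩
        refine .seq (.sub (a := j' + 1) (c := 1) ?_ hr₂.reg_three (by omega) (by omega) ?_)
        · rw [hreg₂ 8 (by norm_num) (by norm_num), h8₁]
        refine .const (by omega) ?_
        refine ⟨ht₂.trans ht, ?_, ?_, Or.inr (Or.inr ⟨by simp, j', E.image (· % n), rfl, by simp,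
          ?_, by omega, ?_, ?_⟩)⟩
        · simp [hreg₂ 6, h6₁]
        · simp [hreg₂ 7, h7₁]
        · exact hr₂.congr rfl
            (fun r hr' hr0 => by simp [show r ≠ 8 by omega, show r ≠ 10 by omega]) fun _ _ => rfl
        · rw [Finset.disjoint_left]
          intro v hvX hv
          exact (Finset.mem_sdiff.1 (core_subset W (hTcore hv))).2 hvX
        · intro F hF hfor
          have hfull : E.image (· % n) = core G W ∨ ((E.image (· % n)).card = 3 * k ∧
              ∀ v ∈ E.image (· % n), ∀ x ∈ core G W, x ∉ E.image (· % n) →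
                coreDeg G W x ≤ coreDeg G W v) := by
            rcases hEk.lt_or_eq with hlt | heq
            · left
              refine hTcore.antisymm fun v hv => ?_
              rw [hT, hTop.eq_of_lt hlt]
              exact ⟨hWn v (core_subset W hv), henc v hv⟩
            · right
              refine ⟨hTcard.trans heq, fun v hv x hx hxT => ?_⟩
              obtain ⟨hvn, hvE⟩ := (hT v).1 hv
              have hxn := hWn x (core_subset W hx)
              have := hTop.le _ hvE _ (henc x hx) fun hxE => hxT ((hT x).2 ⟨hxn, hxE⟩)
              -- Dividing codes by n turns their order into the order of the degrees.
              have := Nat.div_le_div_right (c := n) this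
              rwa [code_div W hxn, code_div W hvn] at this
          obtain ⟨F', hF', hfor'⟩ := exists_smaller_feedback (k := k) (by omega) hfor
            (Finset.nonempty_iff_ne_empty.2 hc) hTcore hfull
          refine ⟨F', by omega, hfor'.mono ?_⟩
          rw [hW, Finset.sdiff_union_distrib]
          intro x
          simp only [Finset.mem_sdiff, Finset.mem_inter]
          tauto

end Round

end ROWordRAM

namespace ROWordRAM

/-! ### The complete program -/

section Solver

variable {w n N k : ℕ} {inp : List ℕ} {G : SimpleGraph ℕ}

/-- For the accesses that raise the high-water mark: those of `returnAll`, and the single one in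
`search` that reserves the memory. -/
theorem Run.store_touch {w : ℕ} {inp : List ℕ} {s : State} {Q : State → Prop} {x y a v : ℕ}
    (hx : s.reg x = a) (hy : s.reg y = v) (h : Q ((s.touch a).setMem a v)) :
    Run w inp (.store x y) s 1 Q :=
  ⟨_, 1, .store s x y, le_rfl, by rwa [hx, hy]⟩

/-- The set `F` of at most `k` vertices meets all cycles of the graph `G` on `{0, …, n - 1}`. -/
def Solvable (G : SimpleGraph ℕ) (n k : ℕ) : Prop :=
  ∃ F : Finset ℕ, F.card ≤ k ∧ IsForestOn G (Finset.range n \ F)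

/-- The state holds an answer for the instance with the graph `G` on `{0, …, n - 1}` and the
parameter `k`, and only cells that fit into the space bound have been accessed. -/
def Solved (G : SimpleGraph ℕ) (n k : ℕ) (s : State) : Prop :=
  s.top ≤ 3 * k * k + 3 * k + 1 ∧
  ((s.reg 0 = 1 ∧ ∃ X ⊆ Finset.range n, (Finset.range (s.reg 1)).image s.mem = X ∧
      X.card ≤ 3 * k * k ∧ IsForestOn G (Finset.range n \ X)) ∨
    (s.reg 0 = 0 ∧ ¬ Solvable G n k))

/-- Return the set of all vertices. -/
def returnAll : Prog :=
  .move 1 4 ⨟ .const 0 1 ⨟ .const 10 0 ⨟ .loop .lt 10 4 (.store 10 10 ⨟ .op .add 10 10 3)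

theorem isForestOn_empty : IsForestOn G (∅ : Finset ℕ) := by
  rintro S hS ⟨x, hx⟩
  exact absurd (hS hx) (Finset.notMem_empty x)

theorem returnAll_run (hw : n + 1 < 2 ^ w) {s : State} (h3 : s.reg 3 = 1) (h4 : s.reg 4 = n)
    (ht : s.top = 0) (hn : n ≤ 3 * k * k) :
    Run w inp returnAll s (n * 3 + 4) (Solved G n k) := by
  refine Run.of_le (b := 1 + (1 + (1 + (n * (1 + 1 + 1) + 1)))) ?_ (by omega)
  refine .seq (.move h4 h3 ?_)
  refine .seq (.const (by omega) ?_)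
  refine .seq (.const (by omega) ?_)
  refine Run.loop_range_const (I := fun i s' => s'.reg 0 = 1 ∧ s'.reg 1 = n ∧ s'.reg 3 = 1 ∧
    s'.reg 4 = n ∧ s'.reg 10 = i ∧ s'.top ≤ i ∧ ∀ a < i, s'.mem a = a) _ n ?_ ?_ ?_
  · rintro i s₁ hi ⟨h0, h1, h3, h4, h10, ht, hmem⟩
    refine ⟨by simp [Cmp.holds, h10, h4, hi], ?_⟩
    refine .seq (.store_touch h10 h10 ?_)
    refine .add (a := i) (c := 1) h10 h3 (by omega) ?_
    refine ⟨by simpa [State.touch] using h0, by simpa [State.touch] using h1,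
      by simpa [State.touch] using h3, by simpa [State.touch] using h4, by simp,
      by simp [State.touch]; omega, fun a ha => ?_⟩
    rw [State.mem_setReg, State.mem_setMem, Function.update_apply]
    split_ifs with h
    · exact h.symm
    · exact hmem a (by omega)
  · rintro s₁ ⟨h0, h1, h3, h4, h10, ht, hmem⟩
    refine ⟨by simp [Cmp.holds, h10, h4], by omega, Or.inl ⟨h0, Finset.range n, subset_rfl, ?_, ?_,
      ?_⟩⟩
    · rw [h1]
      ext x
      simp only [Finset.mem_image, Finset.mem_range]
      constructor
      · rintro ⟨a, ha, rfl⟩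
        rwa [hmem a ha]
      · exact fun hx => ⟨x, hx, hmem x hx⟩
    · rwa [Finset.card_range]
    · rw [Finset.sdiff_self]
      exact isForestOn_empty
  · exact ⟨by simp, by simp, by simp [h3], by simp [h4], by simp, by simp [ht], by simp⟩

/-- Extend the empty set for as long as necessary and possible. -/
def search : Prog :=
  .op .add 33 4 5 ⨟ .read 32 33 ⨟ .op .add 33 33 3 ⨟ .op .sub 32 32 33 ⨟
  .op .add 31 10 3 ⨟ .op .mul 31 31 4 ⨟ .op .mul 31 31 5 ⨟
  .ite .lt 31 32 (.const 0 0)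
    (.op .add 33 7 6 ⨟ .store 33 2 ⨟ .const 1 0 ⨟ .move 8 10 ⨟ .const 0 0 ⨟ .const 10 1 ⨟
      .loop .ne 10 2 round)

theorem roundCost_mono {M M' K : ℕ} (h : M ≤ M') :
    roundCost n M N K ≤ roundCost n M' N K := by
  unfold roundCost collectCost checkCost
  gcongr

theorem not_solvable_of_lt (h : Represents inp n G)
    (hM : (k + 1) * n * 2 < off inp n - off inp 0) : ¬ Solvable G n k := by
  rintro ⟨F, hF, hfor⟩
  have h1 := sum_card_nbrs_le_of_feedback hF hfor
  rw [← Finset.sum_congr rfl fun v hv => h.degree_eq (Finset.mem_range.1 hv), h.sum_off,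
    Finset.card_range] at h1
  omega

theorem search_run (h : Setting w inp n N G) {s : State} (h2 : s.reg 2 = 0) (h3 : s.reg 3 = 1)
    (h4 : s.reg 4 = n) (h5 : s.reg 5 = 2) (h6 : s.reg 6 = 3 * k) (h7 : s.reg 7 = 3 * k * k)
    (h10 : s.reg 10 = k) (ht : s.top = 0) (hk : 3 * k * k < n) :
    Run w inp search s ((k + 1) * (roundCost n ((k + 1) * n * 2) N (3 * k) + 1) + 15)
      (Solved G n k) := by
  have hl := h.lin_lt
  have hkn : k < n := by nlinarith [Nat.le_mul_self k]
  have hkw : (k + 1) * n * 2 < 2 ^ w := by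
    have := h.small
    nlinarith
  have ho := h.off_lt (le_refl n)
  have ho' := h.rep.off_mono (Nat.zero_le n) le_rfl
  have hkn' : (k + 1) * n < 2 ^ w := by omega
  rw [h.rep.off_zero] at ho'
  refine Run.of_le (b := 1 + (1 + (1 + (1 + (1 + (1 + (1 + ((1 + (1 + (1 + (1 + (1 + (1 +
    ((k + 1) * (roundCost n ((k + 1) * n * 2) N (3 * k) + 1) + 1))))))) + 1)))))))) ?_ (by omega)
  refine .seq (.add h4 h5 (by omega) ?_)
  refine .seq (.read (a := n + 2) (by simp) (v := off inp n) rfl (by omega) ?_)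
  refine .seq (.add (a := n + 2) (c := 1) (by simp) (by simp [h3]) (by omega) ?_)
  refine .seq (.sub (a := off inp n) (c := n + 2 + 1) (by simp) (by simp) (by omega) (by omega) ?_)
  refine .seq (.add (a := k) (c := 1) (by simp [h10]) (by simp [h3]) (by omega) ?_)
  refine .seq (.mul (a := k + 1) (c := n) (by simp) (by simp [h4]) (by omega) ?_)
  refine .seq (.mul (a := (k + 1) * n) (c := 2) (by simp) (by simp [h5]) (by omega) ?_)
  refine .ite (fun hc => ?_) (fun hc => ?_)
  · simp [Cmp.holds] at hc
    refine Run.of_le (b := 1) (.const (by omega) ?_) (by omega)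
    refine ⟨by simp [ht], Or.inr ⟨by simp, not_solvable_of_lt h.rep ?_⟩⟩
    rw [h.rep.off_zero]
    omega
  · simp [Cmp.holds] at hc
    have hM : off inp n - off inp 0 ≤ (k + 1) * n * 2 := by rw [h.rep.off_zero]; omega
    refine .seq (.add (a := 3 * k * k) (c := 3 * k) (by simp [h7]) (by simp [h6]) (by omega) ?_)
    -- A dummy access to the cell just past X and the candidates fixes the space used for the rest
    -- of the run.
    refine .seq (.store_touch (a := 3 * k * k + 3 * k) (v := 0) (by simp) (by simp [h2]) ?_)
    refine .seq (.const (by omega) ?_)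
    refine .seq (.move (a := k) (by simp [State.touch, h10]) (by simp [State.touch, h3]) ?_)
    refine .seq (.const (by omega) ?_)
    refine .seq (.const (by omega) ?_)
    -- While the search is active, j extensions remain, and the fuel is j + 1 because the last round
    -- only tests the core. A solvable instance keeps a feedback vertex set of size at most j for
    -- the rest. The two other alternatives describe a finished search.
    refine Run.loop (I := fun f s' => s'.top = 3 * k * k + 3 * k + 1 ∧ s'.reg 6 = 3 * k ∧
      s'.reg 7 = 3 * k * k ∧ ∃ X, Ready n X s' ∧
      ((s'.reg 10 = 1 ∧ ∃ j, f = j + 1 ∧ s'.reg 8 = j ∧ j ≤ k ∧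
          X.card + 3 * k * j ≤ 3 * k * k ∧
          (Solvable G n k →
            ∃ F : Finset ℕ, F.card ≤ j ∧ IsForestOn G ((Finset.range n \ X) \ F))) ∨
        (s'.reg 10 = 0 ∧ s'.reg 0 = 1 ∧ X.card ≤ 3 * k * k ∧ IsForestOn G (Finset.range n \ X)) ∨
        (s'.reg 10 = 0 ∧ s'.reg 0 = 0 ∧ ¬ Solvable G n k)))
      (roundCost n ((k + 1) * n * 2) N (3 * k)) ?_ (k + 1) _ ?_ ?_
    · rintro f s₁ ⟨ht₁, h6₁, h7₁, X, hr, hcase⟩ hc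
      simp only [Cmp.holds, hr.reg_two] at hc
      obtain ⟨h10, j, rfl, h8, hjk, hX, hF⟩ := hcase.resolve_right (by omega)
      refine ⟨j, rfl, ?_⟩
      refine (round_run h hr h6₁ h7₁ h8 hjk hX (by omega) (by omega) (by omega)).mono
        (roundCost_mono hM) ?_
      rintro s₂ ⟨ht₂, h6₂, h7₂, ⟨h10, h0, hr₂, hfor⟩ | ⟨h10, h0, rfl, hr₂, hfor⟩ |
        ⟨h10, j, T, rfl, h8, hr₂, hT, hdisj, hstep⟩⟩
      · exact ⟨ht₂.trans ht₁, h6₂, h7₂, X, hr₂, Or.inr (Or.inl ⟨h10, h0, by omega, hfor⟩)⟩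
      · refine ⟨ht₂.trans ht₁, h6₂, h7₂, X, hr₂, Or.inr (Or.inr ⟨h10, h0, fun hs => hfor ?_⟩)⟩
        obtain ⟨F, hF, hfor⟩ := hF hs
        rw [Nat.le_zero, Finset.card_eq_zero] at hF
        rwa [hF, Finset.sdiff_empty] at hfor
      · refine ⟨ht₂.trans ht₁, h6₂, h7₂, X ∪ T, hr₂, Or.inl ⟨h10, j, rfl, h8, by omega, ?_,
          fun hs => ?_⟩⟩
        · rw [Finset.card_union_of_disjoint hdisj]
          rw [Nat.mul_succ] at hX
          omega
        · obtain ⟨F, hF, hfor⟩ := hF hs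
          exact hstep F hF hfor
    · refine ⟨by simp [State.touch, ht], by simp [State.touch, h6], by simp [State.touch, h7], ∅,
        ?_, Or.inl ⟨by simp, k, rfl, by simp [State.touch], le_rfl, by simp, fun hs => ?_⟩⟩
      · constructor <;> simp [State.touch, *]
      · simpa [Solvable] using hs
    · rintro f s₁ ⟨ht₁, -, -, X, hr, hcase⟩ hc
      simp only [Cmp.holds, hr.reg_two, not_not] at hc
      refine ⟨ht₁.le, ?_⟩
      rcases hcase with ⟨h10, -⟩ | ⟨-, h0, hX, hfor⟩ | ⟨-, h0, hs⟩
      · omega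
      · refine Or.inl ⟨h0, X, hr.subset, ?_, hX, hfor⟩
        rw [hr.reg_one]
        ext x
        simp [hr.mem_iff]
      · exact Or.inr ⟨h0, hs⟩

/-- The program for Feedback Vertex Set. -/
def solve : Prog :=
  .const 3 1 ⨟ .const 2 0 ⨟ .const 5 2 ⨟ .read 4 2 ⨟ .read 10 3 ⨟
  .ite .le 4 10 returnAll
    (.const 6 3 ⨟ .op .mul 6 6 10 ⨟ .op .mul 7 6 10 ⨟ .ite .le 4 7 returnAll search)

/-- The cost b of the search has to be bounded only when 3k² < n, since otherwise all vertices are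
returned; `search_cost_le` depends on this. -/
theorem solve_run (h : Setting w inp n N G) (hk : inp.getD 1 0 = k) (hkw : k < 2 ^ w) {b : ℕ}
    (hb : 3 * k * k < n → (k + 1) * (roundCost n ((k + 1) * n * 2) N (3 * k) + 1) ≤ b) :
    Run w inp solve State.init (b + n * 3 + 25) (Solved G n k) := by
  have hl := h.lin_lt
  refine Run.of_le (b := 1 + (1 + (1 + (1 + (1 + ((1 + (1 + (1 + (b + n * 3 + 15 + 1)))) + 1))))))
    ?_ (by omega)
  refine .seq (.const (by omega) ?_)
  refine .seq (.const (by omega) ?_)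
  refine .seq (.const (by omega) ?_)
  refine .seq (.read (a := 0) (by simp) h.rep.head (by omega) ?_)
  refine .seq (.read (a := 1) (by simp) hk hkw ?_)
  -- Only k < 2 ^ w is known, so 3k² might overflow. Hence n ≤ k is tested first, and 3k² is
  -- computed only if k < n.
  refine .ite (fun hc => ?_) (fun hc => ?_)
  · simp [Cmp.holds] at hc
    refine Run.of_le (returnAll_run (by omega) (by simp) (by simp) rfl ?_) (by omega)
    nlinarith [Nat.le_mul_self k]
  · simp [Cmp.holds] at hc
    have hs := h.small
    have hkk : 3 * k * k < 2 ^ w := by nlinarith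
    refine .seq (.const (by omega) ?_)
    refine .seq (.mul (a := 3) (c := k) (by simp) (by simp) (by omega) ?_)
    refine .seq (.mul (a := 3 * k) (c := k) (by simp) (by simp) (by omega) ?_)
    refine .ite (fun hc' => ?_) (fun hc' => ?_)
    · simp [Cmp.holds] at hc'
      exact Run.of_le (returnAll_run (by omega) (by simp) (by simp) rfl hc') (by omega)
    · simp [Cmp.holds] at hc'
      have := hb hc'
      exact Run.of_le (search_run h (by simp) (by simp) (by simp) (by simp) (by simp) (by simp)
        (by simp) rfl hc') (by omega)

end Solver

end ROWordRAM

namespace ROWordRAM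

/-! ### The input encoding represents the graph -/

section Encode

variable {n : ℕ} (G : SimpleGraph (Fin n)) (k : ℕ)

theorem encode_getD_zero : (encode G k).getD 0 0 = n := rfl

theorem encode_getD_one : (encode G k).getD 1 0 = k := rfl

theorem off_encode {i : ℕ} (hi : i ≤ n) : off (encode G k) i =
    n + 3 + (((List.finRange n).take i).flatMap (neighborList G)).length := by
  rw [off, encode, List.append_assoc, List.getD_append_right _ _ _ _ (by simp)]
  rw [List.getD_append _ _ _ _ (by simp; omega)]
  simp [List.getD_eq_getElem?_getD, Nat.lt_succ_of_le hi]

theorem encode_getD_add (j : ℕ) : (encode G k).getD (n + 3 + j) 0 =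
    (((List.finRange n).flatMap (neighborList G)).map Fin.val).getD j 0 := by
  have he : encode G k = ([n, k] ++ (List.range (n + 1)).map
      (fun i => n + 3 + (((List.finRange n).take i).flatMap (neighborList G)).length)) ++
      ((List.finRange n).flatMap (neighborList G)).map Fin.val := by
    rw [encode]
    simp [List.map_eq_flatMap]
  rw [he, List.getD_append_right _ _ _ _ (by simp)]
  congr 1
  simp

theorem flatMap_take_succ (v : Fin n) :
    ((List.finRange n).take (v + 1)).flatMap (neighborList G) =
      ((List.finRange n).take v).flatMap (neighborList G) ++ neighborList G v := by
  rw [List.take_add_one]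
  simp

theorem off_encode_succ (v : Fin n) : off (encode G k) (v + 1) =
    off (encode G k) v + (neighborList G v).length := by
  rw [off_encode G k v.2, off_encode G k v.2.le, flatMap_take_succ, List.length_append]
  omega

theorem encode_getD_off (v : Fin n) {j : ℕ} (hj : j < (neighborList G v).length) :
    (encode G k).getD (off (encode G k) v + j) 0 = (neighborList G v)[j] := by
  rw [off_encode G k v.2.le, Nat.add_assoc, encode_getD_add]
  have hsplit : (List.finRange n).flatMap (neighborList G) =
      ((List.finRange n).take v).flatMap (neighborList G) ++ (neighborList G v ++
        ((List.finRange n).drop (v + 1)).flatMap (neighborList G)) := by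
    rw [← List.append_assoc, ← flatMap_take_succ, ← List.flatMap_append, List.take_append_drop]
  rw [hsplit, List.map_append, List.map_append, List.getD_append_right _ _ _ _ (by simp)]
  rw [List.length_map, Nat.add_sub_cancel_left, List.getD_append _ _ _ _ (by simpa using hj)]
  simp [List.getD_eq_getElem?_getD, hj]

theorem mem_neighborList {v u : Fin n} : u ∈ neighborList G v ↔ G.Adj v u := by
  simp [neighborList]

theorem pairwise_neighborList (v : Fin n) : (neighborList G v).Pairwise (· < ·) :=
  (List.pairwise_lt_finRange n).filter _

theorem represents_encode :
    Represents (encode G k) n (G.map Fin.valEmbedding) := by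
  refine ⟨encode_getD_zero G k, ?_, fun i hi => ?_, fun v hv u => ?_, fun v hv p q hp hpq hq => ?_,
    fun v u => ?_⟩
  · rw [off_encode G k (Nat.zero_le n)]
    simp
  · rw [off_encode_succ G k ⟨i, hi⟩]
    exact Nat.le_add_right _ _
  · have hs := off_encode_succ G k ⟨v, hv⟩
    have ho := fun j => encode_getD_off G k ⟨v, hv⟩ (j := j)
    simp only at hs ho
    rw [SimpleGraph.map_adj]
    constructor
    · rintro ⟨a, b, hab, rfl, rfl⟩
      obtain ⟨j, hj, hb⟩ := List.getElem_of_mem ((mem_neighborList G).2 hab)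
      refine ⟨off (encode G k) a + j, Nat.le_add_right _ _, ?_, ?_⟩
      · have := off_encode_succ G k a
        simp only [Fin.valEmbedding_apply]
        omega
      · rw [encode_getD_off G k a hj, hb]
        rfl
    · rintro ⟨p, hp, hp', rfl⟩
      obtain ⟨j, rfl⟩ := Nat.exists_eq_add_of_le hp
      have hj : j < (neighborList G ⟨v, hv⟩).length := by omega
      rw [ho j hj]
      exact ⟨⟨v, hv⟩, _, (mem_neighborList G).1 (List.getElem_mem hj), rfl, rfl⟩
  · have hs := off_encode_succ G k ⟨v, hv⟩
    have ho := fun j => encode_getD_off G k ⟨v, hv⟩ (j := j)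
    simp only at hs ho
    obtain ⟨i, rfl⟩ := Nat.exists_eq_add_of_le hp
    obtain ⟨j, rfl⟩ := Nat.exists_eq_add_of_le (hp.trans hpq.le)
    rw [ho i (by omega), ho j (by omega)]
    exact List.pairwise_iff_getElem.1 (pairwise_neighborList G ⟨v, hv⟩) i j (by omega) (by omega)
      (by omega)
  · rw [SimpleGraph.map_adj]
    rintro ⟨a, b, -, rfl, -⟩
    exact a.2

/-- The programs treat vertices as numbers, so the graph is carried to ℕ; neighbourhoods commute
with the embedding, and being a forest is stated through neighbourhoods alone. -/
theorem isFeedbackVertexSet_iff (X : Finset (Fin n)) :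
    IsFeedbackVertexSet G (X : Set (Fin n)) ↔
      IsForestOn (G.map Fin.valEmbedding) (Finset.range n \ X.map Fin.valEmbedding) := by
  rw [IsFeedbackVertexSet, ← Finset.coe_compl, ← isForestOn_iff_isAcyclic]
  have hmap : Finset.range n \ X.map Fin.valEmbedding = Xᶜ.map Fin.valEmbedding := by
    ext x
    simp only [Finset.mem_sdiff, Finset.mem_range, Finset.mem_map, Finset.mem_compl,
      Fin.valEmbedding_apply]
    constructor
    · rintro ⟨hx, hX⟩
      exact ⟨⟨x, hx⟩, fun h => hX ⟨_, h, rfl⟩, rfl⟩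
    · rintro ⟨a, ha, rfl⟩
      exact ⟨a.2, fun ⟨b, hb, hba⟩ => ha (Fin.ext hba ▸ hb)⟩
  have hnbrs : ∀ (S : Finset (Fin n)) v, nbrs (G.map Fin.valEmbedding) (S.map Fin.valEmbedding)
      (Fin.valEmbedding v) = (nbrs G S v).map Fin.valEmbedding := by
    intro S v
    ext x
    simp only [mem_nbrs, Finset.mem_map]
    constructor
    · rintro ⟨⟨a, ha, rfl⟩, h⟩
      exact ⟨a, ⟨ha, SimpleGraph.map_adj_apply.1 h⟩, rfl⟩
    · rintro ⟨a, ⟨ha, h⟩, rfl⟩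
      exact ⟨⟨a, ha, rfl⟩, SimpleGraph.map_adj_apply.2 h⟩
  rw [hmap]
  constructor
  · intro h S hS hne
    obtain ⟨S, hS', rfl⟩ := Finset.subset_map_iff.1 hS
    obtain ⟨v, hv, hc⟩ := h S hS' (Finset.map_nonempty.1 hne)
    exact ⟨Fin.valEmbedding v, Finset.mem_map_of_mem _ hv, by rwa [hnbrs, Finset.card_map]⟩
  · intro h S hS hne
    obtain ⟨v, hv, hc⟩ := h (S.map _) (Finset.map_subset_map.2 hS) (hne.map)
    obtain ⟨v, hv', rfl⟩ := Finset.mem_map.1 hv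
    exact ⟨v, hv', by rwa [hnbrs, Finset.card_map] at hc⟩

theorem exists_map_eq {X : Finset ℕ} (hX : X ⊆ Finset.range n) :
    ∃ Y : Finset (Fin n), Y.map Fin.valEmbedding = X := by
  refine ⟨Finset.univ.filter fun v => (v : ℕ) ∈ X, ?_⟩
  ext x
  simp only [Finset.mem_map, Finset.mem_filter, Finset.mem_univ, true_and, Fin.valEmbedding_apply]
  exact ⟨fun ⟨a, ha, h⟩ => h ▸ ha, fun hx => ⟨⟨x, Finset.mem_range.1 (hX hx)⟩, hx, rfl⟩⟩

theorem IsYesInstance.solvable (h : IsYesInstance G k) : Solvable (G.map Fin.valEmbedding) n k := by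
  obtain ⟨F, hF, hfor⟩ := h
  exact ⟨F.map Fin.valEmbedding, by rwa [Finset.card_map], (isFeedbackVertexSet_iff G F).1 hfor⟩

end Encode

/-! ### Arithmetic of the bounds -/

section Bounds

theorem one_le_lg (x : ℕ) : 1 ≤ lg x :=
  Nat.log_pos (by norm_num) (by omega)

theorem add_three_le_two_pow_lg (x : ℕ) : x + 3 ≤ 2 ^ (lg x + 1) :=
  Nat.lt_pow_succ_log_self (by norm_num) (x + 2)

theorem sq_le_two_mul_two_pow (m : ℕ) : m * m ≤ 2 * 2 ^ m := by
  rcases lt_or_ge m 4 with h | h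
  · interval_cases m <;> norm_num
  · induction m, h using Nat.le_induction with
    | base => norm_num
    | succ m hm ih => rw [pow_succ]; nlinarith

/-- If n is below a fixed power of k, then log n = O(log k) and k² = O(n). Otherwise k² and log n
are both O(√n), so that the product is already O(n). -/
theorem sq_mul_lg_le {n k : ℕ} (h : 3 * k * k < n) :
    (k + 1) * (k + 1) * lg n ≤ 32 * ((n + 1) * lg k) := by
  have hk := one_le_lg k
  rcases lt_or_ge (n + 2) ((k + 2) ^ 4) with hlt | hge
  · have h1 : lg n ≤ 8 * lg k := by
      have h2 : lg n < 4 * (lg k + 1) := by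
        refine Nat.log_lt_of_lt_pow (by omega) (hlt.trans_le ?_)
        rw [mul_comm 4, pow_mul]
        exact Nat.pow_le_pow_left ((Nat.le_succ _).trans (add_three_le_two_pow_lg k)) 4
      omega
    have h3 : (k + 1) * (k + 1) ≤ 4 * (n + 1) := by nlinarith
    calc _ ≤ 4 * (n + 1) * (8 * lg k) := Nat.mul_le_mul h3 h1
      _ = _ := by ring
  · have h1 : 2 ^ lg n ≤ n + 2 := Nat.pow_log_le_self 2 (by omega)
    have h2 := sq_le_two_mul_two_pow (lg n)
    have h3 : (k + 1) * (k + 1) * lg n ≤ 2 * (n + 2) := by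
      refine Nat.mul_self_le_mul_self_iff.1 ?_
      calc _ = (k + 1) ^ 4 * (lg n * lg n) := by ring
        _ ≤ (n + 2) * (2 * (n + 2)) := by
          refine Nat.mul_le_mul ((Nat.pow_le_pow_left (by omega) 4).trans hge) (h2.trans (by omega))
        _ ≤ _ := by nlinarith
    nlinarith

theorem search_cost_le {n k : ℕ} (h : 3 * k * k < n) :
    (k + 1) * (roundCost n ((k + 1) * n * 2) (lg n + 1) (3 * k) + 1) ≤
      15200 * ((n + 1) ^ 4 * (k + 1) * lg k) := by
  have key := sq_mul_lg_le h
  have hL := one_le_lg n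
  set L := lg n
  set l := lg k
  -- Each term is dominated by the single monomial; 475, like 157 below, is the sum of the
  -- coefficients.
  have hround : roundCost n ((k + 1) * n * 2) (L + 1) (3 * k) + 1 ≤
      475 * ((k + 1) ^ 2 * (n + 1) ^ 3 * L) := by
    have hN : (L + 1) * 12 + 35 ≤ 59 * L := by omega
    generalize hκ : k + 1 = κ
    generalize hm : n + 1 = m
    have hκ1 : 1 ≤ κ := by omega
    have hm1 : 1 ≤ m := by omega
    have hnm : n ≤ m := by omega
    have hκκ : κ ≤ κ ^ 2 := Nat.le_self_pow (by norm_num) κ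
    have hmm : m ≤ m ^ 2 := Nat.le_self_pow (by norm_num) m
    have hmm' : m ≤ m ^ 3 := Nat.le_self_pow (by norm_num) m
    have hcheck : checkCost n (κ * n * 2) (L + 1) ≤ 157 * (κ * m ^ 2 * L) := by
      have e1 : m ≤ κ * m ^ 2 * L := by
        calc m = 1 * m * 1 := by ring
          _ ≤ κ * m ^ 2 * L := by gcongr
      have e2 : L ≤ κ * m ^ 2 * L := by
        calc L = 1 * 1 * L := by ring
          _ ≤ κ * m ^ 2 * L := by gcongr; exact Nat.one_le_pow _ _ hm1
      calc _ ≤ m * (κ * m * 2 * (59 * L) + 7) + (L + 1) * 6 + 20 := by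
            unfold checkCost; gcongr
        _ = 118 * (κ * m ^ 2 * L) + 7 * m + 6 * L + 26 := by ring
        _ ≤ _ := by omega
    have e1 : m ≤ κ ^ 2 * m ^ 3 * L := by
      calc m = 1 * m * 1 := by ring
        _ ≤ κ ^ 2 * m ^ 3 * L := by gcongr; exact Nat.one_le_pow _ _ hκ1
    have e2 : m * L ≤ κ ^ 2 * m ^ 3 * L := by
      calc m * L = 1 * m * L := by ring
        _ ≤ κ ^ 2 * m ^ 3 * L := by gcongr; exact Nat.one_le_pow _ _ hκ1
    have e3 : m * κ ≤ κ ^ 2 * m ^ 3 * L := by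
      calc m * κ = κ * m * 1 := by ring
        _ ≤ κ ^ 2 * m ^ 3 * L := by gcongr
    have e4 : κ * L ≤ κ ^ 2 * m ^ 3 * L := by
      calc κ * L = κ * 1 * L := by ring
        _ ≤ κ ^ 2 * m ^ 3 * L := by gcongr; exact Nat.one_le_pow _ _ hm1
    calc _ ≤ κ * m * 2 * (157 * (κ * m ^ 2 * L)) +
          m * ((L + 1) * 6 + 3 * κ * 6 + 32) + 4 +
          3 * κ * ((L + 1) * 6 + m * 5 + 12) + 7 + 1 := by
            unfold roundCost collectCost; gcongr <;> omega
      _ = 314 * (κ ^ 2 * m ^ 3 * L) + 6 * (m * L) + 38 * m + 33 * (m * κ) +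
          18 * (κ * L) + 54 * κ + 12 := by ring
      _ ≤ _ := by
        have : κ ≤ m * κ := Nat.le_mul_of_pos_left _ hm1
        omega
  calc _ ≤ (k + 1) * (475 * ((k + 1) ^ 2 * (n + 1) ^ 3 * L)) := Nat.mul_le_mul_left _ hround
    _ = 475 * ((k + 1) * (n + 1) ^ 3) * ((k + 1) * (k + 1) * L) := by ring
    -- This is where k² log n is traded for n log k; 15200 is 475 · 32.
    _ ≤ 475 * ((k + 1) * (n + 1) ^ 3) * (32 * ((n + 1) * l)) := Nat.mul_le_mul_left _ key
    _ = _ := by ring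

end Bounds

end ROWordRAM

/-- There is one program, with constants `c` and `C`, that on every instance `(G, k)` and for every
word size `w` between `c log n` and `a log n` in which `k` fits halts within
`C n ^ 4 k log k` steps, uses at most `C a k ^ 2 log n` bits, and either returns a feedback vertex
set with at most `3 k ^ 2` vertices, or answers correctly that `(G, k)` is a no-instance. (In the
bounds, `n`, `k` and the logarithms are shifted so as not to vanish for `n, k ≤ 1`.) -/
theorem mainTheorem4 :
    ∃ (P : ROWordRAM.Prog) (c C : ℕ),
      ∀ (n : ℕ) (G : SimpleGraph (Fin n)) (k w a : ℕ),
        c * ROWordRAM.lg n ≤ w → w ≤ a * ROWordRAM.lg n → k < 2 ^ w →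
        ∃ (s : ROWordRAM.State) (t : ℕ),
          ROWordRAM.Exec w (ROWordRAM.encode G k) P ROWordRAM.State.init s t ∧
          t ≤ C * ((n + 1) ^ 4 * (k + 1) * ROWordRAM.lg k) ∧
          ROWordRAM.spaceBits w P s ≤ C * a * ((k + 1) ^ 2 * ROWordRAM.lg n) ∧
          ((∃ X : Finset (Fin n), ROWordRAM.Returns s X ∧ X.card ≤ 3 * k ^ 2 ∧
              ROWordRAM.IsFeedbackVertexSet G (X : Set (Fin n))) ∨
            (ROWordRAM.AnswersNo s ∧ ¬ ROWordRAM.IsYesInstance G k)) := by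
  open ROWordRAM in
  -- The factor 6 comes from 2 + 2(lg n + 1) ≤ 6 lg n, which makes words large enough for 4(n + 3)².
  -- The number 15228 is 15200 for the search plus 28 for the remaining 3n + 25 steps; the registers
  -- are added for the space bound.
  refine ⟨solve, 6, solve.numRegs + 15228, fun n G k w a hw hwa hk => ?_⟩
  have hset : Setting w (encode G k) n (lg n + 1) (G.map Fin.valEmbedding) := by
    have h1 := add_three_le_two_pow_lg n
    refine ⟨represents_encode G k, ?_, by omega⟩
    have hlg := one_le_lg n
    calc _ ≤ 2 ^ 2 * (2 ^ (lg n + 1) * 2 ^ (lg n + 1)) := by gcongr; norm_num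
      _ = 2 ^ (2 + ((lg n + 1) + (lg n + 1))) := by rw [pow_add 2 2, pow_add 2 (lg n + 1)]
      _ ≤ 2 ^ w := Nat.pow_le_pow_right (by norm_num) (by omega)
  obtain ⟨s, t, hexec, ht, htop, hsol⟩ :=
    solve_run hset (encode_getD_one G k) hk (fun h => search_cost_le h)
  refine ⟨s, t, hexec, ?_, ?_, ?_⟩
  · have h1 : n + 1 ≤ (n + 1) ^ 4 * (k + 1) * lg k := by
      calc n + 1 = (n + 1) * 1 * 1 := by ring
        _ ≤ _ := by
          gcongr
          · exact Nat.le_self_pow (by norm_num) _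
          · omega
          · exact one_le_lg k
    calc t ≤ 15228 * ((n + 1) ^ 4 * (k + 1) * lg k) := by omega
      _ ≤ _ := Nat.mul_le_mul_right _ (Nat.le_add_left _ _)
  · have h1 : s.top ≤ 15228 * (k + 1) ^ 2 := by nlinarith
    have h2 : solve.numRegs ≤ solve.numRegs * (k + 1) ^ 2 :=
      Nat.le_mul_of_pos_right _ (by positivity)
    calc _ ≤ (solve.numRegs * (k + 1) ^ 2 + 15228 * (k + 1) ^ 2) * (a * lg n) := by
          unfold spaceBits
          gcongr
      _ = _ := by ring
  · rcases hsol with ⟨h0, X, hX, himg, hcard, hfor⟩ | ⟨h0, hno⟩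
    · obtain ⟨Y, rfl⟩ := exists_map_eq hX
      refine Or.inl ⟨Y, ⟨h0, himg⟩, ?_, (isFeedbackVertexSet_iff G Y).2 hfor⟩
      rw [Finset.card_map] at hcard
      rwa [pow_two, ← mul_assoc]
    · exact Or.inr ⟨h0, fun h => hno (h.solvable G k)⟩
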